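/- **Setting.** An $L$-density of a binary-input memoryless output-symmetric (BMS) channel is a probability measure $\mathsf a$ on $(-\infty,+\infty]$ that is symmetric, $\mathsf a(-w)=e^{-w}\mathsf a(w)$ on $\mathbb R$. Let $\Delta_0,\Delta_\infty$ be the point masses at $0$ and $+\infty$, $\star$ the convolution of densities, and $\boxast$ the check-node convolution, i.e. $\mathsf a\boxast\mathsf b$ is the law of $2\tanh^{-1}(\tanh(X/2)\tanh(Y/2))$ for independent $X\sim\mathsf a$, $Y\sim\mathsf b$. The entropy is $H(\mathsf a)=\int\log_2(1+e^{-w})\,\mathsf a(dw)$. A degree distribution pair consists of polynomials $\lambda(x)=\sum_i\lambda_ix^{i-1}$, $\rho(x)=\sum_i\rho_ix^{i-1}$ with nonnegative coefficients and $\lambda(1)=\rho(1)=1$, where $\rho_1=0$. Write $\int\lambda=\int_0^1\lambda(x)\,dx$, likewise $\int\rho$, and $r(\lambda,\rho)=1-\int\rho/\int\lambda$. Given a BMS channel with $L$-density $\mathsf c$, set $\mathsf a_\alpha=-\alpha\Delta_0+(1+\alpha)\mathsf c$ for $\alpha\in[-1,0]$, and, for $\alpha\ge0$, $$\mathsf b_\alpha=\sum_i\rho_i\,\mathsf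 a_{\alpha-1}^{\boxast(i-1)},\qquad \mathsf a_\alpha=\sum_i\lambda_i\,\mathsf c\star\mathsf b_\alpha^{\star(i-1)} .$$ The densities $\mathsf a_\ell$, $\ell\in\mathbb N$, are those of density evolution. For families of densities $\{\mathsf c_\alpha\},\{\mathsf a_\alpha\}$ the GEXIT functional is $$G(\mathsf c_\alpha,\mathsf a_\alpha)=\int \kappa_\alpha(z)\,\mathsf a_\alpha(dz),\qquad \kappa_\alpha(z)=\frac{\frac{d}{d\alpha}\int\log_2(1+e^{-z-w})\,\mathsf c_\alpha(dw)}{\frac{d}{d\alpha}\int\log_2(1+e^{-w})\,\mathsf c_\alpha(dw)},$$ where the families are piecewise smooth and $\frac{d}{d\alpha}$ means the left derivative at kinks (and $0/0=0$, which matters only in the degenerate case $\mathsf c=\Delta_\infty$). The check-node GEXIT curve is $\{(H(\mathsf a_\alpha),G(\mathsf a_\alpha,\mathsf b_{\alpha+1})):\alpha>-1\}$ and the inverse dual variable-node GEXIT curve is $\{(H(\mathsf a_\alpha),G(\mathsf a_\alpha,\mathsf b_\alpha)):\alpha\ge0\}$. The region under the first curve is bounded below by the horizontal axis; the region to the left of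 the second is the part of $[0,H(\mathsf c)]\times[0,1]$ on the upper left side of (i.e. on or above) that curve. **Statement.** Assume that density evolution converges weakly to $\Delta_\infty$, that is $\mathsf a_\ell\to\Delta_\infty$ as $\ell\to\infty$. Then: 1. The two curves faithfully represent density evolution: the families $\{\mathsf a_\alpha\}_{\alpha\ge-1}$, $\{\mathsf b_\alpha\}_{\alpha\ge0}$ consist of $L$-densities, satisfy the recursions above and agree with density evolution at integers; $\alpha\mapsto H(\mathsf a_\alpha)$ on $[-1,\infty)$ and $\alpha\mapsto H(\mathsf b_\alpha)$ on $[0,\infty)$ are continuous and nonincreasing and take each value in $(0,1]$ at exactly one parameter. For real $z$ and $\alpha>-1$ the left derivative in the numerator of the kernel of $\{\mathsf a_\alpha\}$ exists, and it is a two-sided derivative if $\alpha\notin\mathbb N$; the derivative in the denominator is negative when $H(\mathsf a_\alpha)>0$; the integrals defining $G(\mathsf a_\alpha,\mathsf b_{\alpha+1})$ ($\alpha>-1$) and $G(\mathsf a_\alpha,\mathsf b_\alpha)$ ($\alpha\ge 0$) converge. Both are continuous in $\alpha$ on each interval $(k-1,k]$, $k$ an integer, in these ranges, and take values in $[0,1]$.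 2. The two curves do not overlap: $G(\mathsf a_\alpha,\mathsf b_{\alpha+1})\le G(\mathsf a_\alpha,\mathsf b_\alpha)$ for all $\alpha\ge0$, and the region under the check-node curve meets the region to the left of the variable-node curve in a set of area zero. 3. The area under the check-node curve is $1-\int\rho$, and the area to the left of the inverse dual variable-node curve is $H(\mathsf c)\int\lambda$. 4. Consequently $r(\lambda,\rho)\le1-H(\mathsf c)$. 5. The part of $[0,1]^2$ that is neither under the first curve nor to the left of the second has area $\bigl(\int\lambda\bigr)\bigl(1-H(\mathsf c)-r(\lambda,\rho)\bigr)$. Hence approaching capacity requires a perfect matching of the curves: for every sequence of such $(\lambda^{(n)},\rho^{(n)},\mathsf c^{(n)})$ with $1-H(\mathsf c^{(n)})-r(\lambda^{(n)},\rho^{(n)})\to0$, the area of this region tends to $0$. -/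

import Mathlib

open MeasureTheory Set Filter Topology

noncomputable section

namespace LDPC

/-! ### L-densities -/

/-- `logTwo v = log₂ (1 + e^{-v})` for an extended real log-likelihood ratio `v`, with value `0` at
`v = +∞`. The value at `-∞` is irrelevant: L-densities put no mass there. -/
def logTwo (v : EReal) : ℝ :=
  if v = ⊤ then 0 else Real.logb 2 (1 + Real.exp (-v.toReal))

/-- An L-density of a binary-input memoryless output-symmetric (BMS) channel: the law of the
log-likelihood ratio given that the input `+1` was sent. It is a probability measure on
`(-∞, +∞]` whose restriction `a` to the reals satisfies the symmetry `a(-w) = e^{-w} a(w)`. -/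
structure IsLDensity (c : Measure EReal) : Prop where
  prob : IsProbabilityMeasure c
  no_bot : c {⊥} = 0
  symm : (c.comap Real.toEReal).map (fun w : ℝ => -w) =
    (c.comap Real.toEReal).withDensity (fun w => ENNReal.ofReal (Real.exp (-w)))

/-- The useless density `Δ_0`. -/
def deltaZero : Measure EReal := Measure.dirac 0

/-- The perfect density `Δ_∞`. -/
def deltaInf : Measure EReal := Measure.dirac ⊤

/-- The entropy `H(a) = ∫ log₂ (1 + e^{-w}) a(dw)`. -/
def entropy (a : Measure EReal) : ℝ := ∫ w, logTwo w ∂a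

/-- Weak convergence of a sequence of densities to `Δ_∞`. -/
def ConvergesToPerfect (a : ℕ → Measure EReal) : Prop :=
  ∀ f : BoundedContinuousFunction EReal ℝ,
    Tendsto (fun n => ∫ w, f w ∂(a n)) atTop (𝓝 (f ⊤))

/-! ### The operations at variable and check nodes -/

/-- Convolution `a ⋆ b`: the law of the sum of independent log-likelihood ratios. -/
def starConv (a b : Measure EReal) : Measure EReal :=
  (a.prod b).map (fun p => p.1 + p.2)

/-- `tanh (x / 2)` extended to `[-∞, +∞]`. -/
def tanhHalf (x : EReal) : ℝ :=
  if x = ⊤ then 1 else if x = ⊥ then -1 else Real.tanh (x.toReal / 2)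

/-- The inverse of `tanhHalf`: `2 artanh d`, extended by `+∞` at `1` and `-∞` at `-1`. -/
def twoArtanh (d : ℝ) : EReal :=
  if 1 ≤ d then ⊤ else if d ≤ -1 then ⊥ else ((2 * Real.artanh d : ℝ) : EReal)

/-- The log-likelihood ratio emitted by a check node with inputs `x` and `y`. -/
def checkOp (x y : EReal) : EReal := twoArtanh (tanhHalf x * tanhHalf y)

/-- Check-node convolution `a ⊠ b`: the density at the output of a check node with independent
inputs of densities `a` and `b`. -/
def checkConv (a b : Measure EReal) : Measure EReal :=
  (a.prod b).map (fun p => checkOp p.1 p.2)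

/-- `a^{⋆ n}`. -/
def starPow (a : Measure EReal) : ℕ → Measure EReal
  | 0 => deltaZero
  | n + 1 => starConv (starPow a n) a

/-- `a^{⊠ n}`. -/
def checkPow (a : Measure EReal) : ℕ → Measure EReal
  | 0 => deltaInf
  | n + 1 => checkConv (checkPow a n) a

lemma measurable_tanhHalf : Measurable tanhHalf := by
  have ht : Measurable Real.tanh := by
    have : Real.tanh = fun x => Real.sinh x / Real.cosh x := by
      funext x; exact Real.tanh_eq_sinh_div_cosh x
    rw [this]
    exact Real.measurable_sinh.div Real.measurable_cosh
  unfold tanhHalf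
  refine Measurable.ite (measurableSet_singleton _) measurable_const
    (Measurable.ite (measurableSet_singleton _) measurable_const ?_)
  exact ht.comp (measurable_ereal_toReal.div_const 2)

lemma measurable_twoArtanh : Measurable twoArtanh := by
  have ha : Measurable Real.artanh := by
    unfold Real.artanh
    fun_prop
  unfold twoArtanh
  refine Measurable.ite measurableSet_Ici measurable_const
    (Measurable.ite measurableSet_Iic measurable_const ?_)
  exact measurable_coe_real_ereal.comp (ha.const_mul 2)

/-- The check-node operation is measurable, so `checkConv` is a genuine push-forward. -/
lemma measurable_checkOp : Measurable (fun p : EReal × EReal => checkOp p.1 p.2) :=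
  measurable_twoArtanh.comp
    ((measurable_tanhHalf.comp measurable_fst).mul (measurable_tanhHalf.comp measurable_snd))

/-! ### Degree distributions and density evolution -/

/-- `p(x) = ∑_i p_i x^{i-1}` is an (edge-perspective) degree distribution: the fraction `p_i` of
edges attached to nodes of degree `i` is the coefficient of `x^{i-1}`; fractions are nonnegative
and sum to one. -/
def IsDegreeDistribution (p : Polynomial ℝ) : Prop :=
  (∀ j, 0 ≤ p.coeff j) ∧ p.eval 1 = 1

/-- `∫ p = ∫_0^1 p(x) dx`. -/
def polyInt (p : Polynomial ℝ) : ℝ := ∫ x in (0 : ℝ)..1, p.eval x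

/-- The design rate `r(λ, ρ) = 1 - ∫ρ / ∫λ`. -/
def designRate (l r : Polynomial ℝ) : ℝ := 1 - polyInt r / polyInt l

/-- The check-node side of density evolution: `∑_i ρ_i a^{⊠ (i-1)}`. -/
def checkOut (r : Polynomial ℝ) (a : Measure EReal) : Measure EReal :=
  ∑ j ∈ r.support, ENNReal.ofReal (r.coeff j) • checkPow a j

/-- The variable-node side of density evolution: `∑_i λ_i c ⋆ b^{⋆ (i-1)}`. -/
def varOut (l : Polynomial ℝ) (c b : Measure EReal) : Measure EReal :=
  ∑ j ∈ l.support, ENNReal.ofReal (l.coeff j) • starConv c (starPow b j)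

/-- One full iteration of density evolution. -/
def deStep (l r : Polynomial ℝ) (c a : Measure EReal) : Measure EReal :=
  varOut l c (checkOut r a)

/-- Density evolution: the densities emitted by the variable nodes, started with `c`. -/
def densityEvolution (l r : Polynomial ℝ) (c : Measure EReal) : ℕ → Measure EReal
  | 0 => c
  | n + 1 => deStep l r c (densityEvolution l r c n)

/-- `-α Δ_0 + (1 + α) c`, for `α ∈ [-1, 0]`. -/
def interp (c : Measure EReal) (α : ℝ) : Measure EReal :=
  ENNReal.ofReal (-α) • deltaZero + ENNReal.ofReal (1 + α) • c

/-- The interpolated family `a_α`, `α ≥ -1`: it equals `interp c α` on `[-1, 0]`, and for `α > 0`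
it is obtained from `a_{α-1}` by one iteration of density evolution. -/
def aFam (l r : Polynomial ℝ) (c : Measure EReal) (α : ℝ) : Measure EReal :=
  (deStep l r c)^[⌈α⌉₊] (interp c (α - ⌈α⌉₊))

/-- The interpolated family `b_α = ∑_i ρ_i a_{α-1}^{⊠ (i-1)}`, `α ≥ 0`. -/
def bFam (l r : Polynomial ℝ) (c : Measure EReal) (α : ℝ) : Measure EReal :=
  checkOut r (aFam l r c (α - 1))

lemma aFam_of_nonpos (l r : Polynomial ℝ) (c : Measure EReal) {α : ℝ} (h : α ≤ 0) :
    aFam l r c α = interp c α := by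
  simp [aFam, Nat.ceil_eq_zero.2 h]

lemma aFam_of_pos (l r : Polynomial ℝ) (c : Measure EReal) {α : ℝ} (h : 0 < α) :
    aFam l r c α = varOut l c (bFam l r c α) := by
  have hc : ⌈α⌉₊ = ⌈α - 1⌉₊ + 1 := by
    have h1 : 0 < ⌈α⌉₊ := Nat.ceil_pos.2 h
    rw [Nat.ceil_sub_one]
    omega
  have hx : α - ((⌈α - 1⌉₊ + 1 : ℕ) : ℝ) = α - 1 - (⌈α - 1⌉₊ : ℝ) := by push_cast; ring
  simp only [aFam, bFam]
  rw [hc, hx, Function.iterate_succ_apply']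
  rfl

/-! ### The GEXIT functional -/

/-- The numerator of the GEXIT kernel before differentiation:
`α ↦ ∫ log₂ (1 + e^{-z-w}) c_α(dw)`. -/
def gexitPotential (c : ℝ → Measure EReal) (z : EReal) (α : ℝ) : ℝ :=
  ∫ w, logTwo (z + w) ∂(c α)

/-- The GEXIT kernel of the family `c` at parameter `α`,
`(∫ (dc_α(w)/dα) log₂ (1 + e^{-z-w}) dw) / (∫ (dc_α(w)/dα) log₂ (1 + e^{-w}) dw)`,
where the derivative of the densities is understood in the weak sense, i.e. outside the integral.
The families in question are only piecewise smooth in `α`, so the left derivative is taken; it is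
the ordinary derivative wherever the latter exists, and assigns a value to the curves also at the
kinks. -/
def gexitKernel (c : ℝ → Measure EReal) (α : ℝ) (z : EReal) : ℝ :=
  derivWithin (gexitPotential c z) (Iic α) α /
    derivWithin (fun t => entropy (c t)) (Iic α) α

/-- The GEXIT functional `G(c_α, a_α) = ∫ κ_{c_α}(z) a_α(dz)` of two families of densities. -/
def gexit (c a : ℝ → Measure EReal) (α : ℝ) : ℝ := ∫ z, gexitKernel c α z ∂(a α)

/-- `G(a_α, b_{α+1})`, the ordinate of the check-node GEXIT curve. -/
def gCheck (l r : Polynomial ℝ) (c : Measure EReal) (α : ℝ) : ℝ :=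
  gexit (aFam l r c) (fun t => bFam l r c (t + 1)) α

/-- `G(a_α, b_α)`, the ordinate of the inverse dual variable-node GEXIT curve. -/
def gVar (l r : Polynomial ℝ) (c : Measure EReal) (α : ℝ) : ℝ :=
  gexit (aFam l r c) (bFam l r c) α

/-- The check-node GEXIT curve `{(H(a_α), G(a_α, b_{α+1}))}`, `α > -1`. -/
def checkCurve (l r : Polynomial ℝ) (c : Measure EReal) : Set (ℝ × ℝ) :=
  (fun α => (entropy (aFam l r c α), gCheck l r c α)) '' Ioi (-1)

/-- The inverse dual variable-node GEXIT curve `{(H(a_α), G(a_α, b_α))}`, `α ≥ 0`. -/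
def varCurve (l r : Polynomial ℝ) (c : Measure EReal) : Set (ℝ × ℝ) :=
  (fun α => (entropy (aFam l r c α), gVar l r c α)) '' Ici 0

/-- The region under the curve `C`, down to the horizontal axis. -/
def regionUnder (C : Set (ℝ × ℝ)) : Set (ℝ × ℝ) :=
  {p | ∃ y, (p.1, y) ∈ C ∧ 0 ≤ p.2 ∧ p.2 ≤ y}

/-- The region to the left of a curve `C` that runs over an interval `[0, h]` of abscissae inside
the unit box: the part of `[0, h] × [0, 1]` on the upper left side of the curve. In the
coordinates of the dual curve (axes exchanged) it is the region under the curve. -/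
def regionLeft (C : Set (ℝ × ℝ)) : Set (ℝ × ℝ) :=
  {p | ∃ y, (p.1, y) ∈ C ∧ y ≤ p.2 ∧ p.2 ≤ 1}

/-- The part of the GEXIT box `[0, 1]²` between the two curves, i.e. neither under the check-node
curve nor to the left of the variable-node curve. -/
def gapRegion (l r : Polynomial ℝ) (c : Measure EReal) : Set (ℝ × ℝ) :=
  (Icc 0 1 ×ˢ Icc 0 1) \ (regionUnder (checkCurve l r c) ∪ regionLeft (varCurve l r c))

/-- `(λ, ρ)` is a degree distribution pair (without check nodes of degree one), `c` is the
L-density of a BMS channel, and density evolution converges to `Δ_∞`. -/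
structure Decodable (l r : Polynomial ℝ) (c : Measure EReal) : Prop where
  left : IsDegreeDistribution l
  right : IsDegreeDistribution r
  no_degree_one_check : r.coeff 0 = 0
  channel : IsLDensity c
  converges : ConvergesToPerfect (densityEvolution l r c)

end LDPC

end

open LDPC

namespace LDPC

open scoped ENNReal

/-! ### The transform `tanhHalf` -/

/-! The bias `tanhHalf x = tanh (x / 2)` turns the check node into multiplication, and symmetry of
an L-density `a` says that `1 - tanhHalf` times `a` is an even measure. Hence the entropy is the
mean of an even function of the bias, `biasEntropy`, and its power series gives `1 - H(a) = ∑ w_k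
m_k(a)` with weights `w_k > 0` of sum one and moments `m_k(a) = E tanh (X / 2) ^ (2k + 2)`
(`IsLDensity.hasSum_entropy`). Check convolution multiplies moments; variable convolution is reached
through the duality `H(a ⋆ b) + H(a ⊠ b) = H(a) + H(b)`.

Let `a_α` move while `b` stays fixed. These two facts give `-d/dα H(a_α ⋆ b) = ∑ w_k m_k(a_α)' (1 -
m_k(b))` (`PolyRep.hasSum_d_starConv`), and by Fubini the GEXIT functional is the quotient of this
by `-d/dα H(a_α) = ∑ w_k m_k(a_α)'`. When the moments of `a_α` are nondecreasing it is a weighted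
average of the numbers `1 - m_k(b)`: it lies in `[0, 1]` and goes down when the moments of `b` go
up. As `b_{α+1}` has larger moments than `b_α`, the curves do not cross. Monotonicity in `α` is
proved for degradation, i.e. for all bounded even convex functions of the bias; this class contains
the even powers and is stable under both node operations.

On `[k - 1, k]` the family is a finite mixture of fixed L-densities with polynomial weights
(`PolyRep`), so every linear functional is a polynomial in `α` there and differentiation under the
integral is free.

The areas are integrals of exact differentials. With `b_{α+1}` built from `a_α`, the form `G dH` is
the differential of `H(a) - ∑ ρ_j / (j + 1) H(a^{⊠(j+1)})`, where `ρ_j` is the coefficient of `x^j`.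
For the second curve `(1 - G) dH` is the differential of `H(a ⊠ b)` in its first argument only; the
change in the second argument is compensated by `∑ λ_j / (j + 1) H(c ⋆ b^{⋆(j+1)}) - H(b)`, because
`a` is the variable-node output of `b`. Both potentials tend to `0` along density evolution, so the
areas are their initial values `1 - ∫ρ` and `H(c) ∫λ`.

To read these integrals as areas, the abscissa `H(a_α)` must be injective where it is positive; this
follows from `Decodable.d_entropy_neg`. Finally both regions lie in the unit box and meet in a null
set, so the areas add up to at most one. That inequality is the rate bound, and its slack is the
area of the gap. -/

@[simp] lemma tanhHalf_top : tanhHalf ⊤ = 1 := by simp [tanhHalf]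

@[simp] lemma tanhHalf_bot : tanhHalf ⊥ = -1 := by simp [tanhHalf]

lemma tanhHalf_coe (r : ℝ) : tanhHalf r = Real.tanh (r / 2) := by simp [tanhHalf]

@[simp] lemma tanhHalf_zero : tanhHalf 0 = 0 := by simp [tanhHalf]

lemma tanhHalf_coe_eq_div (r : ℝ) :
    tanhHalf r = (1 - Real.exp (-r)) / (1 + Real.exp (-r)) := by
  rw [tanhHalf_coe, Real.tanh_eq]
  have h1 : Real.exp (-r) = Real.exp (-(r / 2)) * Real.exp (-(r / 2)) := by
    rw [← Real.exp_add]; ring_nf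
  have h2 : Real.exp (r / 2) * Real.exp (-(r / 2)) = 1 := by
    rw [← Real.exp_add]; simp
  rw [h1, div_eq_div_iff (by positivity) (by positivity)]
  linear_combination (2 * Real.exp (-(r / 2))) * h2

lemma one_add_tanhHalf_coe (r : ℝ) : 1 + tanhHalf r = 2 / (1 + Real.exp (-r)) := by
  rw [tanhHalf_coe_eq_div]
  have : 0 < 1 + Real.exp (-r) := by positivity
  field_simp
  ring

lemma one_sub_tanhHalf_coe (r : ℝ) :
    1 - tanhHalf r = 2 * Real.exp (-r) / (1 + Real.exp (-r)) := by
  rw [tanhHalf_coe_eq_div]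
  have : 0 < 1 + Real.exp (-r) := by positivity
  field_simp
  ring

lemma tanhHalf_neg (x : EReal) : tanhHalf (-x) = -tanhHalf x := by
  induction x with
  | bot => simp
  | top => simp
  | coe r => rw [← EReal.coe_neg, tanhHalf_coe, tanhHalf_coe, neg_div, Real.tanh_neg]

lemma tanhHalf_coe_lt_one (r : ℝ) : tanhHalf r < 1 := by
  rw [tanhHalf_coe]; exact Real.tanh_lt_one _

lemma neg_one_lt_tanhHalf_coe (r : ℝ) : -1 < tanhHalf r := by
  rw [tanhHalf_coe]; exact Real.neg_one_lt_tanh _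

lemma tanhHalf_le_one (x : EReal) : tanhHalf x ≤ 1 := by
  induction x with
  | bot => simp
  | top => simp
  | coe r => exact (tanhHalf_coe_lt_one r).le

lemma neg_one_le_tanhHalf (x : EReal) : -1 ≤ tanhHalf x := by
  induction x with
  | bot => simp
  | top => simp
  | coe r => exact (neg_one_lt_tanhHalf_coe r).le

lemma tanhHalf_mem_Icc (x : EReal) : tanhHalf x ∈ Icc (-1 : ℝ) 1 :=
  ⟨neg_one_le_tanhHalf x, tanhHalf_le_one x⟩

lemma abs_tanhHalf_le_one (x : EReal) : |tanhHalf x| ≤ 1 :=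
  abs_le.2 (tanhHalf_mem_Icc x)

lemma neg_one_lt_tanhHalf {x : EReal} (hx : x ≠ ⊥) : -1 < tanhHalf x := by
  induction x with
  | bot => exact absurd rfl hx
  | top => simp
  | coe r => exact neg_one_lt_tanhHalf_coe r

lemma tanhHalf_lt_one {x : EReal} (hx : x ≠ ⊤) : tanhHalf x < 1 := by
  induction x with
  | bot => simp
  | top => exact absurd rfl hx
  | coe r => exact tanhHalf_coe_lt_one r

lemma twoArtanh_tanhHalf (x : EReal) : twoArtanh (tanhHalf x) = x := by
  induction x with
  | bot => norm_num [twoArtanh]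
  | top => norm_num [twoArtanh]
  | coe r =>
    rw [twoArtanh, if_neg (not_le.2 (tanhHalf_coe_lt_one r)),
      if_neg (not_le.2 (neg_one_lt_tanhHalf_coe r)), tanhHalf_coe, Real.artanh_tanh]
    congr 1; ring

lemma tanhHalf_injective : Function.Injective tanhHalf :=
  Function.LeftInverse.injective twoArtanh_tanhHalf

lemma tanhHalf_twoArtanh {d : ℝ} (h : d ∈ Icc (-1 : ℝ) 1) : tanhHalf (twoArtanh d) = d := by
  unfold twoArtanh
  split_ifs with h1 h2
  · simp [le_antisymm h1 h.2]
  · simp [le_antisymm h2 h.1]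
  · push Not at h1 h2
    rw [tanhHalf_coe, mul_div_cancel_left₀ _ (two_ne_zero), Real.tanh_artanh ⟨h2, h1⟩]

lemma mul_mem_Icc_neg_one_one {s t : ℝ} (hs : s ∈ Icc (-1 : ℝ) 1) (ht : t ∈ Icc (-1 : ℝ) 1) :
    s * t ∈ Icc (-1 : ℝ) 1 := by
  rw [mem_Icc, ← abs_le] at *
  rw [abs_mul]
  exact mul_le_one₀ hs (abs_nonneg _) ht

lemma tanhHalf_checkOp (x y : EReal) : tanhHalf (checkOp x y) = tanhHalf x * tanhHalf y :=
  tanhHalf_twoArtanh (mul_mem_Icc_neg_one_one (tanhHalf_mem_Icc x) (tanhHalf_mem_Icc y))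

lemma checkOp_neg_left (x y : EReal) : checkOp (-x) y = -checkOp x y := by
  apply tanhHalf_injective
  simp [tanhHalf_checkOp, tanhHalf_neg]

lemma checkOp_comm (x y : EReal) : checkOp x y = checkOp y x := by
  simp [checkOp, mul_comm]

lemma one_add_tanhHalf_mul_pos {x y : EReal} (hx : x ≠ ⊥) (hy : y ≠ ⊥) :
    0 < 1 + tanhHalf x * tanhHalf y := by
  nlinarith [neg_one_lt_tanhHalf hx, neg_one_lt_tanhHalf hy, tanhHalf_le_one x, tanhHalf_le_one y,
    mul_pos (neg_lt_iff_pos_add.1 (neg_one_lt_tanhHalf hx))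
      (neg_lt_iff_pos_add.1 (neg_one_lt_tanhHalf hy)),
    mul_nonneg (sub_nonneg.2 (tanhHalf_le_one x)) (sub_nonneg.2 (tanhHalf_le_one y))]

lemma tanhHalf_add {x y : EReal} (hx : x ≠ ⊥) (hy : y ≠ ⊥) :
    tanhHalf (x + y) = (tanhHalf x + tanhHalf y) / (1 + tanhHalf x * tanhHalf y) := by
  have hpos := one_add_tanhHalf_mul_pos hx hy
  induction x with
  | bot => exact absurd rfl hx
  | top =>
    rw [EReal.top_add_of_ne_bot hy]
    rw [eq_div_iff hpos.ne']; simp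
  | coe r =>
    induction y with
    | bot => exact absurd rfl hy
    | top =>
      rw [EReal.coe_add_top]
      rw [eq_div_iff hpos.ne']; simp [add_comm]
    | coe u =>
      rw [eq_div_iff hpos.ne', ← EReal.coe_add, tanhHalf_coe_eq_div, tanhHalf_coe_eq_div,
        tanhHalf_coe_eq_div, neg_add, Real.exp_add]
      have h1 := Real.exp_pos (-r)
      have h2 := Real.exp_pos (-u)
      field_simp
      ring

lemma add_ne_bot {x y : EReal} (hx : x ≠ ⊥) (hy : y ≠ ⊥) : x + y ≠ ⊥ := by
  simp [EReal.add_eq_bot_iff, hx, hy]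

lemma checkOp_ne_bot {x y : EReal} (hx : x ≠ ⊥) (hy : y ≠ ⊥) : checkOp x y ≠ ⊥ := by
  intro h
  have := one_add_tanhHalf_mul_pos hx hy
  rw [← tanhHalf_checkOp, h] at this
  simp at this

/-! ### The entropy kernel as a function of the bias -/

@[simp] lemma logTwo_top : logTwo ⊤ = 0 := by simp [logTwo]

lemma logTwo_coe (r : ℝ) : logTwo r = Real.logb 2 (1 + Real.exp (-r)) := by simp [logTwo]

@[simp] lemma logTwo_zero : logTwo 0 = 1 := by
  have := logTwo_coe 0
  norm_num at this
  exact this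

lemma logTwo_nonneg (x : EReal) : 0 ≤ logTwo x := by
  unfold logTwo
  split_ifs
  · exact le_rfl
  · apply Real.logb_nonneg one_lt_two
    linarith [Real.exp_pos (-x.toReal)]

lemma logTwo_eq {x : EReal} (hx : x ≠ ⊥) : logTwo x = 1 - Real.logb 2 (1 + tanhHalf x) := by
  induction x with
  | bot => exact absurd rfl hx
  | top => norm_num
  | coe r =>
    have h1 : 0 < 1 + Real.exp (-r) := by positivity
    rw [one_add_tanhHalf_coe, logTwo_coe, Real.logb_div two_ne_zero h1.ne',
      Real.logb_self_eq_one one_lt_two]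
    ring

/-- The pointwise form of the duality between variable and check nodes. -/
lemma logTwo_add_add_logTwo_checkOp {x y : EReal} (hx : x ≠ ⊥) (hy : y ≠ ⊥) :
    logTwo (x + y) + logTwo (checkOp x y) = logTwo x + logTwo y := by
  have hpos := one_add_tanhHalf_mul_pos hx hy
  have h1 : 0 < 1 + tanhHalf x := by linarith [neg_one_lt_tanhHalf hx]
  have h2 : 0 < 1 + tanhHalf y := by linarith [neg_one_lt_tanhHalf hy]
  rw [logTwo_eq hx, logTwo_eq hy, logTwo_eq (add_ne_bot hx hy), logTwo_eq (checkOp_ne_bot hx hy),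
    tanhHalf_checkOp, tanhHalf_add hx hy]
  -- With biases `s` and `t` the check output contributes the factor `1 + s t`, which is exactly the
  -- denominator here; the logarithms of the two products therefore agree.
  have h3 : 1 + (tanhHalf x + tanhHalf y) / (1 + tanhHalf x * tanhHalf y) =
      (1 + tanhHalf x) * (1 + tanhHalf y) / (1 + tanhHalf x * tanhHalf y) := by
    field_simp; ring
  rw [h3, Real.logb_div (by positivity) hpos.ne', Real.logb_mul h1.ne' h2.ne']
  ring

lemma measurable_logTwo : Measurable logTwo := by
  unfold logTwo
  refine Measurable.ite (measurableSet_singleton _) measurable_const ?_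
  have := measurable_ereal_toReal
  unfold Real.logb
  fun_prop

/-- A monotone surjection onto the ordered space `[-1, 1]` is continuous, so no limits at the
infinite points have to be computed. -/
lemma continuous_tanhHalf : Continuous tanhHalf := by
  have hmono : Monotone tanhHalf := by
    intro x y hxy
    induction x with
    | bot => simpa using neg_one_le_tanhHalf y
    | top => simp [top_le_iff.1 hxy]
    | coe r =>
      induction y with
      | bot => simp at hxy
      | top => simpa using tanhHalf_le_one r
      | coe u =>
        have hru : r ≤ u := by exact_mod_cast hxy
        have h1 := one_add_tanhHalf_coe r
        have h2 := one_add_tanhHalf_coe u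
        have : 2 / (1 + Real.exp (-r)) ≤ 2 / (1 + Real.exp (-u)) := by gcongr
        linarith
  let g : EReal → Icc (-1 : ℝ) 1 := fun x => ⟨tanhHalf x, tanhHalf_mem_Icc x⟩
  have hg : Monotone g := fun x y h => hmono h
  have hs : Function.Surjective g := fun d =>
    ⟨twoArtanh d, Subtype.ext (tanhHalf_twoArtanh d.2)⟩
  have hc : Continuous g := hg.continuous_of_surjective hs
  exact continuous_subtype_val.comp hc

lemma measurable_add_ereal : Measurable (fun p : EReal × EReal => p.1 + p.2) :=
  measurable_fst.add measurable_snd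

/-! ### Symmetry of L-densities through the weight `1 - tanh (x / 2)` -/

/-- The weight `1 - tanh (x / 2)`, with respect to which L-densities are even. -/
noncomputable def evenWeight (x : EReal) : ℝ≥0∞ := ENNReal.ofReal (1 - tanhHalf x)

lemma measurable_evenWeight : Measurable evenWeight :=
  (measurable_const.sub measurable_tanhHalf).ennreal_ofReal

@[simp] lemma evenWeight_top : evenWeight ⊤ = 0 := by simp [evenWeight]

lemma lintegral_ereal (a : Measure EReal) (f : EReal → ℝ≥0∞) :
    ∫⁻ x, f x ∂a =
      ∫⁻ r : ℝ, f r ∂(a.comap Real.toEReal) + (f ⊥ * a {⊥} + f ⊤ * a {⊤}) := by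
  have hr : MeasurableSet (range Real.toEReal) := EReal.measurableEmbedding_coe.measurableSet_range
  have hc : (range Real.toEReal)ᶜ = {⊥, ⊤} := by
    ext x
    induction x <;> simp
  rw [← lintegral_add_compl f hr, hc, ← EReal.measurableEmbedding_coe.lintegral_map f,
    EReal.measurableEmbedding_coe.map_comap, lintegral_insert (by simp), lintegral_singleton]

lemma evenWeight_neg_mul_exp (r : ℝ) :
    evenWeight (-(r : EReal)) * ENNReal.ofReal (Real.exp (-r)) = evenWeight r := by
  rw [evenWeight, evenWeight, tanhHalf_neg, sub_neg_eq_add,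
    ← ENNReal.ofReal_mul (by linarith [neg_one_le_tanhHalf r]), one_add_tanhHalf_coe,
    one_sub_tanhHalf_coe]
  congr 1; ring

/-- The identity behind this is `(1 + tanh (w / 2)) e^{-w} = 1 - tanh (w / 2)`. The weight vanishes
at `⊤` and there is no mass at `⊥`, so symmetry becomes one statement on all of `EReal`, which is
convenient for products. -/
lemma IsLDensity.lintegral_neg_mul {a : Measure EReal} (ha : IsLDensity a) {f : EReal → ℝ≥0∞}
    (hf : Measurable f) :
    ∫⁻ x, f (-x) * evenWeight x ∂a = ∫⁻ x, f x * evenWeight x ∂a := by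
  have hm : Measurable fun r : ℝ => f r := hf.comp measurable_coe_real_ereal
  have hw : Measurable fun r : ℝ => evenWeight (-(r : EReal)) :=
    measurable_evenWeight.comp measurable_coe_real_ereal.neg
  have hg : Measurable fun r : ℝ => f r * evenWeight (-(r : EReal)) := hm.mul hw
  have key := congrArg (fun ν => ∫⁻ r : ℝ, f r * evenWeight (-(r : EReal)) ∂ν) ha.symm
  beta_reduce at key
  rw [lintegral_map hg measurable_neg,
    lintegral_withDensity_eq_lintegral_mul _ (by fun_prop) hg] at key
  rw [lintegral_ereal, lintegral_ereal a, ha.no_bot]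
  simp only [evenWeight_top, mul_zero, zero_mul, add_zero]
  simp only [EReal.coe_neg, neg_neg] at key
  rw [key]
  refine lintegral_congr fun r => ?_
  simp only [Pi.mul_apply]
  rw [← evenWeight_neg_mul_exp r]
  ring

/-- Evenness of the weighted measure also excludes mass at `⊥`: the weight is `2` there and `0` at
the opposite point `⊤`. -/
lemma isLDensity_of_lintegral_neg_mul {a : Measure EReal} [hp : IsProbabilityMeasure a]
    (h : ∀ f : EReal → ℝ≥0∞, Measurable f →
      ∫⁻ x, f (-x) * evenWeight x ∂a = ∫⁻ x, f x * evenWeight x ∂a) : IsLDensity a := by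
  have hbot : a {⊥} = 0 := by
    have h1 := h (indicator {⊤} 1) (measurable_one.indicator (measurableSet_singleton _))
    rw [lintegral_ereal, lintegral_ereal] at h1
    have h2 : ∀ r : ℝ, (-(r : EReal)) ≠ ⊤ := fun r => by
      rw [← EReal.coe_neg]; exact EReal.coe_ne_top _
    simp [evenWeight, h2] at h1
    exact h1.resolve_left (by norm_num)
  refine ⟨hp, hbot, ?_⟩
  refine Measure.ext_of_lintegral _ fun g hg => ?_
  rw [lintegral_map hg measurable_neg,
    lintegral_withDensity_eq_lintegral_mul _ (by fun_prop) hg]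
  have hwpos : ∀ r : ℝ, evenWeight r ≠ 0 := fun r => by
    simpa [evenWeight] using tanhHalf_coe_lt_one r
  have hwtop : ∀ x : EReal, evenWeight x ≠ ∞ := fun x => ENNReal.ofReal_ne_top
  -- On the reals the weight is positive and finite, so dividing by it lets the hypothesis reach an
  -- arbitrary `g`; the first branch removes the infinite points.
  have h1 := h (fun x => if x = ⊤ ∨ x = ⊥ then 0 else g x.toReal / evenWeight (-x)) (by
    refine Measurable.ite ((measurableSet_singleton _).union (measurableSet_singleton _))
      measurable_const ?_
    exact (hg.comp measurable_ereal_toReal).div (measurable_evenWeight.comp measurable_neg))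
  rw [lintegral_ereal, lintegral_ereal] at h1
  simp only [EReal.neg_eq_top_iff, EReal.neg_eq_bot_iff, EReal.coe_ne_top, EReal.coe_ne_bot,
    or_self, if_false, EReal.neg_top, EReal.neg_bot, or_true, true_or, if_true,
    zero_mul, add_zero, neg_neg, EReal.toReal_coe] at h1
  calc ∫⁻ r, g (-r) ∂(a.comap Real.toEReal)
      = ∫⁻ r : ℝ, g (-(r : EReal)).toReal / evenWeight r * evenWeight r
          ∂(a.comap Real.toEReal) := by
        refine lintegral_congr fun r => ?_
        rw [ENNReal.div_mul_cancel (hwpos r) (hwtop r), ← EReal.coe_neg, EReal.toReal_coe]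
    _ = _ := h1
    _ = _ := by
        refine lintegral_congr fun r => ?_
        have h3 : evenWeight (-(r : EReal)) ≠ 0 := by
          rw [← EReal.coe_neg]; exact hwpos _
        simp only [Pi.mul_apply]
        rw [← evenWeight_neg_mul_exp r, mul_comm (evenWeight _) (ENNReal.ofReal _),
          mul_comm (ENNReal.ofReal _), ← mul_assoc, ENNReal.div_mul_cancel h3 (hwtop _), mul_comm]

lemma IsLDensity.ae_ne_bot {a : Measure EReal} (ha : IsLDensity a) : ∀ᵐ x ∂a, x ≠ ⊥ := by
  rw [ae_iff]; simpa using ha.no_bot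

lemma IsLDensity.ae_prod_ne_bot {a b : Measure EReal} (ha : IsLDensity a) (hb : IsLDensity b) :
    ∀ᵐ p ∂(a.prod b), p.1 ≠ ⊥ ∧ p.2 ≠ ⊥ := by
  have := ha.prob
  have := hb.prob
  filter_upwards [Measure.quasiMeasurePreserving_fst.ae ha.ae_ne_bot,
    Measure.quasiMeasurePreserving_snd.ae hb.ae_ne_bot] with p h1 h2
  exact ⟨h1, h2⟩

lemma isLDensity_deltaZero : IsLDensity deltaZero := by
  have : IsProbabilityMeasure deltaZero := by unfold deltaZero; infer_instance
  refine isLDensity_of_lintegral_neg_mul fun f hf => ?_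
  unfold deltaZero
  simp

lemma isLDensity_deltaInf : IsLDensity deltaInf := by
  have : IsProbabilityMeasure deltaInf := by unfold deltaInf; infer_instance
  refine isLDensity_of_lintegral_neg_mul fun f hf => ?_
  unfold deltaInf
  simp

/-- The flipping identity for functions of two variables. -/
lemma IsLDensity.lintegral_prod_flip_left {a b : Measure EReal} (ha : IsLDensity a)
    (hb : IsLDensity b) {f : EReal × EReal → ℝ≥0∞} (hf : Measurable f) :
    ∫⁻ p, f (-p.1, p.2) * evenWeight p.1 ∂(a.prod b) =
      ∫⁻ p, f p * evenWeight p.1 ∂(a.prod b) := by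
  have := ha.prob
  have := hb.prob
  have hw := measurable_evenWeight
  rw [lintegral_prod_symm' _ (by fun_prop), lintegral_prod_symm' _ (by fun_prop)]
  refine lintegral_congr fun y => ?_
  exact ha.lintegral_neg_mul (f := fun x => f (x, y)) (by fun_prop)

lemma IsLDensity.lintegral_prod_flip_right {a b : Measure EReal} (ha : IsLDensity a)
    (hb : IsLDensity b) {f : EReal × EReal → ℝ≥0∞} (hf : Measurable f) :
    ∫⁻ p, f (p.1, -p.2) * evenWeight p.2 ∂(a.prod b) =
      ∫⁻ p, f p * evenWeight p.2 ∂(a.prod b) := by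
  have := ha.prob
  have := hb.prob
  have hw := measurable_evenWeight
  rw [lintegral_prod _ (by fun_prop), lintegral_prod _ (by fun_prop)]
  refine lintegral_congr fun x => ?_
  exact hb.lintegral_neg_mul (f := fun y => f (x, y)) (by fun_prop)

lemma IsLDensity.starConv {a b : Measure EReal} (ha : IsLDensity a) (hb : IsLDensity b) :
    IsLDensity (starConv a b) := by
  have := ha.prob
  have := hb.prob
  have : IsProbabilityMeasure (LDPC.starConv a b) :=
    Measure.isProbabilityMeasure_map measurable_add_ereal.aemeasurable
  refine isLDensity_of_lintegral_neg_mul fun f hf => ?_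
  have hw := measurable_evenWeight
  have hadd := measurable_add_ereal
  have ht := measurable_tanhHalf
  rw [LDPC.starConv, lintegral_map (by fun_prop) hadd, lintegral_map (by fun_prop) hadd]
  -- In the biases `s, t` the weight of the sum is `(1 - s)(1 - t) / (1 + s t)`. The factor `u` does
  -- not change when both signs flip, so evenness can be applied to one coordinate after the other.
  set u : EReal × EReal → ℝ≥0∞ :=
    fun p => ENNReal.ofReal ((1 + tanhHalf p.1 * tanhHalf p.2)⁻¹) with hu
  have hum : Measurable u := by fun_prop
  have hweight : ∀ p : EReal × EReal, p.1 ≠ ⊥ ∧ p.2 ≠ ⊥ →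
      evenWeight (p.1 + p.2) = u p * evenWeight p.2 * evenWeight p.1 := by
    rintro ⟨x, y⟩ ⟨hx, hy⟩
    have hpos := one_add_tanhHalf_mul_pos hx hy
    simp only [hu, evenWeight] at *
    rw [tanhHalf_add hx hy, ← ENNReal.ofReal_mul (by positivity),
      ← ENNReal.ofReal_mul (mul_nonneg (by positivity) (by linarith [tanhHalf_le_one y]))]
    congr 1
    field_simp
    ring
  calc ∫⁻ p, f (-(p.1 + p.2)) * evenWeight (p.1 + p.2) ∂(a.prod b)
      = ∫⁻ p, f (-p.1 + -p.2) * u (-p.1, -p.2) * evenWeight p.2 * evenWeight p.1 ∂(a.prod b) := by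
        refine lintegral_congr_ae ?_
        filter_upwards [ha.ae_prod_ne_bot hb] with p hp
        rw [hweight p hp, EReal.neg_add (Or.inl hp.1) (Or.inr hp.2), sub_eq_add_neg]
        simp only [hu, tanhHalf_neg, neg_mul_neg]
        ring
    _ = ∫⁻ p, f (p.1 + -p.2) * u (p.1, -p.2) * evenWeight p.2 * evenWeight p.1 ∂(a.prod b) := by
        rw [← ha.lintegral_prod_flip_left hb (by fun_prop)]
        simp only [neg_neg]
    _ = ∫⁻ p, f (p.1 + -p.2) * u (p.1, -p.2) * evenWeight p.1 * evenWeight p.2 ∂(a.prod b) := by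
        simp only [mul_comm, mul_left_comm]
    _ = ∫⁻ p, f (p.1 + p.2) * u p * evenWeight p.1 * evenWeight p.2 ∂(a.prod b) := by
        rw [← ha.lintegral_prod_flip_right hb (by fun_prop)]
        simp only [neg_neg]
    _ = _ := by
        refine lintegral_congr_ae ?_
        filter_upwards [ha.ae_prod_ne_bot hb] with p hp
        rw [hweight p hp]
        ring

lemma IsLDensity.checkConv {a b : Measure EReal} (ha : IsLDensity a) (hb : IsLDensity b) :
    IsLDensity (checkConv a b) := by
  have := ha.prob
  have := hb.prob
  have : IsProbabilityMeasure (LDPC.checkConv a b) :=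
    Measure.isProbabilityMeasure_map measurable_checkOp.aemeasurable
  refine isLDensity_of_lintegral_neg_mul fun f hf => ?_
  have hw := measurable_evenWeight
  have hop := measurable_checkOp
  have hfop : Measurable fun p : EReal × EReal => f (checkOp p.1 p.2) := hf.comp hop
  have hfop' : Measurable fun p : EReal × EReal => f (checkOp p.1 (-p.2)) :=
    hf.comp (hop.comp (measurable_fst.prodMk measurable_snd.neg))
  rw [LDPC.checkConv, lintegral_map (by fun_prop) hop, lintegral_map (by fun_prop) hop]
  -- This is `1 - s t = ((1 + t)(1 - s) + (1 + s)(1 - t)) / 2`. Each summand carries the even weight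
  -- of one input, and flipping that input flips the output.
  have hweight : ∀ p : EReal × EReal, evenWeight (checkOp p.1 p.2) =
      (evenWeight (-p.2) * evenWeight p.1 + evenWeight (-p.1) * evenWeight p.2) *
        ENNReal.ofReal (1 / 2) := by
    rintro ⟨x, y⟩
    have h1 := neg_one_le_tanhHalf x
    have h2 := neg_one_le_tanhHalf y
    have h3 := tanhHalf_le_one x
    have h4 := tanhHalf_le_one y
    simp only [evenWeight, tanhHalf_neg, tanhHalf_checkOp, sub_neg_eq_add]
    rw [← ENNReal.ofReal_mul (by linarith), ← ENNReal.ofReal_mul (by linarith),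
      ← ENNReal.ofReal_add (mul_nonneg (by linarith) (by linarith))
        (mul_nonneg (by linarith) (by linarith)), ← ENNReal.ofReal_mul (by nlinarith)]
    congr 1
    ring
  have hneg : ∀ x y : EReal, checkOp x (-y) = -checkOp x y := fun x y => by
    rw [checkOp_comm, checkOp_neg_left, checkOp_comm]
  simp only [hweight, mul_add, ← mul_assoc, add_mul]
  rw [lintegral_add_left (by fun_prop), lintegral_add_left (by fun_prop),
    lintegral_mul_const _ (by fun_prop), lintegral_mul_const _ (by fun_prop),
    lintegral_mul_const _ (by fun_prop), lintegral_mul_const _ (by fun_prop)]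
  have e1 := ha.lintegral_prod_flip_left hb
    (f := fun p => f (checkOp p.1 p.2) * evenWeight (-p.2)) (by fun_prop)
  have e2 := ha.lintegral_prod_flip_right hb
    (f := fun p => f (checkOp p.1 p.2) * evenWeight (-p.1)) (by fun_prop)
  simp only [checkOp_neg_left] at e1
  simp only [hneg] at e2
  rw [e1, e2]

lemma isLDensity_mixture {ι : Type*} (s : Finset ι) (p : ι → ℝ) (m : ι → Measure EReal)
    (hp : ∀ i ∈ s, 0 ≤ p i) (hsum : ∑ i ∈ s, p i = 1) (hm : ∀ i ∈ s, IsLDensity (m i)) :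
    IsLDensity (∑ i ∈ s, ENNReal.ofReal (p i) • m i) := by
  have : IsProbabilityMeasure (∑ i ∈ s, ENNReal.ofReal (p i) • m i) := by
    constructor
    rw [Measure.finsetSum_apply]
    have : ∀ i ∈ s, (ENNReal.ofReal (p i) • m i) univ = ENNReal.ofReal (p i) := fun i hi => by
      have := (hm i hi).prob
      simp
    rw [Finset.sum_congr rfl this, ← ENNReal.ofReal_sum_of_nonneg hp, hsum, ENNReal.ofReal_one]
  refine isLDensity_of_lintegral_neg_mul fun f hf => ?_
  rw [lintegral_finsetSum_measure, lintegral_finsetSum_measure]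
  refine Finset.sum_congr rfl fun i hi => ?_
  rw [lintegral_smul_measure, lintegral_smul_measure, (hm i hi).lintegral_neg_mul hf]

lemma IsLDensity.starPow {a : Measure EReal} (ha : IsLDensity a) (n : ℕ) :
    IsLDensity (starPow a n) := by
  induction n with
  | zero => exact isLDensity_deltaZero
  | succ n ih => exact ih.starConv ha

lemma IsLDensity.checkPow {a : Measure EReal} (ha : IsLDensity a) (n : ℕ) :
    IsLDensity (checkPow a n) := by
  induction n with
  | zero => exact isLDensity_deltaInf
  | succ n ih => exact ih.checkConv ha

lemma IsDegreeDistribution.sum_coeff {p : Polynomial ℝ} (hp : IsDegreeDistribution p) :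
    ∑ j ∈ p.support, p.coeff j = 1 := by
  have := hp.2
  rw [Polynomial.eval_eq_sum, Polynomial.sum] at this
  simpa using this

lemma IsLDensity.checkOut {r : Polynomial ℝ} (hr : IsDegreeDistribution r) {a : Measure EReal}
    (ha : IsLDensity a) : IsLDensity (checkOut r a) :=
  isLDensity_mixture _ _ _ (fun j _ => hr.1 j) hr.sum_coeff fun j _ => ha.checkPow j

lemma IsLDensity.varOut {l : Polynomial ℝ} (hl : IsDegreeDistribution l) {c b : Measure EReal}
    (hc : IsLDensity c) (hb : IsLDensity b) : IsLDensity (varOut l c b) :=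
  isLDensity_mixture _ _ _ (fun j _ => hl.1 j) hl.sum_coeff fun j _ => hc.starConv (hb.starPow j)

lemma IsLDensity.interp {c : Measure EReal} (hc : IsLDensity c) {α : ℝ} (h : α ∈ Icc (-1 : ℝ) 0) :
    IsLDensity (interp c α) := by
  have := isLDensity_mixture (Finset.univ : Finset Bool) (fun i => bif i then -α else 1 + α)
    (fun i => bif i then deltaZero else c)
    (by rintro (_ | _) _ <;> simp <;> linarith [h.1, h.2]) (by simp)
    (by rintro (_ | _) _ <;> simp [hc, isLDensity_deltaZero])
  simpa [LDPC.interp] using this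

/-! ### The entropy as a series of moments -/

/-- The binary entropy of a bit of bias `t`. -/
noncomputable def biasEntropy (t : ℝ) : ℝ :=
  1 - ((1 + t) * Real.log (1 + t) + (1 - t) * Real.log (1 - t)) / (2 * Real.log 2)

/-- The weights of the power series of `biasEntropy`. -/
noncomputable def entropyWeight (k : ℕ) : ℝ := 1 / ((k + 1) * (2 * k + 1) * (2 * Real.log 2))

lemma entropyWeight_pos (k : ℕ) : 0 < entropyWeight k := by
  have := Real.log_pos one_lt_two
  unfold entropyWeight
  positivity

/-- The numerator equals `t (log (1 + t) - log (1 - t)) + log (1 - t²)`, and both parts have known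
series; the coefficients combine by `2 / (2k + 1) - 1 / (k + 1) = 1 / ((k + 1)(2k + 1))`. -/
lemma hasSum_one_sub_biasEntropy_of_lt {t : ℝ} (ht : |t| < 1) :
    HasSum (fun k => entropyWeight k * t ^ (2 * k + 2)) (1 - biasEntropy t) := by
  have hl : Real.log 2 ≠ 0 := (Real.log_pos one_lt_two).ne'
  have h1 := (Real.hasSum_log_sub_log_of_abs_lt_one ht).mul_left t
  have ht2 : |t ^ 2| < 1 := by
    rw [abs_pow]; exact pow_lt_one₀ (abs_nonneg _) ht two_ne_zero
  have h2 := Real.hasSum_pow_div_log_of_abs_lt_one ht2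
  have h3 := (h1.sub h2).div_const (2 * Real.log 2)
  obtain ⟨h4, h5⟩ := abs_lt.1 ht
  have e : Real.log (1 - t ^ 2) = Real.log (1 + t) + Real.log (1 - t) := by
    rw [← Real.log_mul (by linarith) (by linarith)]; ring_nf
  have hs : 1 - biasEntropy t =
      (t * (Real.log (1 + t) - Real.log (1 - t)) - -Real.log (1 - t ^ 2)) / (2 * Real.log 2) := by
    rw [e, biasEntropy]
    field_simp
    ring
  rw [hs]
  refine h3.congr_fun fun k => ?_
  unfold entropyWeight
  have h6 : (2 * (k : ℝ) + 1) ≠ 0 := by positivity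
  have h7 : ((k : ℝ) + 1) ≠ 0 := by positivity
  field_simp
  ring

lemma summable_entropyWeight : Summable entropyWeight := by
  have h : Summable fun n : ℕ => 1 / ((n : ℝ) + 1) ^ 2 := by
    have := (summable_nat_add_iff 1).2 (Real.summable_one_div_nat_pow.2 (one_lt_two))
    simpa using this
  have hl := Real.log_pos one_lt_two
  refine Summable.of_nonneg_of_le (fun k => (entropyWeight_pos k).le) (fun k => ?_)
    (h.mul_left (1 / (2 * Real.log 2)))
  unfold entropyWeight
  rw [div_mul_div_comm, one_mul]
  apply div_le_div_of_nonneg_left (by positivity) (by positivity)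
  have : (0 : ℝ) ≤ k := by positivity
  nlinarith [mul_nonneg hl.le (mul_nonneg this this), mul_nonneg hl.le this]

lemma continuous_biasEntropy : Continuous biasEntropy := by
  have h := Real.continuous_mul_log
  have h1 : Continuous fun t : ℝ => (1 + t) * Real.log (1 + t) :=
    h.comp (continuous_const.add continuous_id)
  have h2 : Continuous fun t : ℝ => (1 - t) * Real.log (1 - t) :=
    h.comp (continuous_const.sub continuous_id)
  unfold biasEntropy
  exact continuous_const.sub ((h1.add h2).div_const _)

lemma biasEntropy_one : biasEntropy 1 = 0 := by
  norm_num [biasEntropy]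

lemma biasEntropy_neg (t : ℝ) : biasEntropy (-t) = biasEntropy t := by
  simp [biasEntropy, add_comm, sub_eq_add_neg]

/-- The value of the series at the boundary point `t = 1`: it converges uniformly on `[-1, 1]`, so
the identity extends from the open interval by continuity. -/
lemma hasSum_entropyWeight : HasSum entropyWeight 1 := by
  have hcont : ContinuousOn (fun t : ℝ => ∑' k, entropyWeight k * t ^ (2 * k + 2))
      (Icc (-1) 1) := by
    refine continuousOn_tsum (fun k => by fun_prop) summable_entropyWeight fun k t ht => ?_
    rw [norm_mul, norm_pow, Real.norm_of_nonneg (entropyWeight_pos k).le]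
    exact mul_le_of_le_one_right (entropyWeight_pos k).le
      (pow_le_one₀ (norm_nonneg _) (abs_le.2 ht))
  have heq : EqOn (fun t : ℝ => ∑' k, entropyWeight k * t ^ (2 * k + 2))
      (fun t => 1 - biasEntropy t) (Ioo (-1) 1) := fun t ht =>
    (hasSum_one_sub_biasEntropy_of_lt (abs_lt.2 ht)).tsum_eq
  have heq' := heq.of_subset_closure hcont
    (continuous_const.sub continuous_biasEntropy).continuousOn Ioo_subset_Icc_self
    (by rw [closure_Ioo (by norm_num)])
  have h1 := heq' (right_mem_Icc.2 (by norm_num : (-1 : ℝ) ≤ 1))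
  simp only [one_pow, mul_one, biasEntropy_one, sub_zero] at h1
  rw [← h1]
  exact summable_entropyWeight.hasSum

lemma hasSum_biasEntropy {t : ℝ} (ht : t ∈ Icc (-1 : ℝ) 1) :
    HasSum (fun k => entropyWeight k * (1 - t ^ (2 * k + 2))) (biasEntropy t) := by
  rcases (abs_le.2 ht).lt_or_eq with h | h
  · have := hasSum_entropyWeight.sub (hasSum_one_sub_biasEntropy_of_lt h)
    simpa [mul_sub] using this
  · have h0 : ∀ k : ℕ, t ^ (2 * k + 2) = 1 := fun k => by
      rw [show 2 * k + 2 = 2 * (k + 1) by ring, pow_mul, ← sq_abs, h]; simp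
    have : biasEntropy t = 0 := by
      rcases eq_or_eq_neg_of_abs_eq h with h | h
      · rw [h, biasEntropy_one]
      · rw [h, biasEntropy_neg, biasEntropy_one]
    simp [h0, this]

/-- The moments `E tanh (x / 2) ^ (2k + 2)`. -/
noncomputable def moment (k : ℕ) (a : Measure EReal) : ℝ := ∫ x, tanhHalf x ^ (2 * k + 2) ∂a

lemma tanhHalf_pow_mem (k : ℕ) (x : EReal) : tanhHalf x ^ (2 * k + 2) ∈ Icc (0 : ℝ) 1 := by
  rw [show 2 * k + 2 = 2 * (k + 1) by ring, pow_mul]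
  refine ⟨by positivity, pow_le_one₀ (by positivity) ?_⟩
  rw [sq_le_one_iff_abs_le_one]
  exact abs_tanhHalf_le_one x

lemma integrable_tanhHalf_pow (k : ℕ) (a : Measure EReal) [IsFiniteMeasure a] :
    Integrable (fun x => tanhHalf x ^ (2 * k + 2)) a := by
  refine Integrable.of_bound (measurable_tanhHalf.pow_const _).aestronglyMeasurable 1 ?_
  refine Eventually.of_forall fun x => ?_
  rw [Real.norm_of_nonneg (tanhHalf_pow_mem k x).1]
  exact (tanhHalf_pow_mem k x).2

lemma moment_mem (k : ℕ) (a : Measure EReal) [IsProbabilityMeasure a] :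
    moment k a ∈ Icc (0 : ℝ) 1 := by
  refine ⟨integral_nonneg fun x => (tanhHalf_pow_mem k x).1, ?_⟩
  have := integral_mono (integrable_tanhHalf_pow k a) (integrable_const (1 : ℝ))
    fun x => (tanhHalf_pow_mem k x).2
  simpa [moment] using this

lemma IsLDensity.map_neg_withDensity {a : Measure EReal} (ha : IsLDensity a) :
    (a.withDensity evenWeight).map (fun x => -x) = a.withDensity evenWeight := by
  refine Measure.ext_of_lintegral _ fun f hf => ?_
  have hw := measurable_evenWeight
  rw [lintegral_map hf measurable_neg,
    lintegral_withDensity_eq_lintegral_mul _ hw (g := fun x => f (-x)) (by fun_prop),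
    lintegral_withDensity_eq_lintegral_mul _ hw hf]
  simpa only [Pi.mul_apply, mul_comm, Function.comp] using ha.lintegral_neg_mul hf

lemma evenWeight_toReal (x : EReal) : (evenWeight x).toReal = 1 - tanhHalf x :=
  ENNReal.toReal_ofReal (by linarith [tanhHalf_le_one x])

lemma IsLDensity.integral_neg {a : Measure EReal} (ha : IsLDensity a) {f : EReal → ℝ}
    (hf : Measurable f) :
    ∫ x, (1 - tanhHalf x) * f (-x) ∂a = ∫ x, (1 - tanhHalf x) * f x ∂a := by
  have hlt : ∀ᵐ x ∂a, evenWeight x < ∞ := Eventually.of_forall fun x => ENNReal.ofReal_lt_top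
  have h := congrArg (fun ν => ∫ x, f x ∂ν) ha.map_neg_withDensity
  beta_reduce at h
  rw [integral_map measurable_neg.aemeasurable hf.aestronglyMeasurable,
    integral_withDensity_eq_integral_toReal_smul measurable_evenWeight hlt,
    integral_withDensity_eq_integral_toReal_smul measurable_evenWeight hlt] at h
  simpa [evenWeight_toReal] using h

lemma IsLDensity.integrable_neg_iff {a : Measure EReal} (ha : IsLDensity a) {f : EReal → ℝ}
    (hf : Measurable f) :
    Integrable (fun x => (1 - tanhHalf x) * f (-x)) a ↔
      Integrable (fun x => (1 - tanhHalf x) * f x) a := by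
  have hlt : ∀ᵐ x ∂a, evenWeight x < ∞ := Eventually.of_forall fun x => ENNReal.ofReal_lt_top
  have h := congrArg (fun ν => Integrable f ν) ha.map_neg_withDensity
  beta_reduce at h
  rw [integrable_map_measure hf.aestronglyMeasurable measurable_neg.aemeasurable,
    integrable_withDensity_iff_integrable_smul' measurable_evenWeight hlt,
    integrable_withDensity_iff_integrable_smul' measurable_evenWeight hlt] at h
  simpa [evenWeight_toReal] using h

/-- `logTwo` grows only linearly towards `-∞`, where `1 + tanhHalf` decays exponentially. The
constant comes from `log (1 + u) ≤ 1 + u`. -/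
lemma one_add_tanhHalf_mul_logTwo_mem (x : EReal) :
    (1 + tanhHalf x) * logTwo x ∈ Icc 0 (2 / Real.log 2) := by
  have hl := Real.log_pos one_lt_two
  refine ⟨mul_nonneg (by linarith [neg_one_le_tanhHalf x]) (logTwo_nonneg x), ?_⟩
  induction x with
  | bot => simp; positivity
  | top => simp; positivity
  | coe r =>
    have h1 := Real.exp_pos (-r)
    have h2 : Real.log (1 + Real.exp (-r)) ≤ 1 + Real.exp (-r) := by
      linarith [Real.log_le_sub_one_of_pos (by positivity : 0 < 1 + Real.exp (-r))]
    rw [one_add_tanhHalf_coe, logTwo_coe, Real.logb, div_mul_div_comm]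
    rw [div_le_div_iff₀ (by positivity) hl]
    nlinarith [mul_le_mul_of_nonneg_left h2 hl.le]

lemma measurable_one_add_tanhHalf_mul_logTwo :
    Measurable fun x => (1 + tanhHalf x) * logTwo x :=
  (measurable_tanhHalf.const_add 1).mul measurable_logTwo

lemma integrable_one_add_tanhHalf_mul_logTwo (a : Measure EReal) [IsFiniteMeasure a] :
    Integrable (fun x => (1 + tanhHalf x) * logTwo x) a := by
  refine Integrable.of_bound measurable_one_add_tanhHalf_mul_logTwo.aestronglyMeasurable
    (2 / Real.log 2) (Eventually.of_forall fun x => ?_)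
  rw [Real.norm_of_nonneg (one_add_tanhHalf_mul_logTwo_mem x).1]
  exact (one_add_tanhHalf_mul_logTwo_mem x).2

lemma integrable_one_sub_tanhHalf_mul_logTwo_neg (a : Measure EReal) [IsFiniteMeasure a] :
    Integrable (fun x => (1 - tanhHalf x) * logTwo (-x)) a := by
  have h : ∀ x, (1 - tanhHalf x) * logTwo (-x) = (1 + tanhHalf (-x)) * logTwo (-x) := fun x => by
    rw [tanhHalf_neg]; ring
  simp only [h]
  refine Integrable.of_bound (measurable_one_add_tanhHalf_mul_logTwo.comp
    measurable_neg).aestronglyMeasurable (2 / Real.log 2) (Eventually.of_forall fun x => ?_)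
  rw [Real.norm_of_nonneg (one_add_tanhHalf_mul_logTwo_mem _).1]
  exact (one_add_tanhHalf_mul_logTwo_mem _).2

/-- `logTwo` is unbounded, but it is half the sum of its products with `1 + tanhHalf` and `1 -
tanhHalf`. The first product is bounded, and symmetry reflects the second into a bounded one. -/
lemma IsLDensity.integrable_logTwo {a : Measure EReal} (ha : IsLDensity a) :
    Integrable logTwo a := by
  have := ha.prob
  have h1 := (ha.integrable_neg_iff measurable_logTwo).1
    (integrable_one_sub_tanhHalf_mul_logTwo_neg a)
  have h2 := integrable_one_add_tanhHalf_mul_logTwo a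
  refine ((h1.add h2).div_const 2).congr (Eventually.of_forall fun x => ?_)
  simp only [Pi.add_apply]
  ring

lemma logTwo_even_part (x : EReal) :
    ((1 + tanhHalf x) * logTwo x + (1 - tanhHalf x) * logTwo (-x)) / 2 =
      biasEntropy (tanhHalf x) := by
  induction x with
  | bot => simp [biasEntropy_neg, biasEntropy_one]
  | top => simp [biasEntropy_one]
  | coe r =>
    have h := tanhHalf_coe_lt_one r
    have h' := neg_one_lt_tanhHalf_coe r
    rw [logTwo_eq (EReal.coe_ne_bot r), logTwo_eq (by rw [← EReal.coe_neg]; exact EReal.coe_ne_bot _),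
      tanhHalf_neg, biasEntropy, Real.logb, Real.logb]
    field_simp
    ring_nf

/-- Reflecting the part weighted by `1 - tanhHalf` replaces the unbounded kernel by a continuous
even function of the bias, which can be expanded in powers and tested against weak convergence. -/
lemma IsLDensity.entropy_eq {a : Measure EReal} (ha : IsLDensity a) :
    entropy a = ∫ x, biasEntropy (tanhHalf x) ∂a := by
  have := ha.prob
  have h1 := (ha.integrable_neg_iff measurable_logTwo).1
    (integrable_one_sub_tanhHalf_mul_logTwo_neg a)
  have h2 := integrable_one_add_tanhHalf_mul_logTwo a
  simp only [← logTwo_even_part]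
  rw [integral_div, integral_add h2 (integrable_one_sub_tanhHalf_mul_logTwo_neg a),
    ha.integral_neg measurable_logTwo, ← integral_add h2 h1, ← integral_div, entropy]
  refine integral_congr_ae (Eventually.of_forall fun x => ?_)
  simp only
  ring

/-- Termwise integration, dominated by the summable weights. Since all weights are positive, later
comparisons of entropies can be made moment by moment. -/
lemma IsLDensity.hasSum_entropy {a : Measure EReal} (ha : IsLDensity a) :
    HasSum (fun k => entropyWeight k * (1 - moment k a)) (entropy a) := by
  have := ha.prob
  have hint : ∀ k, Integrable (fun x => entropyWeight k * (1 - tanhHalf x ^ (2 * k + 2))) a :=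
    fun k => ((integrable_const 1).sub (integrable_tanhHalf_pow k a)).const_mul _
  have h := hasSum_integral_of_summable_integral_norm hint (by
    refine Summable.of_nonneg_of_le (fun k => integral_nonneg fun x => norm_nonneg _)
      (fun k => ?_) summable_entropyWeight
    have : ∫ _ : EReal, entropyWeight k ∂a = entropyWeight k := by simp
    refine (integral_mono (hint k).norm (integrable_const (entropyWeight k)) fun x => ?_).trans
      this.le
    have h0 := tanhHalf_pow_mem k x
    have h1 := (entropyWeight_pos k).le
    simp only
    rw [norm_mul, Real.norm_of_nonneg h1, Real.norm_of_nonneg (by linarith [h0.2])]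
    exact mul_le_of_le_one_right h1 (by linarith [h0.1]))
  rw [ha.entropy_eq]
  have hs : ∫ x, biasEntropy (tanhHalf x) ∂a =
      ∫ x, ∑' k, entropyWeight k * (1 - tanhHalf x ^ (2 * k + 2)) ∂a :=
    integral_congr_ae (Eventually.of_forall fun x =>
      (hasSum_biasEntropy (tanhHalf_mem_Icc x)).tsum_eq.symm)
  rw [hs]
  refine h.congr_fun fun k => ?_
  rw [integral_const_mul, integral_sub (integrable_const 1) (integrable_tanhHalf_pow k a)]
  simp [moment]

lemma moment_checkConv (k : ℕ) (a b : Measure EReal) [IsProbabilityMeasure a]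
    [IsProbabilityMeasure b] : moment k (checkConv a b) = moment k a * moment k b := by
  rw [moment, checkConv, integral_map measurable_checkOp.aemeasurable
    (measurable_tanhHalf.pow_const _).aestronglyMeasurable]
  simp only [tanhHalf_checkOp, mul_pow]
  exact integral_prod_mul (fun x => tanhHalf x ^ (2 * k + 2)) fun y => tanhHalf y ^ (2 * k + 2)

lemma IsLDensity.integrable_logTwo_add {a b : Measure EReal} (ha : IsLDensity a)
    (hb : IsLDensity b) : Integrable (fun p : EReal × EReal => logTwo (p.1 + p.2)) (a.prod b) :=
  (ha.starConv hb).integrable_logTwo.comp_measurable measurable_add_ereal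

/-- The duality rule for entropies. -/
lemma IsLDensity.entropy_starConv_add_entropy_checkConv {a b : Measure EReal} (ha : IsLDensity a)
    (hb : IsLDensity b) :
    entropy (LDPC.starConv a b) + entropy (LDPC.checkConv a b) = entropy a + entropy b := by
  have := ha.prob
  have := hb.prob
  have h1 := ha.integrable_logTwo_add hb
  have h2 : Integrable (fun p : EReal × EReal => logTwo (checkOp p.1 p.2)) (a.prod b) :=
    (ha.checkConv hb).integrable_logTwo.comp_measurable measurable_checkOp
  have h3 : Integrable (fun p : EReal × EReal => logTwo p.1) (a.prod b) :=
    ha.integrable_logTwo.comp_fst b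
  have h4 : Integrable (fun p : EReal × EReal => logTwo p.2) (a.prod b) :=
    hb.integrable_logTwo.comp_snd a
  have e3 : entropy a = ∫ p, logTwo p.1 ∂(a.prod b) := by
    rw [integral_fun_fst]; simp [entropy]
  have e4 : entropy b = ∫ p, logTwo p.2 ∂(a.prod b) := by
    rw [integral_fun_snd]; simp [entropy]
  rw [e3, e4, entropy, entropy, LDPC.starConv, LDPC.checkConv,
    integral_map measurable_add_ereal.aemeasurable measurable_logTwo.aestronglyMeasurable,
    integral_map measurable_checkOp.aemeasurable measurable_logTwo.aestronglyMeasurable,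
    ← integral_add h1 h2, ← integral_add h3 h4]
  refine integral_congr_ae ?_
  filter_upwards [ha.ae_prod_ne_bot hb] with p hp
  exact logTwo_add_add_logTwo_checkOp hp.1 hp.2

/-! ### Degradation as a convex order -/

lemma integral_mixture {ι : Type*} (s : Finset ι) (p : ι → ℝ) (m : ι → Measure EReal)
    (hp : ∀ i ∈ s, 0 ≤ p i) {f : EReal → ℝ} (hf : ∀ i ∈ s, Integrable f (m i)) :
    ∫ x, f x ∂(∑ i ∈ s, ENNReal.ofReal (p i) • m i) = ∑ i ∈ s, p i * ∫ x, f x ∂(m i) := by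
  rw [integral_finsetSum_measure fun i hi => (hf i hi).smul_measure ENNReal.ofReal_ne_top]
  refine Finset.sum_congr rfl fun i hi => ?_
  rw [integral_smul_measure, ENNReal.toReal_ofReal (hp i hi), smul_eq_mul]

/-- Bounded even convex functions on `[-1, 1]`, the test functions of degradation. -/
structure IsTestFun (f : ℝ → ℝ) : Prop where
  even : ∀ t, f (-t) = f t
  convex : ConvexOn ℝ (Icc (-1) 1) f
  measurable : Measurable f
  bounded : ∃ C, ∀ t ∈ Icc (-1 : ℝ) 1, |f t| ≤ C

/-- `a` is degraded with respect to `b`. -/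
def Degraded (a b : Measure EReal) : Prop :=
  ∀ f, IsTestFun f → ∫ x, f (tanhHalf x) ∂a ≤ ∫ x, f (tanhHalf x) ∂b

lemma Degraded.refl (a : Measure EReal) : Degraded a a := fun _ _ => le_rfl

lemma Degraded.trans {a b c : Measure EReal} (h : Degraded a b) (h' : Degraded b c) :
    Degraded a c := fun f hf => (h f hf).trans (h' f hf)

lemma IsTestFun.integrable {f : ℝ → ℝ} (hf : IsTestFun f) (a : Measure EReal)
    [IsFiniteMeasure a] : Integrable (fun x => f (tanhHalf x)) a := by
  obtain ⟨C, hC⟩ := hf.bounded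
  exact Integrable.of_bound (hf.measurable.comp measurable_tanhHalf).aestronglyMeasurable C
    (Eventually.of_forall fun x => hC _ (tanhHalf_mem_Icc x))

lemma isTestFun_pow (k : ℕ) : IsTestFun fun t => t ^ (2 * k + 2) where
  even t := by rw [show 2 * k + 2 = 2 * (k + 1) by ring, pow_mul, pow_mul, neg_sq]
  convex := (Even.convexOn_pow (⟨k + 1, by ring⟩ : Even (2 * k + 2))).subset (subset_univ _)
    (convex_Icc _ _)
  measurable := by fun_prop
  bounded := ⟨1, fun t ht => by
    rw [abs_pow]; exact pow_le_one₀ (abs_nonneg _) (abs_le.2 ht)⟩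

lemma Degraded.moment_le {a b : Measure EReal} (h : Degraded a b) (k : ℕ) :
    moment k a ≤ moment k b := h _ (isTestFun_pow k)

/-- The bias of a bit with two independent observations of biases `s` and `t`. -/
noncomputable def biasAdd (s t : ℝ) : ℝ := (s + t) / (1 + s * t)

lemma biasAdd_neg_neg (s t : ℝ) : biasAdd (-s) (-t) = -biasAdd s t := by
  rw [biasAdd, biasAdd, neg_mul_neg, ← neg_div]; ring_nf

lemma biasAdd_neg_left (s t : ℝ) : biasAdd (-s) t = -biasAdd s (-t) := by
  rw [← biasAdd_neg_neg, neg_neg]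

lemma one_add_mul_nonneg {s t : ℝ} (hs : s ∈ Icc (-1 : ℝ) 1) (ht : t ∈ Icc (-1 : ℝ) 1) :
    0 ≤ 1 + s * t := by
  linarith [(mul_mem_Icc_neg_one_one hs ht).1]

lemma biasAdd_mem {s t : ℝ} (hs : s ∈ Icc (-1 : ℝ) 1) (ht : t ∈ Icc (-1 : ℝ) 1) :
    biasAdd s t ∈ Icc (-1 : ℝ) 1 := by
  obtain ⟨h1, h2⟩ := hs
  obtain ⟨h3, h4⟩ := ht
  rcases (one_add_mul_nonneg ⟨h1, h2⟩ ⟨h3, h4⟩).eq_or_lt with h | h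
  · rw [biasAdd, ← h]; simp
  · rw [biasAdd, mem_Icc, le_div_iff₀ h, div_le_iff₀ h]
    constructor <;> nlinarith

lemma neg_mem_Icc_neg_one_one {t : ℝ} (ht : t ∈ Icc (-1 : ℝ) 1) : -t ∈ Icc (-1 : ℝ) 1 :=
  ⟨by linarith [ht.2], by linarith [ht.1]⟩

/-- The perspective of a convex function along the variable-node operation is convex. -/
lemma convexOn_perspective {f : ℝ → ℝ} (hf : ConvexOn ℝ (Icc (-1) 1) f) {t : ℝ}
    (ht : t ∈ Icc (-1 : ℝ) 1) :
    ConvexOn ℝ (Icc (-1) 1) fun s => (1 + s * t) * f (biasAdd s t) := by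
  refine ⟨convex_Icc _ _, fun s hs u hu v w hv hw hvw => ?_⟩
  have hs0 := one_add_mul_nonneg hs ht
  have hu0 := one_add_mul_nonneg hu ht
  -- At `1 + r t = 0` the quotient `biasAdd r t` has the default value `0`; there `r = -t`, so the
  -- identity still holds and the degenerate corners need no separate definition.
  have hz : ∀ r ∈ Icc (-1 : ℝ) 1, (1 + r * t) * biasAdd r t = r + t := by
    intro r hr
    rcases eq_or_ne (1 + r * t) 0 with h | h
    · rw [h, zero_mul]
      have h1 : r * t = -1 := by linarith
      have h2 : (r + t) ^ 2 ≤ 0 := by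
        nlinarith [hr.1, hr.2, ht.1, ht.2, sq_nonneg (r + t)]
      exact (pow_eq_zero_iff two_ne_zero).1 (le_antisymm h2 (sq_nonneg _)) |>.symm
    · rw [biasAdd, mul_div_cancel₀ _ h]
  simp only [smul_eq_mul]
  set d := 1 + (v * s + w * u) * t with hd
  have hdd : d = v * (1 + s * t) + w * (1 + u * t) := by
    rw [hd]; linear_combination -hvw
  have hv1 : 0 ≤ v * (1 + s * t) := mul_nonneg hv hs0
  have hw1 : 0 ≤ w * (1 + u * t) := mul_nonneg hw hu0
  rcases (by linarith : 0 ≤ d).eq_or_lt with h0 | h0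
  · have h1 : v * (1 + s * t) = 0 := by linarith
    have h2 : w * (1 + u * t) = 0 := by linarith
    rw [← h0, ← mul_assoc, ← mul_assoc, h1, h2]
    simp
  -- Jensen with the tilted weights `v (1 + s t) / d` and `w (1 + u t) / d`, under which the mean of
  -- the two output biases is the output bias of the mean input.
  · have key := hf.2 (biasAdd_mem hs ht) (biasAdd_mem hu ht) (div_nonneg hv1 h0.le)
      (div_nonneg hw1 h0.le) (by rw [← add_div, ← hdd, div_self h0.ne'])
    have harg : (v * (1 + s * t) / d) • biasAdd s t + (w * (1 + u * t) / d) • biasAdd u t =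
        biasAdd (v * s + w * u) t := by
      have e1 := hz s hs
      have e2 := hz u hu
      rw [show biasAdd (v * s + w * u) t = (v * s + w * u + t) / d from rfl, eq_div_iff h0.ne']
      simp only [smul_eq_mul]
      field_simp
      linear_combination v * e1 + w * e2 + t * hvw
    rw [harg] at key
    simp only [smul_eq_mul] at key
    have := mul_le_mul_of_nonneg_left key h0.le
    refine this.trans_eq ?_
    field_simp

/-- The conditional expectation of the test function `f` of the output bias of a variable node with
input biases `±s` and `±t`. -/
noncomputable def varPerspective (f : ℝ → ℝ) (s t : ℝ) : ℝ :=
  ((1 + s * t) * f (biasAdd s t) + (1 + s * -t) * f (biasAdd s (-t))) / 2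

lemma measurable_varPerspective {f : ℝ → ℝ} (hf : Measurable f) :
    Measurable fun p : ℝ × ℝ => varPerspective f p.1 p.2 := by
  unfold varPerspective biasAdd
  fun_prop

lemma abs_varPerspective_le {f : ℝ → ℝ} {C : ℝ} (hC : ∀ t ∈ Icc (-1 : ℝ) 1, |f t| ≤ C) {s t : ℝ}
    (hs : s ∈ Icc (-1 : ℝ) 1) (ht : t ∈ Icc (-1 : ℝ) 1) : |varPerspective f s t| ≤ C := by
  have ht' := neg_mem_Icc_neg_one_one ht
  have h1 := one_add_mul_nonneg hs ht
  have h2 := one_add_mul_nonneg hs ht'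
  have h3 := abs_le.1 (hC _ (biasAdd_mem hs ht))
  have h4 := abs_le.1 (hC _ (biasAdd_mem hs ht'))
  rw [varPerspective, abs_le]
  constructor <;> nlinarith

/-- Changing the sign of `s` exchanges the two summands because `f` is even, and each summand is a
convex perspective, at `t` and at `-t`. -/
lemma IsTestFun.varPerspective {f : ℝ → ℝ} (hf : IsTestFun f) {t : ℝ} (ht : t ∈ Icc (-1 : ℝ) 1) :
    IsTestFun fun s => varPerspective f s t where
  even s := by
    simp only [LDPC.varPerspective, biasAdd_neg_left s, hf.even, neg_neg]
    ring
  convex := by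
    have h1 := (convexOn_perspective hf.convex ht).add
      (convexOn_perspective hf.convex (neg_mem_Icc_neg_one_one ht))
    have h2 := h1.smul (by norm_num : (0 : ℝ) ≤ 1 / 2)
    refine h2.congr fun s _ => ?_
    simp only [LDPC.varPerspective, Pi.add_apply, smul_eq_mul]
    ring
  measurable := (measurable_varPerspective hf.measurable).comp (measurable_id.prodMk
    measurable_const)
  bounded := by
    obtain ⟨C, hC⟩ := hf.bounded
    exact ⟨C, fun s hs => abs_varPerspective_le hC hs ht⟩

lemma IsTestFun.comp_mul {f : ℝ → ℝ} (hf : IsTestFun f) {t : ℝ} (ht : t ∈ Icc (-1 : ℝ) 1) :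
    IsTestFun fun s => f (s * t) where
  even s := by rw [neg_mul, hf.even]
  convex := by
    refine ⟨convex_Icc _ _, fun s hs u hu v w hv hw hvw => ?_⟩
    have := hf.convex.2 (mul_mem_Icc_neg_one_one hs ht) (mul_mem_Icc_neg_one_one hu ht) hv hw hvw
    simp only [smul_eq_mul] at this ⊢
    convert this using 2
    ring
  measurable := hf.measurable.comp (measurable_id.mul_const t)
  bounded := by
    obtain ⟨C, hC⟩ := hf.bounded
    exact ⟨C, fun s hs => hC _ (mul_mem_Icc_neg_one_one hs ht)⟩

/-- Symmetrization of a bounded function under an L-density. -/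
lemma IsLDensity.integral_symmetrize {a : Measure EReal} (ha : IsLDensity a) {f : EReal → ℝ}
    (hf : Measurable f) {C : ℝ} (hC : ∀ x, |f x| ≤ C) :
    ∫ x, f x ∂a = ∫ x, ((1 + tanhHalf x) * f x + (1 - tanhHalf x) * f (-x)) / 2 ∂a := by
  have := ha.prob
  have hb : ∀ (u : EReal → ℝ) (g : EReal → ℝ), Measurable u → Measurable g →
      (∀ x, |u x| ≤ 2) → (∀ x, |g x| ≤ C) → Integrable (fun x => u x * g x) a := by
    intro u g hu hg h2 hC
    refine Integrable.of_bound (hu.mul hg).aestronglyMeasurable (2 * C)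
      (Eventually.of_forall fun x => ?_)
    rw [Real.norm_eq_abs, abs_mul]
    exact mul_le_mul (h2 x) (hC x) (abs_nonneg _) zero_le_two
  have h2 : ∀ x, |1 + tanhHalf x| ≤ 2 := fun x => by
    rw [abs_le]; constructor <;> linarith [neg_one_le_tanhHalf x, tanhHalf_le_one x]
  have h3 : ∀ x, |1 - tanhHalf x| ≤ 2 := fun x => by
    rw [abs_le]; constructor <;> linarith [neg_one_le_tanhHalf x, tanhHalf_le_one x]
  have i1 := hb _ _ (measurable_tanhHalf.const_add 1) hf h2 hC
  have i2 := hb _ _ (measurable_tanhHalf.const_sub 1) hf h3 hC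
  have i3 := hb _ _ (measurable_tanhHalf.const_sub 1) (hf.comp measurable_neg) h3 fun x => hC _
  simp only [Function.comp] at i3
  rw [integral_div, integral_add i1 i3, ha.integral_neg hf, ← integral_add i1 i2, ← integral_div]
  refine integral_congr_ae (Eventually.of_forall fun x => ?_)
  simp only
  ring

lemma measurable_tanhHalf_prod : Measurable fun p : EReal × EReal => (tanhHalf p.1, tanhHalf p.2) :=
  (measurable_tanhHalf.comp measurable_fst).prodMk (measurable_tanhHalf.comp measurable_snd)

lemma integrable_varPerspective {f : ℝ → ℝ} (hf : IsTestFun f) (a b : Measure EReal)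
    [IsFiniteMeasure a] [IsFiniteMeasure b] :
    Integrable (fun p : EReal × EReal => varPerspective f (tanhHalf p.1) (tanhHalf p.2))
      (a.prod b) := by
  obtain ⟨C, hC⟩ := hf.bounded
  exact Integrable.of_bound ((measurable_varPerspective hf.measurable).comp
    measurable_tanhHalf_prod).aestronglyMeasurable C
    (Eventually.of_forall fun p => abs_varPerspective_le hC (tanhHalf_mem_Icc _)
      (tanhHalf_mem_Icc _))

/-- Symmetrizing in both inputs produces four sign patterns; evenness of `f` merges them in pairs
with total weights `1 + s t` and `1 - s t`. For fixed `y` the inner integrand is then a test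
function of the first bias. -/
lemma IsLDensity.integral_starConv {a b : Measure EReal} (ha : IsLDensity a) (hb : IsLDensity b)
    {f : ℝ → ℝ} (hf : IsTestFun f) :
    ∫ x, f (tanhHalf x) ∂(LDPC.starConv a b) =
      ∫ y, ∫ x, varPerspective f (tanhHalf x) (tanhHalf y) ∂a ∂b := by
  have := ha.prob
  have := hb.prob
  obtain ⟨C, hC⟩ := hf.bounded
  have hfm := hf.measurable
  have hD := measurable_tanhHalf
  have hCK : ∀ x y : EReal, |f (biasAdd (tanhHalf x) (tanhHalf y))| ≤ C := fun x y =>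
    hC _ (biasAdd_mem (tanhHalf_mem_Icc x) (tanhHalf_mem_Icc y))
  have hKm : Measurable fun p : EReal × EReal => f (biasAdd (tanhHalf p.1) (tanhHalf p.2)) := by
    unfold biasAdd; fun_prop
  set S : EReal × EReal → ℝ := fun p =>
    ((1 + tanhHalf p.1) * f (biasAdd (tanhHalf p.1) (tanhHalf p.2)) +
      (1 - tanhHalf p.1) * f (biasAdd (-tanhHalf p.1) (tanhHalf p.2))) / 2 with hS
  have hSm : Measurable S := by
    simp only [hS]; unfold biasAdd; fun_prop
  have hSC : ∀ p, |S p| ≤ C := fun p => by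
    have h1 := abs_le.1 (hCK p.1 p.2)
    have h2 := abs_le.1 (hCK (-p.1) p.2)
    have h3 := tanhHalf_mem_Icc p.1
    rw [tanhHalf_neg] at h2
    simp only [hS]
    rw [abs_le]
    constructor <;> nlinarith [h3.1, h3.2]
  have hint : ∀ {g : EReal × EReal → ℝ}, Measurable g → (∀ p, |g p| ≤ C) →
      Integrable g (a.prod b) := fun hg hgC =>
    Integrable.of_bound hg.aestronglyMeasurable C (Eventually.of_forall hgC)
  rw [LDPC.starConv, integral_map measurable_add_ereal.aemeasurable
    (f := fun x => f (tanhHalf x)) (hfm.comp hD).aestronglyMeasurable]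
  calc ∫ p, f (tanhHalf (p.1 + p.2)) ∂(a.prod b)
      = ∫ p, f (biasAdd (tanhHalf p.1) (tanhHalf p.2)) ∂(a.prod b) := by
        refine integral_congr_ae ?_
        filter_upwards [ha.ae_prod_ne_bot hb] with p hp
        rw [tanhHalf_add hp.1 hp.2, biasAdd]
    _ = ∫ y, ∫ x, f (biasAdd (tanhHalf x) (tanhHalf y)) ∂a ∂b :=
        integral_prod_symm _ (hint hKm fun p => hCK _ _)
    _ = ∫ y, ∫ x, S (x, y) ∂a ∂b := by
        refine integral_congr_ae (Eventually.of_forall fun y => ?_)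
        have := ha.integral_symmetrize
          (f := fun x => f (biasAdd (tanhHalf x) (tanhHalf y))) (by unfold biasAdd; fun_prop)
          fun x => hCK x y
        simpa only [tanhHalf_neg] using this
    _ = ∫ x, ∫ y, S (x, y) ∂b ∂a := by
        rw [← integral_prod_symm _ (hint hSm hSC), integral_prod _ (hint hSm hSC)]
    _ = ∫ x, ∫ y, varPerspective f (tanhHalf x) (tanhHalf y) ∂b ∂a := by
        refine integral_congr_ae (Eventually.of_forall fun x => ?_)
        have := hb.integral_symmetrize (f := fun y => S (x, y)) (by fun_prop) fun y => hSC _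
        beta_reduce
        rw [this]
        refine integral_congr_ae (Eventually.of_forall fun y => ?_)
        simp only [hS, tanhHalf_neg, varPerspective, biasAdd_neg_left, hf.even, neg_neg]
        ring
    _ = _ := by
        have hi := integrable_varPerspective hf a b
        rw [← integral_prod_symm _ hi, integral_prod _ hi]

/-! ### Algebra and monotonicity of the two convolutions -/

lemma starConv_comm (a b : Measure EReal) [SFinite a] [SFinite b] : starConv a b = starConv b a :=
  Measure.conv_comm a b

lemma starConv_assoc (a b c : Measure EReal) [SFinite b] [SFinite c] :
    starConv (starConv a b) c = starConv a (starConv b c) :=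
  Measure.conv_assoc a b c

lemma starConv_deltaZero (a : Measure EReal) [SFinite a] : starConv a deltaZero = a :=
  Measure.conv_dirac_zero a

lemma checkConv_comm (a b : Measure EReal) [SFinite a] [SFinite b] :
    checkConv a b = checkConv b a := by
  rw [checkConv, ← Measure.prod_swap, Measure.map_map measurable_checkOp measurable_swap, checkConv]
  congr 1
  funext p
  exact checkOp_comm _ _

/-- For each fixed value of the second input, the first is integrated against a test function, so
the convex order can be applied pointwise. -/
lemma Degraded.starConv_right {a a' b : Measure EReal} (h : Degraded a a') (ha : IsLDensity a)
    (ha' : IsLDensity a') (hb : IsLDensity b) :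
    Degraded (LDPC.starConv a b) (LDPC.starConv a' b) := by
  intro f hf
  have := ha.prob
  have := ha'.prob
  have := hb.prob
  rw [ha.integral_starConv hb hf, ha'.integral_starConv hb hf]
  exact integral_mono (integrable_varPerspective hf a b).integral_prod_right
    (integrable_varPerspective hf a' b).integral_prod_right
    fun y => h _ (hf.varPerspective (tanhHalf_mem_Icc y))

lemma Degraded.starConv {a a' b b' : Measure EReal} (h : Degraded a a') (h' : Degraded b b')
    (ha : IsLDensity a) (ha' : IsLDensity a') (hb : IsLDensity b) (hb' : IsLDensity b') :
    Degraded (LDPC.starConv a b) (LDPC.starConv a' b') := by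
  have := ha.prob
  have := ha'.prob
  have := hb.prob
  have := hb'.prob
  refine (h.starConv_right ha ha' hb).trans ?_
  rw [starConv_comm a', starConv_comm a']
  exact h'.starConv_right hb hb' ha'

lemma integrable_comp_mul {f : ℝ → ℝ} (hf : IsTestFun f) (a b : Measure EReal)
    [IsFiniteMeasure a] [IsFiniteMeasure b] :
    Integrable (fun p : EReal × EReal => f (tanhHalf p.1 * tanhHalf p.2)) (a.prod b) := by
  obtain ⟨C, hC⟩ := hf.bounded
  exact Integrable.of_bound (hf.measurable.comp (measurable_mul.comp
    measurable_tanhHalf_prod)).aestronglyMeasurable C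
    (Eventually.of_forall fun p => hC _ (mul_mem_Icc_neg_one_one (tanhHalf_mem_Icc _)
      (tanhHalf_mem_Icc _)))

lemma integral_checkConv {f : ℝ → ℝ} (hf : IsTestFun f) (a b : Measure EReal)
    [IsFiniteMeasure a] [IsFiniteMeasure b] :
    ∫ x, f (tanhHalf x) ∂(checkConv a b) = ∫ y, ∫ x, f (tanhHalf x * tanhHalf y) ∂a ∂b := by
  rw [checkConv, integral_map measurable_checkOp.aemeasurable
    (f := fun x => f (tanhHalf x)) (hf.measurable.comp measurable_tanhHalf).aestronglyMeasurable]
  simp only [tanhHalf_checkOp]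
  exact integral_prod_symm _ (integrable_comp_mul hf a b)

lemma Degraded.checkConv_right {a a' b : Measure EReal} (h : Degraded a a') [IsFiniteMeasure a]
    [IsFiniteMeasure a'] [IsFiniteMeasure b] : Degraded (checkConv a b) (checkConv a' b) := by
  intro f hf
  rw [integral_checkConv hf, integral_checkConv hf]
  exact integral_mono (integrable_comp_mul hf a b).integral_prod_right
    (integrable_comp_mul hf a' b).integral_prod_right
    fun y => h _ (hf.comp_mul (tanhHalf_mem_Icc y))

lemma Degraded.checkConv {a a' b b' : Measure EReal} (h : Degraded a a') (h' : Degraded b b')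
    [IsFiniteMeasure a] [IsFiniteMeasure a'] [IsFiniteMeasure b] [IsFiniteMeasure b'] :
    Degraded (LDPC.checkConv a b) (LDPC.checkConv a' b') := by
  refine h.checkConv_right.trans ?_
  rw [checkConv_comm a', checkConv_comm a']
  exact h'.checkConv_right

lemma Degraded.starPow {a a' : Measure EReal} (h : Degraded a a') (ha : IsLDensity a)
    (ha' : IsLDensity a') (n : ℕ) : Degraded (starPow a n) (starPow a' n) := by
  induction n with
  | zero => exact Degraded.refl _
  | succ n ih => exact ih.starConv h (ha.starPow n) (ha'.starPow n) ha ha'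

lemma Degraded.checkPow {a a' : Measure EReal} (h : Degraded a a') (ha : IsLDensity a)
    (ha' : IsLDensity a') (n : ℕ) : Degraded (checkPow a n) (checkPow a' n) := by
  induction n with
  | zero => exact Degraded.refl _
  | succ n ih =>
    have := ha.prob
    have := ha'.prob
    have := (ha.checkPow n).prob
    have := (ha'.checkPow n).prob
    exact ih.checkConv h

lemma Degraded.mixture {ι : Type*} (s : Finset ι) (p : ι → ℝ) (m m' : ι → Measure EReal)
    (hp : ∀ i ∈ s, 0 ≤ p i) (hm : ∀ i ∈ s, IsLDensity (m i)) (hm' : ∀ i ∈ s, IsLDensity (m' i))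
    (h : ∀ i ∈ s, Degraded (m i) (m' i)) :
    Degraded (∑ i ∈ s, ENNReal.ofReal (p i) • m i) (∑ i ∈ s, ENNReal.ofReal (p i) • m' i) := by
  intro f hf
  rw [integral_mixture s p m hp fun i hi => by have := (hm i hi).prob; exact hf.integrable _,
    integral_mixture s p m' hp fun i hi => by have := (hm' i hi).prob; exact hf.integrable _]
  exact Finset.sum_le_sum fun i hi => mul_le_mul_of_nonneg_left (h i hi f hf) (hp i hi)

lemma Degraded.checkOut {r : Polynomial ℝ} (hr : IsDegreeDistribution r) {a a' : Measure EReal}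
    (h : Degraded a a') (ha : IsLDensity a) (ha' : IsLDensity a') :
    Degraded (checkOut r a) (checkOut r a') :=
  Degraded.mixture _ _ _ _ (fun j _ => hr.1 j) (fun j _ => ha.checkPow j)
    (fun j _ => ha'.checkPow j) fun j _ => h.checkPow ha ha' j

lemma Degraded.varOut {l : Polynomial ℝ} (hl : IsDegreeDistribution l) {c b b' : Measure EReal}
    (h : Degraded b b') (hc : IsLDensity c) (hb : IsLDensity b) (hb' : IsLDensity b') :
    Degraded (varOut l c b) (varOut l c b') :=
  Degraded.mixture _ _ _ _ (fun j _ => hl.1 j) (fun j _ => hc.starConv (hb.starPow j))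
    (fun j _ => hc.starConv (hb'.starPow j)) fun j _ =>
      (Degraded.refl c).starConv (h.starPow hb hb' j) hc hc (hb.starPow j) (hb'.starPow j)

/-- An even convex function attains its minimum at bias `0`. -/
lemma deltaZero_degraded (a : Measure EReal) [IsProbabilityMeasure a] : Degraded deltaZero a := by
  intro f hf
  have h0 : ∀ t ∈ Icc (-1 : ℝ) 1, f 0 ≤ f t := fun t ht => by
    have := hf.convex.2 ht (neg_mem_Icc_neg_one_one ht) (by norm_num : (0 : ℝ) ≤ 1 / 2)
      (by norm_num : (0 : ℝ) ≤ 1 / 2) (by norm_num)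
    simp only [smul_eq_mul, hf.even] at this
    rw [show 1 / 2 * t + 1 / 2 * -t = 0 by ring] at this
    linarith
  have h1 : ∫ x, f (tanhHalf x) ∂deltaZero = f 0 := by simp [deltaZero]
  rw [h1]
  have h2 := integral_mono (integrable_const (f 0)) (hf.integrable a)
    fun x => h0 _ (tanhHalf_mem_Icc x)
  simpa using h2

/-! ### Polynomial mixtures of L-densities -/

/-- A family of measures that is, for parameters in `[u, v]`, a mixture of finitely many L-densities
with polynomial weights. -/
structure PolyRep (μ : ℝ → Measure EReal) (u v : ℝ) where
  ι : Type
  [fin : Fintype ι]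
  p : ι → Polynomial ℝ
  m : ι → Measure EReal
  ld : ∀ i, IsLDensity (m i)
  nonneg : ∀ i, ∀ t ∈ Icc u v, 0 ≤ (p i).eval t
  sum_eq : ∑ i, p i = 1
  eq : ∀ t ∈ Icc u v, μ t = ∑ i, ENNReal.ofReal ((p i).eval t) • m i

attribute [instance] PolyRep.fin

namespace PolyRep

variable {μ ν : ℝ → Measure EReal} {u v : ℝ}

lemma sum_eval (R : PolyRep μ u v) (t : ℝ) : ∑ i, (R.p i).eval t = 1 := by
  rw [← Polynomial.eval_finsetSum, R.sum_eq, Polynomial.eval_one]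

lemma sum_derivative (R : PolyRep μ u v) (t : ℝ) : ∑ i, (R.p i).derivative.eval t = 0 := by
  rw [← Polynomial.eval_finsetSum, ← Polynomial.derivative_sum, R.sum_eq]
  simp

lemma isLDensity (R : PolyRep μ u v) {t : ℝ} (ht : t ∈ Icc u v) : IsLDensity (μ t) := by
  rw [R.eq t ht]
  exact isLDensity_mixture _ _ _ (fun i _ => R.nonneg i t ht) (R.sum_eval t) fun i _ => R.ld i

/-- A constant family. -/
noncomputable def const {a : Measure EReal} (ha : IsLDensity a) (u v : ℝ) :
    PolyRep (fun _ => a) u v where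
  ι := Unit
  p _ := 1
  m _ := a
  ld _ := ha
  nonneg _ _ _ := by simp
  sum_eq := by simp
  eq _ _ := by simp

/-- Transport along an equality of families on the interval. -/
def congr (R : PolyRep μ u v) (h : ∀ t ∈ Icc u v, ν t = μ t) : PolyRep ν u v where
  ι := R.ι
  p := R.p
  m := R.m
  ld := R.ld
  nonneg := R.nonneg
  sum_eq := R.sum_eq
  eq t ht := (h t ht).trans (R.eq t ht)

/-- Translation of the parameter. -/
noncomputable def shift (R : PolyRep μ u v) {u' v' : ℝ} (hu : u' = u + 1) (hv : v' = v + 1) :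
    PolyRep (fun t => μ (t - 1)) u' v' where
  ι := R.ι
  p i := (R.p i).comp (Polynomial.X - 1)
  m := R.m
  ld := R.ld
  nonneg i t ht := by
    rw [Polynomial.eval_comp]
    exact R.nonneg i _ (by simp; constructor <;> linarith [ht.1, ht.2])
  sum_eq := by
    rw [← Polynomial.sum_comp, R.sum_eq, Polynomial.one_comp]
  eq t ht := by
    simpa using R.eq (t - 1) (by constructor <;> linarith [ht.1, ht.2])

lemma map_prod_mixture {ι κ : Type*} [Fintype ι] [Fintype κ] {φ : EReal × EReal → EReal}
    (hφ : Measurable φ) (p : ι → ℝ) (q : κ → ℝ) (m : ι → Measure EReal) (n : κ → Measure EReal)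
    (hp : ∀ i, 0 ≤ p i) [∀ i, SFinite (m i)] [∀ j, SFinite (n j)] :
    ((∑ i, ENNReal.ofReal (p i) • m i).prod (∑ j, ENNReal.ofReal (q j) • n j)).map φ =
      ∑ k : ι × κ, ENNReal.ofReal (p k.1 * q k.2) • ((m k.1).prod (n k.2)).map φ := by
  refine Measure.ext_of_lintegral _ fun f hf => ?_
  have : SFinite (∑ j, ENNReal.ofReal (q j) • n j) := by
    rw [← Measure.sum_fintype]; infer_instance
  have hfφ : Measurable fun z => f (φ z) := hf.comp hφ
  rw [lintegral_map hf hφ, lintegral_prod _ hfφ.aemeasurable, lintegral_finsetSum_measure,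
    lintegral_finsetSum_measure, Fintype.sum_prod_type]
  refine Finset.sum_congr rfl fun i _ => ?_
  rw [lintegral_smul_measure]
  simp only [lintegral_finsetSum_measure, lintegral_smul_measure, smul_eq_mul]
  rw [lintegral_finsetSum _ fun j _ => by
    exact (Measurable.lintegral_prod_right hfφ).const_mul _, Finset.mul_sum]
  refine Finset.sum_congr rfl fun j _ => ?_
  rw [lintegral_const_mul _ (Measurable.lintegral_prod_right hfφ), lintegral_map hf hφ,
    lintegral_prod _ hfφ.aemeasurable, ENNReal.ofReal_mul (hp i), mul_assoc]

/-- The family of images of products. -/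
noncomputable def mapProd (R : PolyRep μ u v) (S : PolyRep ν u v) {φ : EReal × EReal → EReal}
    (hφ : Measurable φ)
    (hld : ∀ a b, IsLDensity a → IsLDensity b → IsLDensity ((a.prod b).map φ)) :
    PolyRep (fun t => ((μ t).prod (ν t)).map φ) u v where
  ι := R.ι × S.ι
  p k := R.p k.1 * S.p k.2
  m k := ((R.m k.1).prod (S.m k.2)).map φ
  ld k := hld _ _ (R.ld k.1) (S.ld k.2)
  nonneg k t ht := by
    rw [Polynomial.eval_mul]
    exact mul_nonneg (R.nonneg _ t ht) (S.nonneg _ t ht)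
  sum_eq := by
    rw [Fintype.sum_prod_type]
    simp_rw [← Finset.mul_sum, S.sum_eq, mul_one]
    exact R.sum_eq
  eq t ht := by
    have := fun i => (R.ld i).prob
    have := fun i => (S.ld i).prob
    simp only [Polynomial.eval_mul]
    rw [R.eq t ht, S.eq t ht, map_prod_mixture hφ _ _ _ _ fun i => R.nonneg i t ht]

/-- The family of variable-node convolutions. -/
noncomputable def starConv (R : PolyRep μ u v) (S : PolyRep ν u v) :
    PolyRep (fun t => LDPC.starConv (μ t) (ν t)) u v :=
  R.mapProd S measurable_add_ereal fun _ _ ha hb => ha.starConv hb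

/-- The family of check-node convolutions. -/
noncomputable def checkConv (R : PolyRep μ u v) (S : PolyRep ν u v) :
    PolyRep (fun t => LDPC.checkConv (μ t) (ν t)) u v :=
  R.mapProd S measurable_checkOp fun _ _ ha hb => ha.checkConv hb

/-- The family of powers at a variable node. -/
noncomputable def starPow (R : PolyRep μ u v) : ∀ n, PolyRep (fun t => LDPC.starPow (μ t) n) u v
  | 0 => const isLDensity_deltaZero u v
  | n + 1 => (R.starPow n).starConv R

/-- The family of powers at a check node. -/
noncomputable def checkPow (R : PolyRep μ u v) : ∀ n, PolyRep (fun t => LDPC.checkPow (μ t) n) u v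
  | 0 => const isLDensity_deltaInf u v
  | n + 1 => (R.checkPow n).checkConv R

/-- The family of mixtures with constant weights. -/
noncomputable def mixture (s : Finset ℕ) (w : ℕ → ℝ) (hw : ∀ j, 0 ≤ w j) (hsum : ∑ j ∈ s, w j = 1)
    {μ : ℕ → ℝ → Measure EReal} (R : ∀ j, PolyRep (μ j) u v) :
    PolyRep (fun t => ∑ j ∈ s, ENNReal.ofReal (w j) • μ j t) u v where
  ι := Σ j : s, (R j).ι
  p k := Polynomial.C (w k.1) * (R k.1).p k.2
  m k := (R k.1).m k.2
  ld k := (R k.1).ld k.2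
  nonneg k t ht := by
    rw [Polynomial.eval_mul, Polynomial.eval_C]
    exact mul_nonneg (hw _) ((R _).nonneg _ t ht)
  sum_eq := by
    rw [Fintype.sum_sigma]
    simp_rw [← Finset.mul_sum, (R _).sum_eq, mul_one]
    rw [Finset.sum_coe_sort s fun j => Polynomial.C (w j), ← map_sum, hsum, map_one]
  eq t ht := by
    rw [Fintype.sum_sigma, ← Finset.sum_coe_sort s fun j => ENNReal.ofReal (w j) • μ j t]
    refine Finset.sum_congr rfl fun j _ => ?_
    rw [(R j).eq t ht, Finset.smul_sum]
    refine Finset.sum_congr rfl fun i _ => ?_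
    rw [Polynomial.eval_mul, Polynomial.eval_C, ENNReal.ofReal_mul (hw _), mul_smul]

/-- The family of outputs of check nodes. -/
noncomputable def checkOut (R : PolyRep μ u v) {r : Polynomial ℝ} (hr : IsDegreeDistribution r) :
    PolyRep (fun t => LDPC.checkOut r (μ t)) u v :=
  mixture _ _ hr.1 hr.sum_coeff fun j => R.checkPow j

/-- The family of outputs of variable nodes. -/
noncomputable def varOut (R : PolyRep μ u v) {l : Polynomial ℝ} (hl : IsDegreeDistribution l)
    {c : Measure EReal} (hc : IsLDensity c) : PolyRep (fun t => LDPC.varOut l c (μ t)) u v :=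
  mixture _ _ hl.1 hl.sum_coeff fun j => (const hc u v).starConv (R.starPow j)

end PolyRep

/-! ### Linear functionals of L-densities -/

/-- A functional of L-densities given by integration. -/
def IsLinear (Φ : Measure EReal → ℝ) : Prop :=
  ∃ f : EReal → ℝ, ∀ a, IsLDensity a → Integrable f a ∧ Φ a = ∫ x, f x ∂a

lemma isLinear_entropy : IsLinear entropy :=
  ⟨logTwo, fun _ ha => ⟨ha.integrable_logTwo, rfl⟩⟩

lemma isLinear_moment (k : ℕ) : IsLinear (moment k) :=
  ⟨fun x => tanhHalf x ^ (2 * k + 2), fun a ha => by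
    have := ha.prob
    exact ⟨integrable_tanhHalf_pow k a, rfl⟩⟩

lemma isLinear_testFun {f : ℝ → ℝ} (hf : IsTestFun f) :
    IsLinear fun a => ∫ x, f (tanhHalf x) ∂a :=
  ⟨fun x => f (tanhHalf x), fun a ha => by
    have := ha.prob
    exact ⟨hf.integrable a, rfl⟩⟩

lemma IsLinear.congr {Φ Ψ : Measure EReal → ℝ} (h : IsLinear Φ)
    (hΨ : ∀ a, IsLDensity a → Ψ a = Φ a) : IsLinear Ψ := by
  obtain ⟨f, hf⟩ := h
  exact ⟨f, fun a ha => ⟨(hf a ha).1, (hΨ a ha).trans (hf a ha).2⟩⟩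

lemma IsLinear.add {Φ Ψ : Measure EReal → ℝ} (h : IsLinear Φ) (h' : IsLinear Ψ) :
    IsLinear fun a => Φ a + Ψ a := by
  obtain ⟨f, hf⟩ := h
  obtain ⟨g, hg⟩ := h'
  exact ⟨fun x => f x + g x, fun a ha => ⟨(hf a ha).1.add (hg a ha).1, by
    beta_reduce
    rw [(hf a ha).2, (hg a ha).2, integral_add (hf a ha).1 (hg a ha).1]⟩⟩

lemma IsLinear.sub {Φ Ψ : Measure EReal → ℝ} (h : IsLinear Φ) (h' : IsLinear Ψ) :
    IsLinear fun a => Φ a - Ψ a := by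
  obtain ⟨f, hf⟩ := h
  obtain ⟨g, hg⟩ := h'
  exact ⟨fun x => f x - g x, fun a ha => ⟨(hf a ha).1.sub (hg a ha).1, by
    beta_reduce
    rw [(hf a ha).2, (hg a ha).2, integral_sub (hf a ha).1 (hg a ha).1]⟩⟩

lemma isLinear_const (C : ℝ) : IsLinear fun _ => C :=
  ⟨fun _ => C, fun a ha => by
    have := ha.prob
    exact ⟨integrable_const C, by simp⟩⟩

lemma isLinear_entropy_starConv {e : Measure EReal} (he : IsLDensity e) :
    IsLinear fun a => entropy (starConv e a) := by
  refine ⟨fun y => ∫ x, logTwo (x + y) ∂e, fun a ha => ?_⟩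
  have := ha.prob
  have := he.prob
  have h := he.integrable_logTwo_add ha
  refine ⟨h.integral_prod_right, ?_⟩
  unfold entropy starConv
  beta_reduce
  rw [integral_map measurable_add_ereal.aemeasurable measurable_logTwo.aestronglyMeasurable]
  exact integral_prod_symm _ h

/-- Duality expresses this functional through the entropy and the variable-node functional, both
already linear. -/
lemma isLinear_entropy_checkConv {e : Measure EReal} (he : IsLDensity e) :
    IsLinear fun a => entropy (checkConv e a) := by
  refine (((isLinear_const (entropy e)).add isLinear_entropy).sub
    (isLinear_entropy_starConv he)).congr fun a ha => ?_
  linarith [he.entropy_starConv_add_entropy_checkConv ha]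

/-- From `1 + e^{-(z + w)} ≤ e^{|z|} (1 + e^{-w})`; it dominates the shifted kernel by an integrable
one for every real `z`. -/
lemma logTwo_coe_add_le (z : ℝ) {w : EReal} (hw : w ≠ ⊥) :
    logTwo (z + w) ≤ logTwo w + |z| / Real.log 2 := by
  have hl := Real.log_pos one_lt_two
  induction w with
  | bot => exact absurd rfl hw
  | top => rw [EReal.coe_add_top]; simp; positivity
  | coe r =>
    rw [← EReal.coe_add, logTwo_coe, logTwo_coe, Real.logb, Real.logb, ← add_div]
    gcongr
    rw [← Real.log_exp |z|, ← Real.log_mul (by positivity) (by positivity)]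
    apply Real.log_le_log (by positivity)
    have h1 : 1 ≤ Real.exp |z| := Real.one_le_exp (abs_nonneg z)
    have h2 : Real.exp (-(z + r)) ≤ Real.exp (-r) * Real.exp |z| := by
      rw [← Real.exp_add]
      apply Real.exp_le_exp.2
      linarith [neg_abs_le z]
    linarith

lemma IsLDensity.integrable_logTwo_coe_add {a : Measure EReal} (ha : IsLDensity a) (z : ℝ) :
    Integrable (fun w => logTwo (z + w)) a := by
  have := ha.prob
  refine Integrable.mono' (ha.integrable_logTwo.add (integrable_const (|z| / Real.log 2)))
    (measurable_logTwo.comp (measurable_const.add measurable_id)).aestronglyMeasurable ?_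
  filter_upwards [ha.ae_ne_bot] with w hw
  rw [Real.norm_of_nonneg (logTwo_nonneg _)]
  exact logTwo_coe_add_le z hw

lemma isLinear_potential (z : ℝ) : IsLinear fun a => ∫ w, logTwo (z + w) ∂a :=
  ⟨_, fun _ ha => ⟨ha.integrable_logTwo_coe_add z, rfl⟩⟩

namespace PolyRep

variable {μ ν : ℝ → Measure EReal} {u v : ℝ}

lemma apply_eq (R : PolyRep μ u v) {Φ : Measure EReal → ℝ} (hΦ : IsLinear Φ) {t : ℝ}
    (ht : t ∈ Icc u v) : Φ (μ t) = ∑ i, (R.p i).eval t * Φ (R.m i) := by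
  obtain ⟨f, hf⟩ := hΦ
  rw [(hf _ (R.isLDensity ht)).2, R.eq t ht, integral_mixture _ _ _
    (fun i _ => R.nonneg i t ht) fun i _ => (hf _ (R.ld i)).1]
  exact Finset.sum_congr rfl fun i _ => by rw [(hf _ (R.ld i)).2]

/-- The derivative of a linear functional along the family. -/
noncomputable def d (R : PolyRep μ u v) (Φ : Measure EReal → ℝ) (t : ℝ) : ℝ :=
  ∑ i, (R.p i).derivative.eval t * Φ (R.m i)

lemma d_congr (R : PolyRep μ u v) {Φ Ψ : Measure EReal → ℝ} (h : ∀ a, IsLDensity a → Φ a = Ψ a)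
    (t : ℝ) : R.d Φ t = R.d Ψ t :=
  Finset.sum_congr rfl fun i _ => by rw [h _ (R.ld i)]

lemma d_add (R : PolyRep μ u v) (Φ Ψ : Measure EReal → ℝ) (t : ℝ) :
    R.d (fun a => Φ a + Ψ a) t = R.d Φ t + R.d Ψ t := by
  simp only [d, mul_add, Finset.sum_add_distrib]

lemma d_sub (R : PolyRep μ u v) (Φ Ψ : Measure EReal → ℝ) (t : ℝ) :
    R.d (fun a => Φ a - Ψ a) t = R.d Φ t - R.d Ψ t := by
  simp only [d, mul_sub, Finset.sum_sub_distrib]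

lemma d_const_mul (R : PolyRep μ u v) (C : ℝ) (Φ : Measure EReal → ℝ) (t : ℝ) :
    R.d (fun a => C * Φ a) t = C * R.d Φ t := by
  simp only [d, Finset.mul_sum]
  exact Finset.sum_congr rfl fun i _ => by ring

lemma d_const (R : PolyRep μ u v) (C : ℝ) (t : ℝ) : R.d (fun _ => C) t = 0 := by
  simp only [d, ← Finset.sum_mul, R.sum_derivative, zero_mul]

lemma d_finset_sum (R : PolyRep μ u v) {κ : Type*} (s : Finset κ) (Φ : κ → Measure EReal → ℝ)
    (t : ℝ) : R.d (fun a => ∑ j ∈ s, Φ j a) t = ∑ j ∈ s, R.d (Φ j) t := by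
  simp only [d, Finset.mul_sum]
  exact Finset.sum_comm

/-- The quantity `d` is computed from a chosen representation; this shows that it is the derivative
along the family, one-sided at the end points. Adjacent unit intervals may therefore have different
`d` at a common end point. -/
lemma hasDerivWithinAt (R : PolyRep μ u v) {Φ : Measure EReal → ℝ} (hΦ : IsLinear Φ) {t : ℝ}
    (ht : t ∈ Icc u v) : HasDerivWithinAt (fun t => Φ (μ t)) (R.d Φ t) (Icc u v) t := by
  have h : HasDerivWithinAt (fun t => ∑ i, (R.p i).eval t * Φ (R.m i)) (R.d Φ t) (Icc u v) t :=
    HasDerivWithinAt.fun_sum fun i _ => ((R.p i).hasDerivAt t).hasDerivWithinAt.mul_const _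
  exact h.congr (fun s hs => R.apply_eq hΦ hs) (R.apply_eq hΦ ht)

lemma continuousOn (R : PolyRep μ u v) {Φ : Measure EReal → ℝ} (hΦ : IsLinear Φ) :
    ContinuousOn (fun t => Φ (μ t)) (Icc u v) :=
  fun _ ht => (R.hasDerivWithinAt hΦ ht).continuousWithinAt

end PolyRep

/-! ### The derivative of powers -/

/-- An abstract power rule: `F n e t` stands for a functional of `e` times the `n`-th power of the
moving family. `hstep` expands one factor as a mixture and absorbs its component into `e`, so the
induction needs all `e` at once; `hcomm` makes the `n + 1` factors interchangeable. One form serves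
both convolutions. -/
lemma hasDerivWithinAt_of_step {X ι : Type*} [Fintype ι] (q : ι → Polynomial ℝ) (s : Set ℝ)
    (act : X → ι → X) (F : ℕ → X → ℝ → ℝ) (h0 : ∀ e t t', F 0 e t = F 0 e t')
    (hstep : ∀ n e, ∀ t ∈ s, F (n + 1) e t = ∑ j, (q j).eval t * F n (act e j) t)
    (hcomm : ∀ n e j k, ∀ t ∈ s, F n (act (act e j) k) t = F n (act (act e k) j) t)
    (n : ℕ) (e : X) {t : ℝ} (ht : t ∈ s) :
    HasDerivWithinAt (F (n + 1) e)
      ((n + 1) * ∑ k, (q k).derivative.eval t * F n (act e k) t) s t := by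
  induction n generalizing e with
  | zero =>
    have h : HasDerivWithinAt (fun t' => ∑ j, (q j).eval t' * F 0 (act e j) t)
        (∑ k, (q k).derivative.eval t * F 0 (act e k) t) s t :=
      HasDerivWithinAt.fun_sum fun j _ => ((q j).hasDerivAt t).hasDerivWithinAt.mul_const _
    have h2 := h.congr_of_mem (f₁ := F 1 e) (fun t' ht' => by
      rw [hstep 0 e t' ht']
      exact Finset.sum_congr rfl fun j _ => by rw [h0 _ t' t]) ht
    simpa using h2
  | succ n ih =>
    have h : HasDerivWithinAt (fun t' => ∑ j, (q j).eval t' * F (n + 1) (act e j) t')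
        (∑ j, ((q j).derivative.eval t * F (n + 1) (act e j) t + (q j).eval t *
          ((n + 1) * ∑ k, (q k).derivative.eval t * F n (act (act e j) k) t))) s t :=
      HasDerivWithinAt.fun_sum fun j _ =>
        ((q j).hasDerivAt t).hasDerivWithinAt.mul (ih (act e j))
    have h2 := h.congr_of_mem (f₁ := F (n + 1 + 1) e) (fun t' ht' => hstep _ e t' ht') ht
    have e1 : ∑ j, (q j).eval t * (((n : ℝ) + 1) *
        ∑ k, (q k).derivative.eval t * F n (act (act e j) k) t) =
        (n + 1) * ∑ k, (q k).derivative.eval t * F (n + 1) (act e k) t := by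
      simp_rw [hstep n _ t ht, Finset.mul_sum]
      rw [Finset.sum_comm]
      refine Finset.sum_congr rfl fun k _ => Finset.sum_congr rfl fun j _ => ?_
      rw [hcomm n e j k t ht]
      ring
    rw [Finset.sum_add_distrib, e1] at h2
    push_cast
    rwa [show ((n : ℝ) + 1 + 1) * ∑ k, (q k).derivative.eval t * F (n + 1) (act e k) t =
      ∑ k, (q k).derivative.eval t * F (n + 1) (act e k) t +
        (n + 1) * ∑ k, (q k).derivative.eval t * F (n + 1) (act e k) t by ring]

lemma moment_deltaInf (k : ℕ) : moment k deltaInf = 1 := by simp [moment, deltaInf]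

lemma moment_deltaZero (k : ℕ) : moment k deltaZero = 0 := by simp [moment, deltaZero]

lemma IsLDensity.moment_checkPow {a : Measure EReal} (ha : IsLDensity a) (k n : ℕ) :
    moment k (LDPC.checkPow a n) = moment k a ^ n := by
  induction n with
  | zero => simp [LDPC.checkPow, moment_deltaInf]
  | succ n ih =>
    have := ha.prob
    have := (ha.checkPow n).prob
    rw [LDPC.checkPow, moment_checkConv, ih, pow_succ]

lemma IsLDensity.entropy_congr {a b : Measure EReal} (ha : IsLDensity a) (hb : IsLDensity b)
    (h : ∀ k, moment k a = moment k b) : entropy a = entropy b := by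
  have h1 := ha.hasSum_entropy
  simp only [h] at h1
  exact h1.unique hb.hasSum_entropy

lemma PolyRep.hasDerivWithinAt_starPow {μ : ℝ → Measure EReal} {u v : ℝ} (R : PolyRep μ u v)
    {e : Measure EReal} (he : IsLDensity e) (n : ℕ) {t : ℝ} (ht : t ∈ Icc u v) :
    HasDerivWithinAt (fun t => entropy (LDPC.starConv e (LDPC.starPow (μ t) (n + 1))))
      ((n + 1) * R.d (fun a => entropy (LDPC.starConv (LDPC.starConv e a)
        (LDPC.starPow (μ t) n))) t) (Icc u v) t := by
  refine hasDerivWithinAt_of_step (X := {a : Measure EReal // IsLDensity a}) R.p (Icc u v)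
    (fun e j => ⟨LDPC.starConv e.1 (R.m j), e.2.starConv (R.ld j)⟩)
    (fun n e t => entropy (LDPC.starConv e.1 (LDPC.starPow (μ t) n))) (fun _ _ _ => rfl) ?_ ?_ n
    ⟨e, he⟩ ht
  · rintro n ⟨e, he⟩ t ht
    have hμ := R.isLDensity ht
    have hp := hμ.starPow n
    have := he.prob
    have := hμ.prob
    have := hp.prob
    simp only [LDPC.starPow]
    rw [← starConv_assoc, R.apply_eq (isLinear_entropy_starConv (he.starConv hp)) ht]
    refine Finset.sum_congr rfl fun j _ => ?_
    have := (R.ld j).prob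
    rw [starConv_assoc, starConv_comm (LDPC.starPow (μ t) n), ← starConv_assoc]
  · rintro n ⟨e, he⟩ j k t ht
    have := he.prob
    have := (R.ld j).prob
    have := (R.ld k).prob
    simp only
    rw [starConv_assoc e, starConv_comm (R.m j), ← starConv_assoc e]

/-- Reassociating check convolutions is done at the level of entropies: the two bracketings have
equal products of moments, and moments determine the entropy. -/
lemma PolyRep.hasDerivWithinAt_checkPow {μ : ℝ → Measure EReal} {u v : ℝ} (R : PolyRep μ u v)
    {e : Measure EReal} (he : IsLDensity e) (n : ℕ) {t : ℝ} (ht : t ∈ Icc u v) :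
    HasDerivWithinAt (fun t => entropy (LDPC.checkConv e (LDPC.checkPow (μ t) (n + 1))))
      ((n + 1) * R.d (fun a => entropy (LDPC.checkConv (LDPC.checkConv e a)
        (LDPC.checkPow (μ t) n))) t) (Icc u v) t := by
  refine hasDerivWithinAt_of_step (X := {a : Measure EReal // IsLDensity a}) R.p (Icc u v)
    (fun e j => ⟨LDPC.checkConv e.1 (R.m j), e.2.checkConv (R.ld j)⟩)
    (fun n e t => entropy (LDPC.checkConv e.1 (LDPC.checkPow (μ t) n))) (fun _ _ _ => rfl) ?_ ?_ n
    ⟨e, he⟩ ht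
  · rintro n ⟨e, he⟩ t ht
    have hμ := R.isLDensity ht
    have hp := hμ.checkPow n
    have := he.prob
    have := hμ.prob
    have := hp.prob
    have := (he.checkConv hp).prob
    have := (hp.checkConv hμ).prob
    simp only [LDPC.checkPow]
    rw [(he.checkConv (hp.checkConv hμ)).entropy_congr ((he.checkConv hp).checkConv hμ)
      fun k => by simp only [moment_checkConv]; ring,
      R.apply_eq (isLinear_entropy_checkConv (he.checkConv hp)) ht]
    refine Finset.sum_congr rfl fun j _ => ?_
    have hj := R.ld j
    have := hj.prob
    have := (he.checkConv hj).prob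
    rw [((he.checkConv hp).checkConv hj).entropy_congr ((he.checkConv hj).checkConv hp)
      fun k => by simp only [moment_checkConv]; ring]
  · rintro n ⟨e, he⟩ j k t ht
    have hp := (R.isLDensity ht).checkPow n
    have hj := R.ld j
    have hk := R.ld k
    have := he.prob
    have := hj.prob
    have := hk.prob
    have := hp.prob
    have := (he.checkConv hj).prob
    have := (he.checkConv hk).prob
    have := ((he.checkConv hj).checkConv hk).prob
    have := ((he.checkConv hk).checkConv hj).prob
    exact (((he.checkConv hj).checkConv hk).checkConv hp).entropy_congr
      (((he.checkConv hk).checkConv hj).checkConv hp)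
      fun i => by simp only [moment_checkConv]; ring

/-! ### Gluing along unit intervals -/

lemma monotoneOn_Ici_of_unit_intervals {f : ℝ → ℝ} {u : ℝ}
    (h : ∀ n : ℕ, MonotoneOn f (Icc (u + n) (u + (n + 1)))) : MonotoneOn f (Ici u) := by
  have key : ∀ n : ℕ, MonotoneOn f (Icc u (u + n)) := by
    intro n
    induction n with
    | zero => simp
    | succ n ih =>
      have hu : u ≤ u + n := by simp
      have := ih.union_right (h n) (isGreatest_Icc hu) (isLeast_Icc (by linarith))
      rw [Icc_union_Icc_eq_Icc hu (by linarith)] at this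
      simpa using this
  intro x hx y hy hxy
  obtain ⟨n, hn⟩ := exists_nat_ge (y - u)
  exact key n ⟨hx, by linarith⟩ ⟨hy, by linarith⟩ hxy

lemma continuousOn_Ici_of_unit_intervals {f : ℝ → ℝ} {u : ℝ}
    (h : ∀ n : ℕ, ContinuousOn f (Icc (u + n) (u + (n + 1)))) : ContinuousOn f (Ici u) := by
  have key : ∀ n : ℕ, ContinuousOn f (Icc u (u + n)) := by
    intro n
    induction n with
    | zero => simp
    | succ n ih =>
      have hu : u ≤ u + n := by simp
      have := ih.union_of_isClosed (h n) isClosed_Icc isClosed_Icc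
      rw [Icc_union_Icc_eq_Icc hu (by linarith)] at this
      simpa using this
  intro x hx
  obtain ⟨n, hn⟩ := exists_nat_gt (x - u)
  refine (key n x ⟨hx, by linarith⟩).mono_of_mem_nhdsWithin ?_
  rw [← Ici_inter_Iic]
  exact inter_mem self_mem_nhdsWithin (mem_nhdsWithin_of_mem_nhds (Iic_mem_nhds (by linarith)))

lemma exists_mem_Ioc {α : ℝ} (h : -1 < α) : ∃ k : ℕ, α ∈ Ioc ((k : ℝ) - 1) k := by
  refine ⟨⌈α⌉₊, ?_, Nat.le_ceil α⟩
  rcases le_or_gt α 0 with h0 | h0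
  · simp [Nat.ceil_eq_zero.2 h0, h]
  · linarith [Nat.ceil_lt_add_one h0.le]

lemma exists_mem_Icc {α : ℝ} (h : -1 ≤ α) : ∃ k : ℕ, α ∈ Icc ((k : ℝ) - 1) k := by
  rcases h.eq_or_lt with rfl | h
  · exact ⟨0, by norm_num⟩
  · obtain ⟨k, hk⟩ := exists_mem_Ioc h
    exact ⟨k, Ioc_subset_Icc_self hk⟩

/-! ### Extremal densities -/

lemma eq_dirac_of_ae_eq {a : Measure EReal} [IsProbabilityMeasure a] {z : EReal}
    (h : ∀ᵐ x ∂a, x = z) : a = Measure.dirac z := by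
  have : a.map id = a.map fun _ => z := Measure.map_congr h
  rwa [Measure.map_id, Measure.map_const, measure_univ, one_smul] at this

lemma eq_deltaZero_of_moment_eq_zero {a : Measure EReal} [IsProbabilityMeasure a] {k : ℕ}
    (h : moment k a = 0) : a = deltaZero := by
  refine eq_dirac_of_ae_eq ?_
  have := (integral_eq_zero_iff_of_nonneg (fun x => (tanhHalf_pow_mem k x).1)
    (integrable_tanhHalf_pow k a)).1 h
  filter_upwards [this] with x hx
  have hx0 : tanhHalf x = 0 := (pow_eq_zero_iff (by omega)).1 hx
  exact tanhHalf_injective (hx0.trans tanhHalf_zero.symm)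

/-- An even power of the bias has mean one only if the bias is `±1` almost surely, and `-1` is
excluded by the absence of mass at `⊥`. -/
lemma IsLDensity.eq_deltaInf_of_moment_eq_one {a : Measure EReal} (ha : IsLDensity a) {k : ℕ}
    (h : moment k a = 1) : a = deltaInf := by
  have := ha.prob
  refine eq_dirac_of_ae_eq ?_
  have hi : Integrable (fun x => 1 - tanhHalf x ^ (2 * k + 2)) a :=
    (integrable_const 1).sub (integrable_tanhHalf_pow k a)
  have h0 : ∫ x, (1 - tanhHalf x ^ (2 * k + 2)) ∂a = 0 := by
    rw [integral_sub (integrable_const 1) (integrable_tanhHalf_pow k a)]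
    unfold moment at h
    simp [h]
  have h1 := (integral_eq_zero_iff_of_nonneg
    (fun x => by simpa using (tanhHalf_pow_mem k x).2) hi).1 h0
  filter_upwards [h1, ha.ae_ne_bot] with x hx hb
  by_contra ht
  have h2 : |tanhHalf x| < 1 := abs_lt.2 ⟨neg_one_lt_tanhHalf hb, tanhHalf_lt_one ht⟩
  have h3 : |tanhHalf x| ^ (2 * k + 2) < 1 := pow_lt_one₀ (abs_nonneg _) h2 (by omega)
  rw [← abs_pow] at h3
  have h4 := (abs_lt.1 h3).2
  simp only [Pi.zero_apply] at hx
  linarith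

lemma IsLDensity.moment_lt_one {a : Measure EReal} (ha : IsLDensity a) (h : a ≠ deltaInf) (k : ℕ) :
    moment k a < 1 := by
  have := ha.prob
  exact lt_of_le_of_ne (moment_mem k a).2 fun h1 => h (ha.eq_deltaInf_of_moment_eq_one h1)

lemma ne_deltaInf_of_moment_lt_one {a : Measure EReal} {k : ℕ} (h : moment k a < 1) :
    a ≠ deltaInf := by
  rintro rfl
  simp [moment_deltaInf] at h

lemma IsLDensity.entropy_nonneg {a : Measure EReal} (_ha : IsLDensity a) : 0 ≤ entropy a :=
  integral_nonneg fun x => logTwo_nonneg x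

lemma entropy_deltaInf : entropy deltaInf = 0 := by simp [entropy, deltaInf]

lemma entropy_deltaZero : entropy deltaZero = 1 := by simp [entropy, deltaZero]

lemma IsLDensity.moment_eq_one_of_entropy_eq_zero {a : Measure EReal} (ha : IsLDensity a)
    (h : entropy a = 0) (k : ℕ) : moment k a = 1 := by
  have := ha.prob
  have h1 := ha.hasSum_entropy
  rw [h, hasSum_zero_iff_of_nonneg fun k => mul_nonneg (entropyWeight_pos k).le
    (by linarith [(moment_mem k a).2])] at h1
  have h2 := congrFun h1 k
  rcases mul_eq_zero.1 h2 with h3 | h3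
  · exact absurd h3 (entropyWeight_pos k).ne'
  · linarith

lemma IsLDensity.entropy_pos {a : Measure EReal} (ha : IsLDensity a) (h : a ≠ deltaInf) :
    0 < entropy a :=
  lt_of_le_of_ne ha.entropy_nonneg fun h0 =>
    (ha.moment_lt_one h 0).ne (ha.moment_eq_one_of_entropy_eq_zero h0.symm 0)

lemma IsLDensity.entropy_le_entropy {a b : Measure EReal} (ha : IsLDensity a) (hb : IsLDensity b)
    (h : ∀ k, moment k a ≤ moment k b) : entropy b ≤ entropy a :=
  hasSum_le (fun k => mul_le_mul_of_nonneg_left (by linarith [h k]) (entropyWeight_pos k).le)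
    hb.hasSum_entropy ha.hasSum_entropy

/-- The difference of the entropies is a series of nonnegative terms with positive weights; if it
vanishes, every term does. -/
lemma IsLDensity.moment_eq_of_entropy_eq {a b : Measure EReal} (ha : IsLDensity a)
    (hb : IsLDensity b) (h : ∀ k, moment k a ≤ moment k b) (he : entropy a = entropy b) (k : ℕ) :
    moment k a = moment k b := by
  have h1 := ha.hasSum_entropy.sub hb.hasSum_entropy
  rw [he, sub_self, hasSum_zero_iff_of_nonneg fun k => by
    have := mul_le_mul_of_nonneg_left (h k) (entropyWeight_pos k).le
    linarith] at h1
  have h2 := congrFun h1 k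
  simp only [Pi.zero_apply] at h2
  have h3 := (entropyWeight_pos k).ne'
  have : entropyWeight k * (moment k b - moment k a) = 0 := by linarith
  rcases mul_eq_zero.1 this with h | h
  · exact absurd h h3
  · linarith

/-- By independence both summands are different from `⊤` with positive probability, and then so is
the sum. -/
lemma IsLDensity.starConv_ne_deltaInf {a b : Measure EReal} (ha : IsLDensity a) (hb : IsLDensity b)
    (h : a ≠ deltaInf) (h' : b ≠ deltaInf) : LDPC.starConv a b ≠ deltaInf := by
  have := ha.prob
  have := hb.prob
  intro heq
  have h1 : LDPC.starConv a b {⊤}ᶜ = 0 := by rw [heq]; simp [deltaInf]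
  rw [LDPC.starConv, Measure.map_apply measurable_add_ereal (measurableSet_singleton _).compl] at h1
  have h2 : (a.prod b) ({⊤}ᶜ ×ˢ {⊤}ᶜ) = 0 := measure_mono_null (fun p hp => by
    simp only [mem_prod, mem_compl_iff, mem_singleton_iff] at hp
    simp only [mem_preimage, mem_compl_iff, mem_singleton_iff]
    exact (EReal.add_lt_top hp.1 hp.2).ne) h1
  rw [Measure.prod_prod] at h2
  rcases mul_eq_zero.1 h2 with h3 | h3
  · exact h (eq_dirac_of_ae_eq (by rw [ae_iff]; exact h3))
  · exact h' (eq_dirac_of_ae_eq (by rw [ae_iff]; exact h3))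

lemma IsLDensity.starPow_ne_deltaInf {a : Measure EReal} (ha : IsLDensity a) (h : a ≠ deltaInf)
    (n : ℕ) : LDPC.starPow a n ≠ deltaInf := by
  induction n with
  | zero =>
    intro h0
    have := entropy_deltaZero
    rw [show deltaZero = deltaInf from h0, entropy_deltaInf] at this
    exact zero_ne_one this
  | succ n ih => exact (ha.starPow n).starConv_ne_deltaInf ha ih h

lemma checkConv_deltaZero (a : Measure EReal) [IsProbabilityMeasure a] :
    checkConv a deltaZero = deltaZero := by
  have := isLDensity_deltaZero.prob
  have : IsProbabilityMeasure (checkConv a deltaZero) :=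
    Measure.isProbabilityMeasure_map measurable_checkOp.aemeasurable
  refine eq_deltaZero_of_moment_eq_zero (k := 0) ?_
  rw [moment_checkConv, moment_deltaZero, mul_zero]

lemma starPow_deltaZero (n : ℕ) : starPow deltaZero n = deltaZero := by
  induction n with
  | zero => rfl
  | succ n ih =>
    have := isLDensity_deltaZero.prob
    rw [starPow, ih, starConv_deltaZero]

/-! ### The node maps at the useless density and under linear functionals -/

lemma sum_smul_eq_self {p : Polynomial ℝ} (hp : IsDegreeDistribution p) (a : Measure EReal) :
    ∑ j ∈ p.support, ENNReal.ofReal (p.coeff j) • a = a := by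
  rw [← Finset.sum_smul, ← ENNReal.ofReal_sum_of_nonneg fun j _ => hp.1 j, hp.sum_coeff,
    ENNReal.ofReal_one, one_smul]

lemma checkOut_deltaZero {r : Polynomial ℝ} (hr : IsDegreeDistribution r) (h0 : r.coeff 0 = 0) :
    checkOut r deltaZero = deltaZero := by
  rw [checkOut, ← sum_smul_eq_self hr deltaZero]
  refine Finset.sum_congr rfl fun j hj => ?_
  rw [sum_smul_eq_self hr]
  rcases j with _ | j
  -- The zeroth check power is `deltaInf`, so a constant term of `r` would spoil the fixed point;
  -- `h0` rules it out.
  · simp [h0] at hj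
  · have := (isLDensity_deltaZero.checkPow j).prob
    rw [checkPow, checkConv_deltaZero]

lemma varOut_deltaZero {l : Polynomial ℝ} (hl : IsDegreeDistribution l) {c : Measure EReal}
    [SFinite c] : varOut l c deltaZero = c := by
  simp only [varOut, starPow_deltaZero, starConv_deltaZero]
  exact sum_smul_eq_self hl c

lemma IsLDensity.moment_checkOut {a : Measure EReal} (ha : IsLDensity a) {r : Polynomial ℝ}
    (hr : IsDegreeDistribution r) (k : ℕ) : moment k (LDPC.checkOut r a) = r.eval (moment k a) := by
  rw [moment, LDPC.checkOut, integral_mixture _ _ _ (fun j _ => hr.1 j) fun j _ => by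
    have := (ha.checkPow j).prob
    exact integrable_tanhHalf_pow k _, Polynomial.eval_eq_sum, Polynomial.sum]
  refine Finset.sum_congr rfl fun j _ => ?_
  rw [← ha.moment_checkPow]
  rfl

lemma IsLinear.apply_varOut {Φ : Measure EReal → ℝ} (hΦ : IsLinear Φ) {l : Polynomial ℝ}
    (hl : IsDegreeDistribution l) {c b : Measure EReal} (hc : IsLDensity c) (hb : IsLDensity b) :
    Φ (varOut l c b) = ∑ j ∈ l.support, l.coeff j * Φ (starConv c (starPow b j)) := by
  obtain ⟨f, hf⟩ := hΦ
  have hj := fun j => hc.starConv (hb.starPow j)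
  rw [(hf _ (hc.varOut hl hb)).2, varOut, integral_mixture _ _ _ (fun j _ => hl.1 j)
    fun j _ => (hf _ (hj j)).1]
  exact Finset.sum_congr rfl fun j _ => by rw [(hf _ (hj j)).2]

lemma IsLinear.apply_checkOut {Φ : Measure EReal → ℝ} (hΦ : IsLinear Φ) {r : Polynomial ℝ}
    (hr : IsDegreeDistribution r) {a : Measure EReal} (ha : IsLDensity a) :
    Φ (checkOut r a) = ∑ j ∈ r.support, r.coeff j * Φ (checkPow a j) := by
  obtain ⟨f, hf⟩ := hΦ
  have hj := fun j => ha.checkPow j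
  rw [(hf _ (ha.checkOut hr)).2, checkOut, integral_mixture _ _ _ (fun j _ => hr.1 j)
    fun j _ => (hf _ (hj j)).1]
  exact Finset.sum_congr rfl fun j _ => by rw [(hf _ (hj j)).2]

lemma IsLinear.apply_interp {Φ : Measure EReal → ℝ} (hΦ : IsLinear Φ) {c : Measure EReal}
    (hc : IsLDensity c) {α : ℝ} (hα : α ∈ Icc (-1 : ℝ) 0) :
    Φ (interp c α) = -α * Φ deltaZero + (1 + α) * Φ c := by
  obtain ⟨f, hf⟩ := hΦ
  have h0 := hf _ isLDensity_deltaZero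
  have h1 := hf _ hc
  rw [(hf _ (hc.interp hα)).2, h0.2, h1.2, interp, integral_add_measure
    (h0.1.smul_measure ENNReal.ofReal_ne_top) (h1.1.smul_measure ENNReal.ofReal_ne_top),
    integral_smul_measure, integral_smul_measure, ENNReal.toReal_ofReal (by linarith [hα.2]),
    ENNReal.toReal_ofReal (by linarith [hα.1]), smul_eq_mul, smul_eq_mul]

/-! ### The interpolated families -/

variable {l r : Polynomial ℝ} {c : Measure EReal}

lemma bFam_add_one (l r : Polynomial ℝ) (c : Measure EReal) (α : ℝ) :
    bFam l r c (α + 1) = checkOut r (aFam l r c α) := by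
  rw [bFam, add_sub_cancel_right]

lemma interp_zero (c : Measure EReal) : interp c 0 = c := by simp [interp]

lemma interp_neg_one (c : Measure EReal) : interp c (-1) = deltaZero := by simp [interp]

lemma aFam_zero (l r : Polynomial ℝ) (c : Measure EReal) : aFam l r c 0 = c := by
  rw [aFam_of_nonpos l r c le_rfl, interp_zero]

lemma aFam_neg_one (l r : Polynomial ℝ) (c : Measure EReal) : aFam l r c (-1) = deltaZero := by
  rw [aFam_of_nonpos l r c (by norm_num), interp_neg_one]

lemma densityEvolution_eq_iterate (l r : Polynomial ℝ) (c : Measure EReal) (n : ℕ) :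
    densityEvolution l r c n = (deStep l r c)^[n] c := by
  induction n with
  | zero => rfl
  | succ n ih => rw [densityEvolution, ih, Function.iterate_succ_apply']

lemma aFam_natCast (l r : Polynomial ℝ) (c : Measure EReal) (n : ℕ) :
    aFam l r c n = densityEvolution l r c n := by
  rw [aFam, Nat.ceil_natCast, sub_self, interp_zero, densityEvolution_eq_iterate]

namespace Decodable

lemma bFam_zero (h : Decodable l r c) : bFam l r c 0 = deltaZero := by
  rw [bFam, zero_sub, aFam_neg_one, checkOut_deltaZero h.right h.no_degree_one_check]

/-- The recursion also holds at the junction `α = 0`: there `b_0` is useless and the variable node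
returns the channel. -/
lemma aFam_eq_varOut (h : Decodable l r c) {α : ℝ} (hα : 0 ≤ α) :
    aFam l r c α = varOut l c (bFam l r c α) := by
  have := h.channel.prob
  rcases hα.eq_or_lt with rfl | hα
  · rw [aFam_zero, h.bFam_zero, varOut_deltaZero h.left]
  · exact aFam_of_pos l r c hα

/-- On `[-1, 0]` the family is a mixture with affine weights. -/
noncomputable def repZero (h : Decodable l r c) : PolyRep (aFam l r c) (-1) 0 where
  ι := Bool
  p i := bif i then -Polynomial.X else 1 + Polynomial.X
  m i := bif i then deltaZero else c
  ld := by rintro (_ | _) <;> simp [h.channel, isLDensity_deltaZero]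
  nonneg := by rintro (_ | _) t ht <;> simp <;> linarith [ht.1, ht.2]
  sum_eq := by simp
  eq t ht := by rw [aFam_of_nonpos l r c ht.2]; simp [interp]

/-- The family of variable-node outputs on `[k - 1, k]` as a polynomial mixture. -/
noncomputable def aRep (h : Decodable l r c) : ∀ k : ℕ, PolyRep (aFam l r c) ((k : ℝ) - 1) k
  | 0 => by
    rw [show ((0 : ℕ) : ℝ) - 1 = -1 by norm_num, Nat.cast_zero]
    exact h.repZero
  | k + 1 =>
    ((((h.aRep k).shift (u' := ((k + 1 : ℕ) : ℝ) - 1) (v' := ((k + 1 : ℕ) : ℝ)) (by simp)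
      (by simp)).checkOut h.right).varOut h.left h.channel).congr fun t ht =>
        h.aFam_eq_varOut (by
          have := ht.1
          push_cast at this
          linarith [k.cast_nonneg (α := ℝ)])

/-- The family of check-node outputs on `[k, k + 1]` as a polynomial mixture. -/
noncomputable def bRep (h : Decodable l r c) (k : ℕ) : PolyRep (bFam l r c) k (k + 1) :=
  ((h.aRep k).shift (u' := (k : ℝ)) (v' := (k : ℝ) + 1) (by simp) rfl).checkOut h.right

lemma isLDensity_aFam (h : Decodable l r c) {α : ℝ} (hα : -1 ≤ α) : IsLDensity (aFam l r c α) := by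
  obtain ⟨k, hk⟩ := exists_mem_Icc hα
  exact (h.aRep k).isLDensity hk

lemma isLDensity_bFam (h : Decodable l r c) {α : ℝ} (hα : 0 ≤ α) : IsLDensity (bFam l r c α) :=
  (h.isLDensity_aFam (by linarith)).checkOut h.right

lemma unit_interval_eq (n : ℕ) :
    Icc (-1 + (n : ℝ)) (-1 + (n + 1)) = Icc ((n : ℝ) - 1) n := by
  congr 1 <;> ring

/-- On the first interval the family moves affinely from the least element `deltaZero` to `c`;
afterwards the order is carried from one unit interval to the next by monotonicity of the two node
maps. -/
lemma degraded_of_mem_Icc (h : Decodable l r c) (k : ℕ) {α β : ℝ} (hα : α ∈ Icc ((k : ℝ) - 1) k)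
    (hβ : β ∈ Icc ((k : ℝ) - 1) k) (hαβ : α ≤ β) :
    Degraded (aFam l r c α) (aFam l r c β) := by
  induction k generalizing α β with
  | zero =>
    rw [Nat.cast_zero, zero_sub] at hα hβ
    intro f hf
    have hl := isLinear_testFun hf
    have := h.channel.prob
    have h0 := deltaZero_degraded c f hf
    rw [aFam_of_nonpos l r c hα.2, aFam_of_nonpos l r c hβ.2, hl.apply_interp h.channel hα,
      hl.apply_interp h.channel hβ]
    nlinarith
  | succ k ih =>
    push_cast at hα hβ
    have hk := k.cast_nonneg (α := ℝ)
    have hα0 : 0 ≤ α := by linarith [hα.1]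
    have hβ0 : 0 ≤ β := by linarith [hβ.1]
    rw [h.aFam_eq_varOut hα0, h.aFam_eq_varOut hβ0]
    refine Degraded.varOut h.left ?_ h.channel (h.isLDensity_bFam hα0) (h.isLDensity_bFam hβ0)
    exact (ih ⟨by linarith [hα.1], by linarith [hα.2]⟩ ⟨by linarith [hβ.1], by linarith [hβ.2]⟩
      (by linarith)).checkOut h.right (h.isLDensity_aFam (by linarith))
      (h.isLDensity_aFam (by linarith))

lemma degraded_aFam (h : Decodable l r c) {α β : ℝ} (hα : -1 ≤ α) (hαβ : α ≤ β) :
    Degraded (aFam l r c α) (aFam l r c β) := by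
  intro f hf
  refine monotoneOn_Ici_of_unit_intervals (f := fun α => ∫ x, f (tanhHalf x) ∂(aFam l r c α))
    (fun n s hs t ht hst => ?_) hα (hα.trans hαβ : (-1 : ℝ) ≤ β) hαβ
  rw [unit_interval_eq] at hs ht
  exact h.degraded_of_mem_Icc n hs ht hst f hf

lemma moment_aFam_mono (h : Decodable l r c) (k : ℕ) {α β : ℝ} (hα : -1 ≤ α) (hαβ : α ≤ β) :
    moment k (aFam l r c α) ≤ moment k (aFam l r c β) :=
  (h.degraded_aFam hα hαβ).moment_le k

lemma degraded_bFam (h : Decodable l r c) {α β : ℝ} (hα : 0 ≤ α) (hαβ : α ≤ β) :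
    Degraded (bFam l r c α) (bFam l r c β) :=
  (h.degraded_aFam (by linarith) (by linarith)).checkOut h.right (h.isLDensity_aFam (by linarith))
    (h.isLDensity_aFam (by linarith))

lemma moment_bFam_mono (h : Decodable l r c) (k : ℕ) {α β : ℝ} (hα : 0 ≤ α) (hαβ : α ≤ β) :
    moment k (bFam l r c α) ≤ moment k (bFam l r c β) :=
  (h.degraded_bFam hα hαβ).moment_le k

lemma antitoneOn_entropy_aFam (h : Decodable l r c) :
    AntitoneOn (fun α => entropy (aFam l r c α)) (Ici (-1)) := fun _ hα _ hβ hαβ =>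
  (h.isLDensity_aFam hα).entropy_le_entropy (h.isLDensity_aFam hβ)
    fun k => h.moment_aFam_mono k hα hαβ

lemma antitoneOn_entropy_bFam (h : Decodable l r c) :
    AntitoneOn (fun α => entropy (bFam l r c α)) (Ici 0) := fun _ hα _ hβ hαβ =>
  (h.isLDensity_bFam hα).entropy_le_entropy (h.isLDensity_bFam hβ)
    fun k => h.moment_bFam_mono k hα hαβ

lemma continuousOn_aFam (h : Decodable l r c) {Φ : Measure EReal → ℝ} (hΦ : IsLinear Φ) :
    ContinuousOn (fun α => Φ (aFam l r c α)) (Ici (-1)) :=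
  continuousOn_Ici_of_unit_intervals fun n => by
    rw [unit_interval_eq]
    exact (h.aRep n).continuousOn hΦ

lemma continuousOn_bFam (h : Decodable l r c) {Φ : Measure EReal → ℝ} (hΦ : IsLinear Φ) :
    ContinuousOn (fun α => Φ (bFam l r c α)) (Ici 0) :=
  continuousOn_Ici_of_unit_intervals fun n => by
    simp only [zero_add]
    exact (h.bRep n).continuousOn hΦ

/-- `logTwo` is unbounded, so weak convergence is applied to `biasEntropy ∘ tanhHalf`, which is
continuous on the compact space `EReal` and has the same integral against L-densities. -/
lemma tendsto_entropy_aFam (h : Decodable l r c) :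
    Tendsto (fun n : ℕ => entropy (aFam l r c n)) atTop (𝓝 0) := by
  let f : BoundedContinuousFunction EReal ℝ := BoundedContinuousFunction.mkOfCompact
    ⟨fun x => biasEntropy (tanhHalf x), continuous_biasEntropy.comp continuous_tanhHalf⟩
  have h1 := h.converges f
  have h2 : f ⊤ = 0 := by simp [f, biasEntropy_one]
  rw [h2] at h1
  refine h1.congr fun n => ?_
  rw [← aFam_natCast, (h.isLDensity_aFam (by linarith [n.cast_nonneg (α := ℝ)])).entropy_eq]
  rfl

/-- The useless density is a fixed point of density evolution, so its entropy would remain `1`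
instead of tending to `0`. -/
lemma channel_ne_deltaZero (h : Decodable l r c) : c ≠ deltaZero := by
  rintro rfl
  have hn : ∀ n, densityEvolution l r deltaZero n = deltaZero := by
    intro n
    have := h.channel.prob
    induction n with
    | zero => rfl
    | succ n ih =>
      rw [densityEvolution, ih, deStep, checkOut_deltaZero h.right h.no_degree_one_check,
        varOut_deltaZero h.left]
  have h1 := h.tendsto_entropy_aFam
  simp only [aFam_natCast, hn, entropy_deltaZero] at h1
  exact one_ne_zero (tendsto_nhds_unique tendsto_const_nhds h1)

lemma moment_channel_pos (h : Decodable l r c) (k : ℕ) : 0 < moment k c := by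
  have := h.channel.prob
  exact lt_of_le_of_ne (moment_mem k c).1
    fun h0 => h.channel_ne_deltaZero (eq_deltaZero_of_moment_eq_zero h0.symm)

lemma entropy_channel_lt_one (h : Decodable l r c) : entropy c < 1 := by
  have := h.channel.prob
  have h1 := h.channel.hasSum_entropy
  refine hasSum_lt (fun k => ?_) (i := 0) ?_ h1 hasSum_entropyWeight
  · nlinarith [entropyWeight_pos k, h.moment_channel_pos k]
  · nlinarith [entropyWeight_pos 0, h.moment_channel_pos 0]

lemma moment_aFam_pos (h : Decodable l r c) (k : ℕ) {α : ℝ} (hα : -1 < α) :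
    0 < moment k (aFam l r c α) := by
  have h1 : 0 < moment k (aFam l r c (min α 0)) := by
    rw [aFam_of_nonpos l r c (min_le_right _ _), (isLinear_moment k).apply_interp h.channel
      ⟨le_min hα.le (by norm_num), min_le_right _ _⟩, moment_deltaZero, mul_zero, zero_add]
    exact mul_pos (by linarith [lt_min hα (by norm_num : (-1 : ℝ) < 0)]) (h.moment_channel_pos k)
  exact h1.trans_le (h.moment_aFam_mono k (le_min hα.le (by norm_num)) (min_le_left _ _))

/-- Without a constant term, `ρ(x) ≤ x` on `[0, 1]`. -/
lemma moment_bFam_le (h : Decodable l r c) (k : ℕ) {α : ℝ} (hα : 0 ≤ α) :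
    moment k (bFam l r c α) ≤ moment k (aFam l r c (α - 1)) := by
  have ha := h.isLDensity_aFam (α := α - 1) (by linarith)
  have := ha.prob
  rw [bFam, ha.moment_checkOut h.right, Polynomial.eval_eq_sum, Polynomial.sum]
  calc ∑ j ∈ r.support, r.coeff j * moment k (aFam l r c (α - 1)) ^ j
      ≤ ∑ j ∈ r.support, r.coeff j * moment k (aFam l r c (α - 1)) := by
        refine Finset.sum_le_sum fun j hj => mul_le_mul_of_nonneg_left ?_ (h.right.1 j)
        refine pow_le_of_le_one (moment_mem _ _).1 (moment_mem _ _).2 ?_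
        rintro rfl
        simp [h.no_degree_one_check] at hj
    _ = moment k (aFam l r c (α - 1)) := by
        rw [← Finset.sum_mul, h.right.sum_coeff, one_mul]

/-- Perfect knowledge is not reached at a finite parameter: check nodes do not raise the moments,
and variable nodes combining imperfect observations stay imperfect. -/
lemma moment_aFam_lt_one (h : Decodable l r c) (hc : c ≠ deltaInf) (k : ℕ) {α : ℝ} (hα : -1 ≤ α) :
    moment k (aFam l r c α) < 1 := by
  obtain ⟨n, hn⟩ := exists_mem_Icc hα
  induction n generalizing α with
  | zero =>
    rw [Nat.cast_zero, zero_sub] at hn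
    rw [aFam_of_nonpos l r c hn.2, (isLinear_moment k).apply_interp h.channel hn,
      moment_deltaZero, mul_zero, zero_add]
    nlinarith [h.moment_channel_pos k, h.channel.moment_lt_one hc k, hn.2]
  | succ n ih =>
    push_cast at hn
    have h0 : 0 ≤ α := by linarith [hn.1, n.cast_nonneg (α := ℝ)]
    have hb := h.isLDensity_bFam h0
    have hbne : bFam l r c α ≠ deltaInf := by
      refine ne_deltaInf_of_moment_lt_one (k := k) ?_
      exact (h.moment_bFam_le k h0).trans_lt
        (ih (α := α - 1) (by linarith) ⟨by linarith [hn.1], by linarith [hn.2]⟩)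
    rw [h.aFam_eq_varOut h0, (isLinear_moment k).apply_varOut h.left h.channel hb,
      ← h.left.sum_coeff]
    refine Finset.sum_lt_sum_of_nonempty ?_ fun j hj => ?_
    · by_contra hne
      have := h.left.sum_coeff
      simp [Finset.not_nonempty_iff_eq_empty.1 hne] at this
    · have hpos : 0 < l.coeff j :=
        lt_of_le_of_ne (h.left.1 j) (Polynomial.mem_support_iff.1 hj).symm
      have := (h.channel.starConv (hb.starPow j)).moment_lt_one
        (h.channel.starConv_ne_deltaInf (hb.starPow j) hc (hb.starPow_ne_deltaInf hbne j)) k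
      nlinarith

end Decodable

/-! ### Derivatives along a polynomial mixture -/

namespace PolyRep

variable {μ ν : ℝ → Measure EReal} {u v : ℝ}

lemma hasSum_d_entropy (R : PolyRep μ u v) (t : ℝ) :
    HasSum (fun k => entropyWeight k * R.d (moment k) t) (-R.d entropy t) := by
  have h1 : HasSum (fun k => ∑ i, (R.p i).derivative.eval t *
      (entropyWeight k * (1 - moment k (R.m i)))) (R.d entropy t) :=
    hasSum_sum fun i _ => (R.ld i).hasSum_entropy.mul_left _
  refine h1.neg.congr_fun fun k => ?_
  have e : ∑ i, (R.p i).derivative.eval t * (entropyWeight k * (1 - moment k (R.m i))) =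
      R.d (fun a => entropyWeight k * (1 - moment k a)) t := rfl
  rw [e, d_const_mul, d_sub, d_const]
  ring

lemma hasSum_d_checkConv (R : PolyRep μ u v) {b : Measure EReal} (hb : IsLDensity b) (t : ℝ) :
    HasSum (fun k => entropyWeight k * R.d (moment k) t * moment k b)
      (-R.d (fun a => entropy (LDPC.checkConv a b)) t) := by
  have h1 : HasSum (fun k => ∑ i, (R.p i).derivative.eval t *
      (entropyWeight k * (1 - moment k (LDPC.checkConv (R.m i) b))))
      (R.d (fun a => entropy (LDPC.checkConv a b)) t) :=
    hasSum_sum fun i _ => ((R.ld i).checkConv hb).hasSum_entropy.mul_left _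
  refine h1.neg.congr_fun fun k => ?_
  have e : ∑ i, (R.p i).derivative.eval t *
      (entropyWeight k * (1 - moment k (LDPC.checkConv (R.m i) b))) =
      R.d (fun a => entropyWeight k * (1 - moment k b * moment k a)) t := by
    refine Finset.sum_congr rfl fun i _ => ?_
    have := (R.ld i).prob
    have := hb.prob
    rw [moment_checkConv, mul_comm (moment k (R.m i))]
  rw [e, d_const_mul, d_sub, d_const, d_const_mul]
  ring

lemma d_starConv (R : PolyRep μ u v) {b : Measure EReal} (hb : IsLDensity b) (t : ℝ) :
    R.d (fun a => entropy (LDPC.starConv a b)) t =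
      R.d entropy t - R.d (fun a => entropy (LDPC.checkConv a b)) t := by
  rw [R.d_congr (Ψ := fun a => entropy a + entropy b - entropy (LDPC.checkConv a b))
    (fun a ha => by linarith [ha.entropy_starConv_add_entropy_checkConv hb]), d_sub, d_add, d_const,
    add_zero]

/-- The central formula. Duality writes the variable-node derivative as the entropy derivative minus
the check-node derivative, and in the latter the moments of `b` enter as factors. For nondecreasing
moments of the family every term is nonnegative and decreasing in the moments of `b`. -/
lemma hasSum_d_starConv (R : PolyRep μ u v) {b : Measure EReal} (hb : IsLDensity b) (t : ℝ) :
    HasSum (fun k => entropyWeight k * R.d (moment k) t * (1 - moment k b))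
      (-R.d (fun a => entropy (LDPC.starConv a b)) t) := by
  rw [R.d_starConv hb, neg_sub, sub_eq_neg_add]
  have := (R.hasSum_d_entropy t).sub (R.hasSum_d_checkConv hb t)
  rw [sub_neg_eq_add] at this
  exact this.congr_fun fun k => by ring

lemma d_eq_derivWithin (R : PolyRep μ u v) (huv : u < v) {Φ : Measure EReal → ℝ}
    (hΦ : IsLinear Φ) {t : ℝ} (ht : t ∈ Icc u v) :
    derivWithin (fun t => Φ (μ t)) (Icc u v) t = R.d Φ t :=
  (R.hasDerivWithinAt hΦ ht).derivWithin (uniqueDiffOn_Icc huv t ht)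

lemma d_nonneg (R : PolyRep μ u v) (huv : u < v) {Φ : Measure EReal → ℝ} (hΦ : IsLinear Φ)
    (hmono : MonotoneOn (fun t => Φ (μ t)) (Icc u v)) {t : ℝ} (ht : t ∈ Icc u v) :
    0 ≤ R.d Φ t := by
  rw [← R.d_eq_derivWithin huv hΦ ht]
  exact hmono.derivWithin_nonneg

lemma continuous_d (R : PolyRep μ u v) (Φ : Measure EReal → ℝ) : Continuous (R.d Φ) := by
  unfold d
  exact continuous_finsetSum _ fun i _ => ((R.p i).derivative.continuous).mul continuous_const

end PolyRep

/-! ### Strict monotonicity of the entropy -/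

namespace PolyRep

variable {μ ν : ℝ → Measure EReal} {u v : ℝ}

lemma hasDerivWithinAt_entropy_starPow (R : PolyRep μ u v) {e : Measure EReal} (he : IsLDensity e)
    (n : ℕ) {t : ℝ} (ht : t ∈ Icc u v) :
    HasDerivWithinAt (fun t => entropy (LDPC.starConv e (LDPC.starPow (μ t) n)))
      (n * R.d (fun a => entropy (LDPC.starConv a
        (LDPC.starConv e (LDPC.starPow (μ t) (n - 1))))) t) (Icc u v) t := by
  rcases n with _ | n
  · simpa [LDPC.starPow] using hasDerivWithinAt_const t (Icc u v) _
  · have h := R.hasDerivWithinAt_starPow he n ht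
    rw [R.d_congr fun a ha => by
      have := ha.prob
      have := he.prob
      have := ((R.isLDensity ht).starPow n).prob
      rw [starConv_comm e a, starConv_assoc]] at h
    simpa using h

lemma hasDerivWithinAt_entropy_checkPow (R : PolyRep μ u v) (n : ℕ) {t : ℝ} (ht : t ∈ Icc u v) :
    HasDerivWithinAt (fun t => entropy (LDPC.checkPow (μ t) n))
      (n * R.d (fun a => entropy (LDPC.checkConv a (LDPC.checkPow (μ t) (n - 1)))) t)
      (Icc u v) t := by
  have hinf := isLDensity_deltaInf.prob
  have hone : ∀ a, IsLDensity a → entropy (LDPC.checkConv deltaInf a) = entropy a := fun a ha => by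
    have := ha.prob
    exact (isLDensity_deltaInf.checkConv ha).entropy_congr ha fun k => by
      rw [moment_checkConv, moment_deltaInf, one_mul]
  rcases n with _ | n
  · simpa [LDPC.checkPow] using hasDerivWithinAt_const t (Icc u v) _
  · have h := R.hasDerivWithinAt_checkPow isLDensity_deltaInf n ht
    have hp := (R.isLDensity ht).checkPow n
    rw [R.d_congr fun a ha => by
      have := ha.prob
      have := hp.prob
      have := (isLDensity_deltaInf.checkConv ha).prob
      exact ((isLDensity_deltaInf.checkConv ha).checkConv hp).entropy_congr (ha.checkConv hp)
        fun k => by rw [moment_checkConv, moment_checkConv, moment_checkConv, moment_deltaInf,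
          one_mul]] at h
    have h2 := h.congr_of_mem (f₁ := fun t => entropy (LDPC.checkPow (μ t) (n + 1)))
      (fun s hs => (hone _ ((R.isLDensity hs).checkPow (n + 1))).symm) ht
    simpa using h2

end PolyRep

lemma IsDegreeDistribution.derivative_eval_pos {p : Polynomial ℝ} (hp : IsDegreeDistribution p)
    (h0 : p.coeff 0 = 0) {x : ℝ} (hx : 0 < x) : 0 < p.derivative.eval x := by
  rw [Polynomial.derivative_eval, Polynomial.sum]
  refine Finset.sum_pos (fun j hj => ?_) ?_
  · have hpos : 0 < p.coeff j :=
      lt_of_le_of_ne (hp.1 j) (Polynomial.mem_support_iff.1 hj).symm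
    have hj0 : j ≠ 0 := by
      rintro rfl
      exact hpos.ne' h0
    have : 0 < j := Nat.pos_of_ne_zero hj0
    positivity
  · by_contra hne
    have := hp.sum_coeff
    simp [Finset.not_nonempty_iff_eq_empty.1 hne] at this

lemma sub_one_lt_self_cast (k : ℕ) : (k : ℝ) - 1 < k := by linarith

namespace Decodable

variable {l r : Polynomial ℝ} {c : Measure EReal}

lemma neg_one_le_cast_sub_one (k : ℕ) : (-1 : ℝ) ≤ (k : ℝ) - 1 := by
  linarith [k.cast_nonneg (α := ℝ)]

lemma d_moment_nonneg (h : Decodable l r c) (k j : ℕ) {α : ℝ} (hα : α ∈ Icc ((k : ℝ) - 1) k) :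
    0 ≤ (h.aRep k).d (moment j) α :=
  (h.aRep k).d_nonneg (sub_one_lt_self_cast k) (isLinear_moment j) (fun _ hs _ _ hst =>
    h.moment_aFam_mono j ((neg_one_le_cast_sub_one k).trans hs.1) hst) hα

/-- The chain rule for `m_j(b_α) = ρ(m_j(a_{α-1}))`. -/
lemma bRep_d_moment (h : Decodable l r c) (k j : ℕ) {α : ℝ} (hα : α ∈ Icc (k : ℝ) (k + 1)) :
    (h.bRep k).d (moment j) α =
      r.derivative.eval (moment j (aFam l r c (α - 1))) * (h.aRep k).d (moment j) (α - 1) := by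
  have hlt : (k : ℝ) < k + 1 := by linarith
  have h1 := (h.aRep k).hasDerivWithinAt (isLinear_moment j) (t := α - 1)
    ⟨by linarith [hα.1], by linarith [hα.2]⟩
  have h2 : HasDerivWithinAt (fun t : ℝ => t - 1) 1 (Icc (k : ℝ) (k + 1)) α :=
    (hasDerivWithinAt_id α _).sub_const 1
  have h3 := h1.comp α h2 fun t (ht : t ∈ Icc (k : ℝ) (k + 1)) => ⟨by linarith [ht.1], by linarith [ht.2]⟩
  have h4 := (r.hasDerivAt _).comp_hasDerivWithinAt α h3
  have h5 := h4.congr_of_mem (f₁ := fun t => moment j (bFam l r c t)) (fun t ht =>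
    (h.isLDensity_aFam (by linarith [ht.1, k.cast_nonneg (α := ℝ)])).moment_checkOut h.right j) hα
  have h6 := h5.derivWithin (uniqueDiffOn_Icc hlt α hα)
  rw [(h.bRep k).d_eq_derivWithin hlt (isLinear_moment j) hα] at h6
  rw [h6, mul_one]
  rfl

/-- If `λ` were constant, each variable node would only repeat the channel, and density evolution
could converge only for a perfect channel. -/
lemma exists_degree_pos (h : Decodable l r c) (hc : c ≠ deltaInf) : ∃ j ∈ l.support, j ≠ 0 := by
  by_contra! hne
  have hconst : ∀ b, varOut l c b = varOut l c deltaZero := fun b =>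
    Finset.sum_congr rfl fun j hj => by rw [hne j hj]; rfl
  have := h.channel.prob
  have h1 : ∀ n : ℕ, aFam l r c n = c := fun n => by
    rw [h.aFam_eq_varOut n.cast_nonneg, hconst, varOut_deltaZero h.left]
  have h2 := h.tendsto_entropy_aFam
  simp only [h1] at h2
  exact (h.channel.entropy_pos hc).ne' (tendsto_nhds_unique tendsto_const_nhds h2)

/-- The derivative of the entropy along `a_α` in terms of `b_α`. -/
lemma hasDerivWithinAt_entropy_varOut (h : Decodable l r c) (k : ℕ) {α : ℝ}
    (hα : α ∈ Icc (k : ℝ) (k + 1)) :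
    HasDerivWithinAt (fun t => entropy (aFam l r c t))
      (∑ j ∈ l.support, l.coeff j * (j * (h.bRep k).d (fun a => entropy (LDPC.starConv a
        (LDPC.starConv c (LDPC.starPow (bFam l r c α) (j - 1))))) α)) (Icc (k : ℝ) (k + 1)) α := by
  have h1 := HasDerivWithinAt.fun_sum (u := l.support) fun j _ =>
    ((h.bRep k).hasDerivWithinAt_entropy_starPow h.channel j hα).const_mul (l.coeff j)
  refine h1.congr_of_mem (fun t ht => ?_) hα
  have ht0 : 0 ≤ t := k.cast_nonneg.trans ht.1
  rw [h.aFam_eq_varOut ht0]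
  exact isLinear_entropy.apply_varOut h.left h.channel (h.isLDensity_bFam ht0)

lemma d_entropy_neg_zero (h : Decodable l r c) {α : ℝ} (hα : α ∈ Icc (((0 : ℕ) : ℝ) - 1) (0 : ℕ)) :
    (h.aRep 0).d entropy α < 0 := by
  have h1 : HasDerivWithinAt (fun t : ℝ => -t * entropy deltaZero + (1 + t) * entropy c)
      (-1 * entropy deltaZero + 1 * entropy c) (Icc (((0 : ℕ) : ℝ) - 1) (0 : ℕ)) α :=
    ((hasDerivWithinAt_id α _).neg.mul_const _).add
      (((hasDerivWithinAt_id α _).const_add 1).mul_const _)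
  have h2 := h1.congr_of_mem (f₁ := fun t => entropy (aFam l r c t)) (fun t ht => by
    rw [Nat.cast_zero, zero_sub] at ht
    rw [aFam_of_nonpos l r c ht.2, isLinear_entropy.apply_interp h.channel ht]) hα
  have h3 := h2.derivWithin (uniqueDiffOn_Icc (sub_one_lt_self_cast 0) α hα)
  rw [(h.aRep 0).d_eq_derivWithin (sub_one_lt_self_cast 0) isLinear_entropy hα] at h3
  rw [h3, entropy_deltaZero]
  linarith [h.entropy_channel_lt_one]

/-- Strict growth of some moment survives one iteration: `ρ' > 0` at positive arguments passes it to
`b_α`, and an imperfect `c ⋆ b^{⋆ n}` turns it into a strict decrease of entropy. The left end point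
is excluded since at `α = 0` the preceding density is `deltaZero`, where all moments vanish and `ρ'`
may vanish too. -/
lemma d_entropy_neg (h : Decodable l r c) (hc : c ≠ deltaInf) (k : ℕ) {α : ℝ}
    (hα : α ∈ Ioc ((k : ℝ) - 1) k) : (h.aRep k).d entropy α < 0 := by
  induction k generalizing α with
  | zero => exact h.d_entropy_neg_zero (Ioc_subset_Icc_self hα)
  | succ k ih =>
    have hα' : α ∈ Icc (((k + 1 : ℕ) : ℝ) - 1) ((k + 1 : ℕ) : ℝ) := Ioc_subset_Icc_self hα
    have hI : Icc (((k + 1 : ℕ) : ℝ) - 1) ((k + 1 : ℕ) : ℝ) = Icc (k : ℝ) (k + 1) := by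
      push_cast; rw [add_sub_cancel_right]
    have hk := k.cast_nonneg (α := ℝ)
    have hαk : α ∈ Icc (k : ℝ) (k + 1) := hI ▸ hα'
    have hα0 : -1 < α - 1 := by
      have := hα.1
      push_cast at this
      linarith
    have hprev : α - 1 ∈ Ioc ((k : ℝ) - 1) k := by
      have := hα
      push_cast at this
      constructor <;> linarith [this.1, this.2]
    have hb := h.isLDensity_bFam (hk.trans hαk.1)
    have hbne : bFam l r c α ≠ deltaInf := by
      refine ne_deltaInf_of_moment_lt_one (k := 0)
        ((h.moment_bFam_le 0 (by linarith)).trans_lt (h.moment_aFam_lt_one hc 0 hα0.le))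
    -- If no moment grew at `α - 1`, the series for minus the entropy derivative would be
    -- nonpositive, against the induction hypothesis.
    obtain ⟨j₀, hj₀⟩ : ∃ j, 0 < (h.aRep k).d (moment j) (α - 1) := by
      by_contra! hne
      have h1 := (h.aRep k).hasSum_d_entropy (α - 1)
      have h2 := hasSum_le (fun j => mul_nonpos_of_nonneg_of_nonpos (entropyWeight_pos j).le
        (hne j)) h1 hasSum_zero
      linarith [ih hprev]
    have hbd : ∀ j, 0 ≤ (h.bRep k).d (moment j) α := fun j => by
      rw [h.bRep_d_moment k j hαk]
      exact mul_nonneg (h.right.derivative_eval_pos h.no_degree_one_check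
        (h.moment_aFam_pos j hα0)).le (h.d_moment_nonneg k j (Ioc_subset_Icc_self hprev))
    have hbd₀ : 0 < (h.bRep k).d (moment j₀) α := by
      rw [h.bRep_d_moment k j₀ hαk]
      exact mul_pos (h.right.derivative_eval_pos h.no_degree_one_check
        (h.moment_aFam_pos j₀ hα0)) hj₀
    have hneg : ∀ n, (h.bRep k).d (fun a => entropy (LDPC.starConv a
        (LDPC.starConv c (LDPC.starPow (bFam l r c α) n)))) α < 0 := fun n => by
      have he := h.channel.starConv (hb.starPow n)
      have hene := h.channel.starConv_ne_deltaInf (hb.starPow n) hc (hb.starPow_ne_deltaInf hbne n)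
      have := he.prob
      have h1 := (h.bRep k).hasSum_d_starConv he α
      have h2 := hasSum_lt (f := fun _ => (0 : ℝ)) (i := j₀) (fun j =>
        mul_nonneg (mul_nonneg (entropyWeight_pos j).le (hbd j))
          (by linarith [he.moment_lt_one hene j])) (mul_pos (mul_pos (entropyWeight_pos j₀) hbd₀)
          (by linarith [he.moment_lt_one hene j₀])) hasSum_zero h1
      linarith
    have h3 := (h.hasDerivWithinAt_entropy_varOut k hαk).derivWithin
      (uniqueDiffOn_Icc (by linarith) α hαk)
    rw [← hI, (h.aRep (k + 1)).d_eq_derivWithin (sub_one_lt_self_cast _) isLinear_entropy hα'] at h3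
    rw [h3]
    obtain ⟨j₁, hj₁, hj₁0⟩ := h.exists_degree_pos hc
    refine Finset.sum_neg' (fun j _ => mul_nonpos_of_nonneg_of_nonpos (h.left.1 j)
      (mul_nonpos_of_nonneg_of_nonpos j.cast_nonneg (hneg _).le)) ⟨j₁, hj₁, ?_⟩
    have hpos : 0 < l.coeff j₁ :=
      lt_of_le_of_ne (h.left.1 j₁) (Polynomial.mem_support_iff.1 hj₁).symm
    exact mul_neg_of_pos_of_neg hpos (mul_neg_of_pos_of_neg
      (Nat.cast_pos.2 (Nat.pos_of_ne_zero hj₁0)) (hneg _))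

lemma entropy_aFam_eq_zero (h : Decodable l r c) (hc : c = deltaInf) {α : ℝ} (hα : 0 ≤ α) :
    entropy (aFam l r c α) = 0 := by
  have h1 := h.antitoneOn_entropy_aFam (by norm_num : (-1 : ℝ) ≤ 0)
    (by linarith : (-1 : ℝ) ≤ α) hα
  simp only [aFam_zero] at h1
  have h2 : entropy c = 0 := by rw [hc, entropy_deltaInf]
  exact le_antisymm (h1.trans h2.le) (h.isLDensity_aFam (by linarith)).entropy_nonneg

/-- On each interval of smoothness the entropy either has a negative derivative or vanishes. -/
lemma d_entropy_neg_or (h : Decodable l r c) (k : ℕ) :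
    (∀ α ∈ Ioc ((k : ℝ) - 1) k, (h.aRep k).d entropy α < 0) ∨
      (∀ α ∈ Ioc ((k : ℝ) - 1) k, entropy (aFam l r c α) = 0 ∧ (h.aRep k).d entropy α = 0) := by
  by_cases hc : c = deltaInf
  · rcases k with _ | k
    · exact Or.inl fun α hα => h.d_entropy_neg_zero (Ioc_subset_Icc_self hα)
    · refine Or.inr fun α hα => ?_
      have h0 : ∀ t ∈ Icc (((k + 1 : ℕ) : ℝ) - 1) ((k + 1 : ℕ) : ℝ), entropy (aFam l r c t) = 0 :=
        fun t ht => h.entropy_aFam_eq_zero hc (by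
          have := ht.1
          push_cast at this
          linarith [k.cast_nonneg (α := ℝ)])
      have hα' := Ioc_subset_Icc_self hα
      refine ⟨h0 α hα', ?_⟩
      rw [← (h.aRep (k + 1)).d_eq_derivWithin (sub_one_lt_self_cast _) isLinear_entropy hα',
        derivWithin_congr h0 (h0 α hα')]
      simp
  · exact Or.inl fun α hα => h.d_entropy_neg hc k hα

end Decodable

/-! ### The GEXIT functional along the interpolated families -/

lemma isLinear_gexitPotential {z : EReal} (hz : z ≠ ⊥) :
    IsLinear fun a => ∫ w, logTwo (z + w) ∂a := by
  induction z with
  | bot => exact absurd rfl hz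
  | coe z => exact isLinear_potential z
  | top =>
    have h0 : ∀ a, IsLDensity a → (fun w => logTwo (⊤ + w)) =ᵐ[a] fun _ => 0 := fun a ha => by
      filter_upwards [ha.ae_ne_bot] with w hw
      rw [EReal.top_add_of_ne_bot hw, logTwo_top]
    exact ⟨fun w => logTwo (⊤ + w), fun a ha =>
      ⟨(integrable_zero _ _ _).congr (h0 a ha).symm, rfl⟩⟩

namespace PolyRep

variable {μ : ℝ → Measure EReal} {u v : ℝ}

/-- At a point of the half-open interval, the right end included, a left neighbourhood stays in `[u,
v]`. This is why the left derivative at a kink is read off from the interval that ends there. -/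
lemma hasDerivWithinAt_Iic (R : PolyRep μ u v) {Φ : Measure EReal → ℝ} (hΦ : IsLinear Φ) {t : ℝ}
    (ht : t ∈ Ioc u v) : HasDerivWithinAt (fun t => Φ (μ t)) (R.d Φ t) (Iic t) t := by
  refine (R.hasDerivWithinAt hΦ (Ioc_subset_Icc_self ht)).mono_of_mem_nhdsWithin ?_
  filter_upwards [self_mem_nhdsWithin, mem_nhdsWithin_of_mem_nhds (Ioi_mem_nhds ht.1)] with s hs hs'
  exact ⟨(mem_Ioi.1 hs').le, (mem_Iic.1 hs).trans ht.2⟩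

lemma derivWithin_Iic (R : PolyRep μ u v) {Φ : Measure EReal → ℝ} (hΦ : IsLinear Φ) {t : ℝ}
    (ht : t ∈ Ioc u v) : derivWithin (fun t => Φ (μ t)) (Iic t) t = R.d Φ t :=
  (R.hasDerivWithinAt_Iic hΦ ht).derivWithin (uniqueDiffOn_Iic t t self_mem_Iic)

lemma gexitKernel_eq (R : PolyRep μ u v) {t : ℝ} (ht : t ∈ Ioc u v) {z : EReal} (hz : z ≠ ⊥) :
    gexitKernel μ t z = R.d (fun a => ∫ w, logTwo (z + w) ∂a) t / R.d entropy t := by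
  rw [gexitKernel, R.derivWithin_Iic isLinear_entropy ht,
    ← R.derivWithin_Iic (isLinear_gexitPotential hz) ht]
  rfl

lemma integrable_potential {a b : Measure EReal} (ha : IsLDensity a) (hb : IsLDensity b) :
    Integrable (fun z => ∫ w, logTwo (z + w) ∂a) b := by
  have := ha.prob
  have := hb.prob
  exact (hb.integrable_logTwo_add ha).integral_prod_left

lemma integral_potential {a b : Measure EReal} (ha : IsLDensity a) (hb : IsLDensity b) :
    ∫ z, ∫ w, logTwo (z + w) ∂a ∂b = entropy (LDPC.starConv a b) := by
  have := ha.prob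
  have := hb.prob
  rw [starConv_comm, entropy, LDPC.starConv, integral_map measurable_add_ereal.aemeasurable
    measurable_logTwo.aestronglyMeasurable]
  exact (integral_prod _ (hb.integrable_logTwo_add ha)).symm

lemma integrable_gexitKernel (R : PolyRep μ u v) {t : ℝ} (ht : t ∈ Ioc u v) {b : Measure EReal}
    (hb : IsLDensity b) : Integrable (gexitKernel μ t) b := by
  have h : Integrable (fun z => R.d (fun a => ∫ w, logTwo (z + w) ∂a) t / R.d entropy t) b :=
    (integrable_finsetSum _ fun i _ =>
      (integrable_potential (R.ld i) hb).const_mul _).div_const _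
  refine h.congr ?_
  filter_upwards [hb.ae_ne_bot] with z hz
  rw [R.gexitKernel_eq ht hz]

/-- Integrating the potential at `z` against `b t` gives, by Fubini, the entropy of the convolution;
the kernel is a finite combination of such potentials. -/
lemma gexit_eq (R : PolyRep μ u v) {t : ℝ} (ht : t ∈ Ioc u v) {b : ℝ → Measure EReal}
    (hb : IsLDensity (b t)) :
    gexit μ b t = R.d (fun a => entropy (LDPC.starConv a (b t))) t / R.d entropy t := by
  have h : gexit μ b t =
      ∫ z, R.d (fun a => ∫ w, logTwo (z + w) ∂a) t / R.d entropy t ∂(b t) := by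
    refine integral_congr_ae ?_
    filter_upwards [hb.ae_ne_bot] with z hz
    rw [R.gexitKernel_eq ht hz]
  rw [h, integral_div]
  congr 1
  unfold d
  rw [integral_finsetSum _ fun i _ => (integrable_potential (R.ld i) hb).const_mul _]
  exact Finset.sum_congr rfl fun i _ => by
    rw [integral_const_mul, integral_potential (R.ld i) hb]

end PolyRep

namespace Decodable

variable {l r : Polynomial ℝ} {c : Measure EReal}

/-- The numerator of the GEXIT functional. -/
noncomputable def gexitNum (h : Decodable l r c) (k : ℕ) (b : Measure EReal) (α : ℝ) : ℝ :=
  (h.aRep k).d (fun a => entropy (LDPC.starConv a b)) α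

lemma gexitNum_nonpos (h : Decodable l r c) (k : ℕ) {b : Measure EReal} (hb : IsLDensity b) {α : ℝ}
    (hα : α ∈ Icc ((k : ℝ) - 1) k) : h.gexitNum k b α ≤ 0 := by
  have := hb.prob
  have h1 := ((h.aRep k).hasSum_d_starConv hb α).nonneg fun j =>
    mul_nonneg (mul_nonneg (entropyWeight_pos j).le (h.d_moment_nonneg k j hα))
      (by linarith [(moment_mem j b).2])
  unfold gexitNum
  linarith

lemma d_entropy_le_gexitNum (h : Decodable l r c) (k : ℕ) {b : Measure EReal} (hb : IsLDensity b)
    {α : ℝ} (hα : α ∈ Icc ((k : ℝ) - 1) k) : (h.aRep k).d entropy α ≤ h.gexitNum k b α := by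
  have := hb.prob
  have h1 := hasSum_le (fun j => ?_) ((h.aRep k).hasSum_d_starConv hb α)
    ((h.aRep k).hasSum_d_entropy α)
  · unfold gexitNum
    linarith
  · exact mul_le_of_le_one_right (mul_nonneg (entropyWeight_pos j).le (h.d_moment_nonneg k j hα))
      (by linarith [(moment_mem j b).1])

lemma gexitNum_mono (h : Decodable l r c) (k : ℕ) {b b' : Measure EReal} (hb : IsLDensity b)
    (hb' : IsLDensity b') (hbb' : ∀ j, moment j b ≤ moment j b') {α : ℝ}
    (hα : α ∈ Icc ((k : ℝ) - 1) k) : h.gexitNum k b α ≤ h.gexitNum k b' α := by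
  have h1 := hasSum_le (fun j => ?_) ((h.aRep k).hasSum_d_starConv hb' α)
    ((h.aRep k).hasSum_d_starConv hb α)
  · unfold gexitNum
    linarith
  · exact mul_le_mul_of_nonneg_left (by linarith [hbb' j])
      (mul_nonneg (entropyWeight_pos j).le (h.d_moment_nonneg k j hα))

lemma d_entropy_nonpos (h : Decodable l r c) (k : ℕ) {α : ℝ} (hα : α ∈ Icc ((k : ℝ) - 1) k) :
    (h.aRep k).d entropy α ≤ 0 :=
  (h.d_entropy_le_gexitNum k isLDensity_deltaInf hα).trans
    (h.gexitNum_nonpos k isLDensity_deltaInf hα)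

lemma gCheck_eq (h : Decodable l r c) {k : ℕ} {α : ℝ} (hα : α ∈ Ioc ((k : ℝ) - 1) k) :
    gCheck l r c α = h.gexitNum k (bFam l r c (α + 1)) α / (h.aRep k).d entropy α :=
  (h.aRep k).gexit_eq hα (b := fun t => bFam l r c (t + 1))
    (h.isLDensity_bFam (by linarith [hα.1, k.cast_nonneg (α := ℝ)]))

lemma gVar_eq (h : Decodable l r c) {k : ℕ} {α : ℝ} (hα : α ∈ Ioc ((k : ℝ) - 1) k) (h0 : 0 ≤ α) :
    gVar l r c α = h.gexitNum k (bFam l r c α) α / (h.aRep k).d entropy α :=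
  (h.aRep k).gexit_eq hα (h.isLDensity_bFam h0)

lemma div_mem_Icc_zero_one {x y : ℝ} (h1 : y ≤ x) (h2 : x ≤ 0) : x / y ∈ Icc (0 : ℝ) 1 :=
  ⟨div_nonneg_of_nonpos h2 (h1.trans h2), by
    rw [← neg_div_neg_eq]
    exact div_le_one_of_le₀ (by linarith) (by linarith)⟩

lemma gCheck_mem (h : Decodable l r c) {α : ℝ} (hα : -1 < α) : gCheck l r c α ∈ Icc (0 : ℝ) 1 := by
  obtain ⟨k, hk⟩ := exists_mem_Ioc hα
  have hb := h.isLDensity_bFam (α := α + 1) (by linarith)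
  rw [h.gCheck_eq hk]
  exact div_mem_Icc_zero_one (h.d_entropy_le_gexitNum k hb (Ioc_subset_Icc_self hk))
    (h.gexitNum_nonpos k hb (Ioc_subset_Icc_self hk))

lemma gVar_mem (h : Decodable l r c) {α : ℝ} (hα : 0 ≤ α) : gVar l r c α ∈ Icc (0 : ℝ) 1 := by
  obtain ⟨k, hk⟩ := exists_mem_Ioc (by linarith : -1 < α)
  have hb := h.isLDensity_bFam hα
  rw [h.gVar_eq hk hα]
  exact div_mem_Icc_zero_one (h.d_entropy_le_gexitNum k hb (Ioc_subset_Icc_self hk))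
    (h.gexitNum_nonpos k hb (Ioc_subset_Icc_self hk))

/-- Both ordinates have the same denominator, and the numerators differ only in the fixed argument,
whose moments are larger for `b_{α+1}`. -/
lemma gCheck_le_gVar (h : Decodable l r c) {α : ℝ} (hα : 0 ≤ α) :
    gCheck l r c α ≤ gVar l r c α := by
  obtain ⟨k, hk⟩ := exists_mem_Ioc (by linarith : -1 < α)
  have hk' := Ioc_subset_Icc_self hk
  have h1 := h.gexitNum_mono k (h.isLDensity_bFam hα) (h.isLDensity_bFam (α := α + 1) (by linarith))
    (fun j => h.moment_bFam_mono j hα (by linarith)) hk'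
  rw [h.gCheck_eq hk, h.gVar_eq hk hα, ← neg_div_neg_eq, ← neg_div_neg_eq (h.gexitNum k _ α)]
  exact div_le_div_of_nonneg_right (by linarith) (by linarith [h.d_entropy_nonpos k hk'])

/-- The product formula survives a vanishing denominator: the numerator lies between the entropy
derivative and `0`, so it vanishes as well, in accordance with `0 / 0 = 0`. -/
lemma d_entropy_mul_gCheck (h : Decodable l r c) {k : ℕ} {α : ℝ} (hα : α ∈ Ioc ((k : ℝ) - 1) k) :
    (h.aRep k).d entropy α * gCheck l r c α = h.gexitNum k (bFam l r c (α + 1)) α := by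
  have hb := h.isLDensity_bFam (α := α + 1) (by linarith [hα.1, k.cast_nonneg (α := ℝ)])
  have h1 := h.d_entropy_le_gexitNum k hb (Ioc_subset_Icc_self hα)
  have h2 := h.gexitNum_nonpos k hb (Ioc_subset_Icc_self hα)
  rw [h.gCheck_eq hα]
  rcases eq_or_ne ((h.aRep k).d entropy α) 0 with h0 | h0
  · rw [h0] at h1 ⊢
    rw [le_antisymm h2 h1, zero_mul]
  · exact mul_div_cancel₀ _ h0

lemma d_entropy_mul_gVar (h : Decodable l r c) {k : ℕ} {α : ℝ} (hα : α ∈ Ioc ((k : ℝ) - 1) k)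
    (hα0 : 0 ≤ α) :
    (h.aRep k).d entropy α * gVar l r c α = h.gexitNum k (bFam l r c α) α := by
  have hb := h.isLDensity_bFam hα0
  have h1 := h.d_entropy_le_gexitNum k hb (Ioc_subset_Icc_self hα)
  have h2 := h.gexitNum_nonpos k hb (Ioc_subset_Icc_self hα)
  rw [h.gVar_eq hα hα0]
  rcases eq_or_ne ((h.aRep k).d entropy α) 0 with h0 | h0
  · rw [h0] at h1 ⊢
    rw [le_antisymm h2 h1, zero_mul]
  · exact mul_div_cancel₀ _ h0

lemma continuousOn_gexitNum (h : Decodable l r c) (k : ℕ) {b : ℝ → Measure EReal} {s : Set ℝ}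
    (hb : ∀ Φ, IsLinear Φ → ContinuousOn (fun α => Φ (b α)) s) :
    ContinuousOn (fun α => h.gexitNum k (b α) α) s :=
  continuousOn_finsetSum _ fun i _ =>
    (((h.aRep k).p i).derivative.continuous.continuousOn).mul
      (hb _ (isLinear_entropy_starConv ((h.aRep k).ld i)))

lemma continuousOn_bFam_add_one (h : Decodable l r c) {Φ : Measure EReal → ℝ} (hΦ : IsLinear Φ) :
    ContinuousOn (fun α => Φ (bFam l r c (α + 1))) (Ici (-1)) :=
  (h.continuousOn_bFam hΦ).comp (continuous_id.add continuous_const).continuousOn fun α hα => by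
    have : -1 ≤ α := hα
    simp only [mem_Ici]
    linarith

/-- On a whole interval the denominator is either nowhere zero or identically zero; in the second
case the quotient is constantly `0` by convention. -/
lemma continuousOn_div_d_entropy (h : Decodable l r c) (k : ℕ) {f : ℝ → ℝ}
    (hf : ContinuousOn f (Ioc ((k : ℝ) - 1) k)) :
    ContinuousOn (fun α => f α / (h.aRep k).d entropy α) (Ioc ((k : ℝ) - 1) k) := by
  rcases h.d_entropy_neg_or k with h1 | h1
  · exact hf.div ((h.aRep k).continuous_d _).continuousOn fun α hα => (h1 α hα).ne
  · exact (continuousOn_const (c := (0 : ℝ))).congr fun α hα => by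
      simp only [(h1 α hα).2, div_zero]

lemma continuousOn_gCheck (h : Decodable l r c) (k : ℕ) :
    ContinuousOn (gCheck l r c) (Ioc ((k : ℝ) - 1) k) := by
  refine (h.continuousOn_div_d_entropy k (f := fun α => h.gexitNum k (bFam l r c (α + 1)) α)
    ?_).congr fun α hα => h.gCheck_eq hα
  refine (h.continuousOn_gexitNum k (b := fun α => bFam l r c (α + 1)) (s := Ici (-1)) fun Φ hΦ =>
    h.continuousOn_bFam_add_one hΦ).mono fun α hα => ?_
  exact (neg_one_le_cast_sub_one k).trans hα.1.le

lemma continuousOn_gVar (h : Decodable l r c) (k : ℕ) :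
    ContinuousOn (gVar l r c) (Ioc (k : ℝ) (k + 1)) := by
  have hI : Ioc (((k + 1 : ℕ) : ℝ) - 1) ((k + 1 : ℕ) : ℝ) = Ioc (k : ℝ) (k + 1) := by
    push_cast; rw [add_sub_cancel_right]
  have hk := k.cast_nonneg (α := ℝ)
  rw [← hI]
  refine (h.continuousOn_div_d_entropy (k + 1) (f := fun α => h.gexitNum (k + 1) (bFam l r c α) α)
    ?_).congr fun α hα => h.gVar_eq hα ?_
  · rw [hI]
    refine (h.continuousOn_gexitNum (k + 1) (b := fun α => bFam l r c α) (s := Ici 0) fun Φ hΦ =>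
      h.continuousOn_bFam hΦ).mono fun α hα => hk.trans hα.1.le
  · rw [hI] at hα
    exact hk.trans hα.1.le

lemma derivWithin_entropy (h : Decodable l r c) {k : ℕ} {α : ℝ} (hα : α ∈ Ioc ((k : ℝ) - 1) k) :
    derivWithin (fun t => entropy (aFam l r c t)) (Iic α) α = (h.aRep k).d entropy α :=
  (h.aRep k).derivWithin_Iic isLinear_entropy hα

lemma differentiableWithinAt_gexitPotential (h : Decodable l r c) {α : ℝ} (z : ℝ) (hα : -1 < α) :
    DifferentiableWithinAt ℝ (gexitPotential (aFam l r c) z) (Iic α) α := by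
  obtain ⟨k, hk⟩ := exists_mem_Ioc hα
  exact ((h.aRep k).hasDerivWithinAt_Iic (isLinear_potential z) hk).differentiableWithinAt

lemma mem_Ioo_of_ne {k : ℕ} {α : ℝ} (hk : α ∈ Ioc ((k : ℝ) - 1) k) (hne : ∀ k : ℕ, α ≠ k) :
    α ∈ Ioo ((k : ℝ) - 1) k :=
  ⟨hk.1, lt_of_le_of_ne hk.2 (hne k)⟩

lemma differentiableAt_gexitPotential (h : Decodable l r c) {α : ℝ} (z : ℝ) (hα : -1 < α)
    (hne : ∀ k : ℕ, α ≠ k) : DifferentiableAt ℝ (gexitPotential (aFam l r c) z) α := by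
  obtain ⟨k, hk⟩ := exists_mem_Ioc hα
  have hk' := mem_Ioo_of_ne hk hne
  exact ((h.aRep k).hasDerivWithinAt (isLinear_potential z)
    (Ioo_subset_Icc_self hk')).differentiableWithinAt.differentiableAt (Icc_mem_nhds hk'.1 hk'.2)

lemma derivWithin_entropy_neg (h : Decodable l r c) {α : ℝ} (hα : -1 < α)
    (hpos : 0 < entropy (aFam l r c α)) :
    derivWithin (fun t => entropy (aFam l r c t)) (Iic α) α < 0 := by
  obtain ⟨k, hk⟩ := exists_mem_Ioc hα
  rw [h.derivWithin_entropy hk]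
  rcases h.d_entropy_neg_or k with h1 | h1
  · exact h1 α hk
  · exact absurd (h1 α hk).1 hpos.ne'

end Decodable

/-- Bernoulli's inequality `1 - m ^ n ≤ n (1 - m)` in each moment. -/
lemma IsLDensity.entropy_checkPow_le {a : Measure EReal} (ha : IsLDensity a) (n : ℕ) :
    entropy (LDPC.checkPow a n) ≤ n * entropy a := by
  have := ha.prob
  refine hasSum_le (fun k => ?_) (ha.checkPow n).hasSum_entropy (ha.hasSum_entropy.mul_left _)
  have hm := moment_mem k a
  rw [ha.moment_checkPow, mul_left_comm]
  refine mul_le_mul_of_nonneg_left ?_ (entropyWeight_pos k).le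
  have hb := one_add_mul_le_pow (by linarith [hm.1] : (-2 : ℝ) ≤ moment k a - 1) n
  rw [add_sub_cancel] at hb
  linarith

namespace Decodable

variable {l r : Polynomial ℝ} {c : Measure EReal}

/-! ### Every positive entropy is attained exactly once -/

/-- Equal values at two parameters would make the monotone entropy constant between them, so its
left derivative at the larger one would be zero rather than negative. -/
lemma eq_of_entropy_aFam_eq (h : Decodable l r c) {α β : ℝ} (hα : -1 ≤ α) (hβ : -1 ≤ β)
    (he : entropy (aFam l r c α) = entropy (aFam l r c β)) (hpos : 0 < entropy (aFam l r c α)) :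
    α = β := by
  wlog hlt : α < β generalizing α β
  · rcases (not_lt.1 hlt).eq_or_lt with h1 | h1
    · exact h1.symm
    · exact (this hβ hα he.symm (he ▸ hpos) h1).symm
  have hβ' : -1 < β := hα.trans_lt hlt
  have h1 := h.derivWithin_entropy_neg hβ' (he ▸ hpos)
  have h2 : ∀ t ∈ Icc α β, entropy (aFam l r c t) = entropy (aFam l r c β) := fun t ht =>
    le_antisymm (he ▸ h.antitoneOn_entropy_aFam hα (hα.trans ht.1 : (-1 : ℝ) ≤ t) ht.1)
      (h.antitoneOn_entropy_aFam (hα.trans ht.1 : (-1 : ℝ) ≤ t) hβ ht.2)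
  have h3 : (fun t => entropy (aFam l r c t)) =ᶠ[𝓝[Iic β] β] fun _ => entropy (aFam l r c β) := by
    filter_upwards [self_mem_nhdsWithin, mem_nhdsWithin_of_mem_nhds (Ioi_mem_nhds hlt)] with t ht ht'
    exact h2 t ⟨(mem_Ioi.1 ht').le, ht⟩
  rw [h3.derivWithin_eq rfl] at h1
  simp at h1

/-- Equal entropies of ordered densities force equal moments. Since `ρ` is strictly increasing on
`[0, ∞)`, the moments of the preceding `a` agree too, and injectivity for that family applies. -/
lemma eq_of_entropy_bFam_eq (h : Decodable l r c) {α β : ℝ} (hα : 0 ≤ α) (hβ : 0 ≤ β)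
    (he : entropy (bFam l r c α) = entropy (bFam l r c β)) (hpos : 0 < entropy (bFam l r c α)) :
    α = β := by
  wlog hle : α ≤ β generalizing α β
  · exact (this hβ hα he.symm (he ▸ hpos) (le_of_not_ge hle)).symm
  have ha := h.isLDensity_aFam (α := α - 1) (by linarith)
  have ha' := h.isLDensity_aFam (α := β - 1) (by linarith)
  have hmom : ∀ k, moment k (aFam l r c (α - 1)) = moment k (aFam l r c (β - 1)) := fun k => by
    have := ha.prob
    have h1 := (h.isLDensity_bFam hα).moment_eq_of_entropy_eq (h.isLDensity_bFam hβ)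
      (fun k => h.moment_bFam_mono k hα hle) he k
    have h2 := h.moment_aFam_mono k (by linarith : -1 ≤ α - 1) (by linarith : α - 1 ≤ β - 1)
    rw [bFam, bFam, ha.moment_checkOut h.right, ha'.moment_checkOut h.right] at h1
    by_contra hne
    have hlt := lt_of_le_of_ne h2 hne
    have hmono : StrictMonoOn (fun x => r.eval x) (Ici 0) := by
      refine strictMonoOn_of_deriv_pos (convex_Ici 0) r.continuous.continuousOn fun x hx => ?_
      rw [interior_Ici] at hx
      rw [Polynomial.deriv]
      exact h.right.derivative_eval_pos h.no_degree_one_check hx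
    exact (hmono (moment_mem k (aFam l r c (α - 1))).1
      ((moment_mem k (aFam l r c (α - 1))).1.trans h2) hlt).ne h1
  have heq := ha.entropy_congr ha' hmom
  have hpos' : 0 < entropy (aFam l r c (α - 1)) := by
    refine ha.entropy_pos fun h0 => hpos.ne' ?_
    have h1 := (h.isLDensity_bFam hα).entropy_congr isLDensity_deltaInf fun k => by
      rw [bFam, ha.moment_checkOut h.right, h0, moment_deltaInf, h.right.2]
    rw [h1, entropy_deltaInf]
  linarith [h.eq_of_entropy_aFam_eq (by linarith) (by linarith) heq hpos']

lemma entropy_bFam_le (h : Decodable l r c) {α : ℝ} (hα : -1 ≤ α) :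
    entropy (bFam l r c (α + 1)) ≤ r.derivative.eval 1 * entropy (aFam l r c α) := by
  have ha := h.isLDensity_aFam hα
  rw [bFam_add_one, isLinear_entropy.apply_checkOut h.right ha, Polynomial.derivative_eval,
    Polynomial.sum, Finset.sum_mul]
  refine Finset.sum_le_sum fun j _ => ?_
  rw [one_pow, mul_one, mul_assoc]
  exact mul_le_mul_of_nonneg_left (ha.entropy_checkPow_le j) (h.right.1 j)

lemma tendsto_entropy_bFam (h : Decodable l r c) :
    Tendsto (fun n : ℕ => entropy (bFam l r c n)) atTop (𝓝 0) := by
  rw [← tendsto_add_atTop_iff_nat 1]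
  have h1 := h.tendsto_entropy_aFam.const_mul (r.derivative.eval 1)
  rw [mul_zero] at h1
  refine squeeze_zero (fun n => (h.isLDensity_bFam (Nat.cast_nonneg _)).entropy_nonneg)
    (fun n => ?_) h1
  push_cast
  exact h.entropy_bFam_le (by linarith [n.cast_nonneg (α := ℝ)])

end Decodable

lemma existsUnique_of_antitoneOn {f : ℝ → ℝ} {u : ℝ} (hf : ContinuousOn f (Ici u))
    (hu : f u = 1) (hlim : Tendsto (fun n : ℕ => f n) atTop (𝓝 0))
    (hinj : ∀ x y, u ≤ x → u ≤ y → f x = f y → 0 < f x → x = y) {y : ℝ}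
    (hy : y ∈ Ioc (0 : ℝ) 1) : ∃! x, u ≤ x ∧ f x = y := by
  have hn : ∃ n : ℕ, f n < y ∧ u ≤ n := by
    have h1 := hlim.eventually (gt_mem_nhds hy.1)
    have h2 := tendsto_natCast_atTop_atTop.eventually (eventually_ge_atTop u)
    exact (h1.and h2).exists
  obtain ⟨n, hn, hun⟩ := hn
  obtain ⟨x, hx, hxy⟩ := intermediate_value_Icc' hun (hf.mono Icc_subset_Ici_self)
    ⟨hn.le, hy.2.trans hu.ge⟩
  exact ⟨x, ⟨hx.1, hxy⟩, fun z hz => hinj z x hz.1 hx.1 (hz.2.trans hxy.symm) (hz.2 ▸ hy.1)⟩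

/-! ### Areas of regions bounded by parametrized curves -/

lemma exists_mem_Ioc_unit {u α : ℝ} (h : u < α) : ∃ n : ℕ, α ∈ Ioc (u + n) (u + (n + 1)) := by
  obtain ⟨n, hn⟩ := exists_mem_Ioc (α := α - u - 1) (by linarith)
  exact ⟨n, by linarith [hn.1], by linarith [hn.2]⟩

lemma volume_vertical_line (x : ℝ) : volume {p : ℝ × ℝ | p.1 = x} = 0 := by
  have : {p : ℝ × ℝ | p.1 = x} = {x} ×ˢ univ := by ext p; simp
  rw [this, Measure.volume_eq_prod, Measure.prod_prod, Real.volume_singleton, zero_mul]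

lemma measurable_indicator_of_unit_intervals {g : ℝ → ℝ} {u : ℝ}
    (hg : ∀ n : ℕ, ContinuousOn g (Ioc (u + n) (u + (n + 1)))) :
    Measurable ((Ioi u).indicator g) := by
  have hpiece : ∀ n : ℕ, Measurable ((Ioc (u + n) (u + (n + 1))).indicator g) := fun n => by
    rw [← piecewise_eq_indicator]
    exact (hg n).measurable_piecewise continuousOn_const measurableSet_Ioc
  intro t ht
  have : (Ioi u).indicator g ⁻¹' t =
      (⋃ n : ℕ, Ioc (u + n) (u + (n + 1)) ∩ (Ioc (u + n) (u + (n + 1))).indicator g ⁻¹' t) ∪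
        (Iic u ∩ (fun _ => (0 : ℝ)) ⁻¹' t) := by
    ext x
    simp only [mem_preimage, mem_union, mem_iUnion, mem_inter_iff, mem_Iic]
    constructor
    · intro hx
      rcases le_or_gt x u with h | h
      · right
        rw [indicator_of_notMem (by simpa using h)] at hx
        exact ⟨h, hx⟩
      · obtain ⟨n, hn⟩ := exists_mem_Ioc_unit h
        left
        rw [indicator_of_mem (by simpa using h)] at hx
        exact ⟨n, hn, by rwa [indicator_of_mem hn]⟩
    · rintro (⟨n, hn, hx⟩ | ⟨h, hx⟩)
      · have h : u < x := by linarith [hn.1, n.cast_nonneg (α := ℝ)]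
        rw [indicator_of_mem hn] at hx
        rwa [indicator_of_mem (by simpa using h)]
      · rwa [indicator_of_notMem (by simpa using h)]
  rw [this]
  exact (MeasurableSet.iUnion fun n => measurableSet_Ioc.inter (hpiece n ht)).union
    (measurableSet_Iic.inter (measurable_const ht))

lemma volume_between {S : Set ℝ} (hS : MeasurableSet S) {lo up : ℝ → ℝ} (hlo : Measurable lo)
    (hup : Measurable up) :
    MeasurableSet {p : ℝ × ℝ | p.1 ∈ S ∧ lo p.1 ≤ p.2 ∧ p.2 ≤ up p.1} ∧
      volume {p : ℝ × ℝ | p.1 ∈ S ∧ lo p.1 ≤ p.2 ∧ p.2 ≤ up p.1} =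
        ∫⁻ x in S, ENNReal.ofReal (up x - lo x) := by
  have hm : MeasurableSet {p : ℝ × ℝ | p.1 ∈ S ∧ lo p.1 ≤ p.2 ∧ p.2 ≤ up p.1} :=
    (measurable_fst hS).inter ((measurableSet_le (hlo.comp measurable_fst) measurable_snd).inter
      (measurableSet_le measurable_snd (hup.comp measurable_fst)))
  refine ⟨hm, ?_⟩
  rw [Measure.volume_eq_prod, Measure.prod_apply hm, ← lintegral_indicator hS]
  refine lintegral_congr fun x => ?_
  by_cases hx : x ∈ S
  · rw [indicator_of_mem hx, ← Real.volume_Icc]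
    congr 1
    ext y
    simp [hx]
  · rw [indicator_of_notMem hx]
    have : Prod.mk x ⁻¹' {p : ℝ × ℝ | p.1 ∈ S ∧ lo p.1 ≤ p.2 ∧ p.2 ≤ up p.1} = ∅ := by
      ext y
      simp [hx]
    rw [this, measure_empty]

/-- The region between two ordinates `lo` and `up` over a decreasing abscissa `H`. -/
def paramRegion (H lo up : ℝ → ℝ) (u : ℝ) : Set (ℝ × ℝ) :=
  {p | ∃ α, u < α ∧ p.1 = H α ∧ lo α ≤ p.2 ∧ p.2 ≤ up α}

/-- A decreasing parametrization of abscissae by a piecewise differentiable function. -/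
structure IsAbscissa (H H' : ℝ → ℝ) (u : ℝ) : Prop where
  continuousOn : ContinuousOn H (Ici u)
  antitoneOn : AntitoneOn H (Ici u)
  nonneg : ∀ α, u ≤ α → 0 ≤ H α
  inj : ∀ α β, u ≤ α → u ≤ β → H α = H β → 0 < H α → α = β
  tendsto : Tendsto (fun n : ℕ => H n) atTop (𝓝 0)
  hasDerivAt : ∃ N : Set ℝ, N.Countable ∧ ∀ α, u < α → α ∉ N → HasDerivAt H (H' α) α

namespace IsAbscissa

variable {H H' : ℝ → ℝ} {u : ℝ}

lemma lt_of_lt (hH : IsAbscissa H H' u) {α : ℝ} (hα : u < α) (hpos : 0 < H α) : H α < H u :=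
  lt_of_le_of_ne (hH.antitoneOn self_mem_Ici hα.le hα.le)
    fun h => hα.ne' (hH.inj α u hα.le le_rfl h hpos)

lemma image_eq (hH : IsAbscissa H H' u) : H '' {α | u < α ∧ 0 < H α} = Ioo 0 (H u) := by
  ext x
  constructor
  · rintro ⟨α, ⟨hα, hpos⟩, rfl⟩
    exact ⟨hpos, hH.lt_of_lt hα hpos⟩
  · intro hx
    have hn : ∃ n : ℕ, H n < x ∧ u ≤ n :=
      ((hH.tendsto.eventually (gt_mem_nhds hx.1)).and
        (tendsto_natCast_atTop_atTop.eventually (eventually_ge_atTop u))).exists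
    obtain ⟨n, hn, hun⟩ := hn
    obtain ⟨α, hα, rfl⟩ := intermediate_value_Icc' hun
      (hH.continuousOn.mono Icc_subset_Ici_self) ⟨hn.le, hx.2.le⟩
    refine ⟨α, ⟨lt_of_le_of_ne hα.1 ?_, hx.1⟩, rfl⟩
    rintro rfl
    exact hx.2.ne rfl

open Classical in
/-- The inverse of the parametrization, extended by `u`. -/
noncomputable def inverse (_ : IsAbscissa H H' u) (x : ℝ) : ℝ :=
  if h : ∃ α, u < α ∧ 0 < H α ∧ H α = x then h.choose else u

lemma inverse_apply (hH : IsAbscissa H H' u) {α : ℝ} (hα : u < α) (hpos : 0 < H α) :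
    hH.inverse (H α) = α := by
  have h : ∃ β, u < β ∧ 0 < H β ∧ H β = H α := ⟨α, hα, hpos, rfl⟩
  rw [inverse, dif_pos h]
  exact hH.inj _ _ h.choose_spec.1.le hα.le h.choose_spec.2.2 h.choose_spec.2.1

lemma inverse_of_notMem (hH : IsAbscissa H H' u) {x : ℝ} (hx : x ∉ Ioo 0 (H u)) :
    hH.inverse x = u := by
  rw [inverse, dif_neg]
  rintro ⟨α, hα, hpos, rfl⟩
  exact hx ⟨hpos, hH.lt_of_lt hα hpos⟩

lemma exists_of_mem (hH : IsAbscissa H H' u) {x : ℝ} (hx : x ∈ Ioo 0 (H u)) :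
    ∃ α, u < α ∧ 0 < H α ∧ H α = x := by
  rw [← hH.image_eq] at hx
  obtain ⟨α, ⟨hα, hpos⟩, hx⟩ := hx
  exact ⟨α, hα, hpos, hx⟩

/-- `H` is decreasing, so superlevel sets of the inverse are intervals, apart from the range where
the default value `u` already makes them everything. -/
lemma measurable_inverse (hH : IsAbscissa H H' u) : Measurable hH.inverse := by
  refine measurable_of_Ici fun t => ?_
  rcases le_or_gt t u with ht | ht
  · have : hH.inverse ⁻¹' Ici t = univ := by
      refine eq_univ_of_forall fun x => ?_
      simp only [mem_preimage, mem_Ici]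
      by_cases hx : x ∈ Ioo 0 (H u)
      · obtain ⟨α, hα, hpos, rfl⟩ := hH.exists_of_mem hx
        rw [hH.inverse_apply hα hpos]
        linarith
      · rwa [hH.inverse_of_notMem hx]
    rw [this]
    exact MeasurableSet.univ
  · have : hH.inverse ⁻¹' Ici t = Ioo 0 (H u) ∩ Iic (H t) := by
      ext x
      simp only [mem_preimage, mem_Ici, mem_inter_iff, mem_Iic]
      by_cases hx : x ∈ Ioo 0 (H u)
      · obtain ⟨α, hα, hpos, rfl⟩ := hH.exists_of_mem hx
        rw [hH.inverse_apply hα hpos]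
        constructor
        · exact fun h => ⟨hx, hH.antitoneOn ht.le hα.le h⟩
        · rintro ⟨_, h⟩
          by_contra! hlt
          exact hlt.ne (hH.inj _ _ hα.le ht.le
            (le_antisymm h (hH.antitoneOn hα.le ht.le hlt.le)) hpos)
      · rw [hH.inverse_of_notMem hx]
        exact ⟨fun h => absurd h (not_le.2 ht), fun h => absurd h.1 hx⟩
    rw [this]
    exact measurableSet_Ioo.inter measurableSet_Iic

/-- Up to the line of abscissa `0` the region lies between two graphs over `(0, H u)`, obtained by
composing `lo` and `up` with the inverse of `H`. The area formula then substitutes `x = H α`; the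
countable set of kinks and its image are null. -/
lemma volume_paramRegion (hH : IsAbscissa H H' u) {lo up : ℝ → ℝ}
    (hlo : Measurable ((Ioi u).indicator lo)) (hup : Measurable ((Ioi u).indicator up)) :
    NullMeasurableSet (paramRegion H lo up u) ∧
      volume (paramRegion H lo up u) =
        ∫⁻ α in Ioi u, ENNReal.ofReal |H' α| * ENNReal.ofReal (up α - lo α) := by
  obtain ⟨N, hN, hder⟩ := hH.hasDerivAt
  set S := Ioo 0 (H u) with hS
  set lo' := fun x => (Ioi u).indicator lo (hH.inverse x) with hlo'
  set up' := fun x => (Ioi u).indicator up (hH.inverse x) with hup'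
  obtain ⟨hm, hvol⟩ := volume_between (S := S) measurableSet_Ioo (hlo.comp hH.measurable_inverse)
    (hup.comp hH.measurable_inverse)
  set E' := {p : ℝ × ℝ | p.1 ∈ S ∧ lo' p.1 ≤ p.2 ∧ p.2 ≤ up' p.1} with hE'
  have hval : ∀ α, u < α → 0 < H α → lo' (H α) = lo α ∧ up' (H α) = up α := fun α hα hpos => by
    simp only [hlo', hup', hH.inverse_apply hα hpos]
    rw [indicator_of_mem (mem_Ioi.2 hα), indicator_of_mem (mem_Ioi.2 hα)]
    exact ⟨rfl, rfl⟩
  have hsub : E' ⊆ paramRegion H lo up u := by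
    rintro ⟨x, y⟩ ⟨hx, h1, h2⟩
    obtain ⟨α, hα, hpos, rfl⟩ := hH.exists_of_mem hx
    simp only [(hval α hα hpos).1, (hval α hα hpos).2] at h1 h2
    exact ⟨α, hα, rfl, h1, h2⟩
  have hsub' : paramRegion H lo up u ⊆ E' ∪ {p | p.1 = 0} := by
    rintro ⟨x, y⟩ ⟨α, hα, hx, h1, h2⟩
    simp only at hx h1 h2
    subst hx
    rcases (hH.nonneg α hα.le).eq_or_lt with h0 | hpos
    · exact Or.inr h0.symm
    · refine Or.inl ⟨⟨hpos, hH.lt_of_lt hα hpos⟩, ?_, ?_⟩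
      · rwa [(hval α hα hpos).1]
      · rwa [(hval α hα hpos).2]
  have hae : E' =ᵐ[volume] paramRegion H lo up u := by
    refine (ae_le_set.2 ?_ : E' ≤ᵐ[volume] _).antisymm (ae_le_set.2 ?_)
    · rw [sdiff_eq_empty.2 hsub, measure_empty]
    · exact measure_mono_null (fun p hp => (hsub' hp.1).resolve_left hp.2) (volume_vertical_line 0)
  refine ⟨hm.nullMeasurableSet.congr hae, ?_⟩
  rw [← measure_congr hae]
  refine hvol.trans ?_
  change ∫⁻ x in S, ENNReal.ofReal (up' x - lo' x) = _
  set T := {α | u < α ∧ 0 < H α} \ N with hT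
  have hP : IsOpen {α | u < α ∧ 0 < H α} :=
    (hH.continuousOn.mono Ioi_subset_Ici_self).isOpen_inter_preimage isOpen_Ioi isOpen_Ioi
  have hTm : MeasurableSet T := hP.measurableSet.diff hN.measurableSet
  have hTS : H '' T =ᵐ[volume] S := by
    refine (ae_le_set.2 ?_ : H '' T ≤ᵐ[volume] S).antisymm (ae_le_set.2 ?_)
    · rw [sdiff_eq_empty.2, measure_empty]
      rw [hS, ← hH.image_eq]
      exact image_mono sdiff_subset
    · refine measure_mono_null (fun x hx => ?_) ((hN.image H).measure_zero volume)
      obtain ⟨α, hα, hpos, rfl⟩ := hH.exists_of_mem hx.1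
      refine ⟨α, ?_, rfl⟩
      by_contra hne
      exact hx.2 ⟨α, ⟨⟨hα, hpos⟩, hne⟩, rfl⟩
  rw [← setLIntegral_congr hTS, lintegral_image_eq_lintegral_abs_deriv_mul hTm
    (fun α hα => (hder α hα.1.1 hα.2).hasDerivWithinAt)
    (fun α hα β hβ h => hH.inj α β hα.1.1.le hβ.1.1.le h hα.1.2)]
  rw [← lintegral_indicator hTm, ← lintegral_indicator measurableSet_Ioi]
  refine lintegral_congr_ae ?_
  filter_upwards [compl_mem_ae_iff.2 (hN.measure_zero volume)] with α hαN
  by_cases hα : u < α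
  · rw [indicator_of_mem (mem_Ioi.2 hα) (fun α => ENNReal.ofReal |H' α| *
      ENNReal.ofReal (up α - lo α))]
    rcases (hH.nonneg α hα.le).eq_or_lt with h0 | hpos
    -- Parameters with `H α = 0` are not in the domain of the substitution, but they contribute
    -- nothing on the right: `H` has a minimum there and its derivative vanishes.
    · have hmin : IsLocalMin H α := by
        filter_upwards [Ioi_mem_nhds hα] with β hβ
        rw [← h0]
        exact hH.nonneg β (mem_Ioi.1 hβ).le
      rw [hmin.hasDerivAt_eq_zero (hder α hα hαN), indicator_of_notMem fun hα' => h0.not_lt hα'.1.2]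
      simp
    · have hαT : α ∈ T := ⟨⟨hα, hpos⟩, hαN⟩
      rw [indicator_of_mem hαT, (hval α hα hpos).1, (hval α hα hpos).2]
  · have hαT : α ∉ T := fun hα' => hα hα'.1.1
    have hαu : α ∉ Ioi u := hα
    rw [indicator_of_notMem hαT, indicator_of_notMem hαu]

end IsAbscissa

/-! ### Integration of a piecewise exact differential -/

lemma lintegral_Ioc_of_hasDerivWithinAt {a b : ℝ} (hab : a ≤ b) {Ψ ψ : ℝ → ℝ}
    (hcont : ContinuousOn ψ (Icc a b))
    (hder : ∀ t ∈ Icc a b, HasDerivWithinAt Ψ (ψ t) (Icc a b) t) (hneg : ∀ t ∈ Ioc a b, ψ t ≤ 0) :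
    ∫⁻ t in Ioc a b, ENNReal.ofReal (-ψ t) = ENNReal.ofReal (Ψ a - Ψ b) := by
  have hint : IntervalIntegrable ψ volume a b :=
    (hcont.mono (by rw [uIcc_of_le hab])).intervalIntegrable
  have h1 := intervalIntegral.integral_eq_sub_of_hasDerivAt_of_le hab
    (fun t ht => (hder t ht).continuousWithinAt)
    (fun t ht => (hder t (Ioo_subset_Icc_self ht)).hasDerivAt (Icc_mem_nhds ht.1 ht.2)) hint
  have hint' : IntegrableOn (fun t => -ψ t) (Ioc a b) := hint.1.neg
  rw [← ofReal_integral_eq_lintegral_ofReal hint'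
    ((ae_restrict_iff' measurableSet_Ioc).2 (Eventually.of_forall fun t ht => by
      simpa using hneg t ht)), integral_neg, ← intervalIntegral.integral_of_le hab, h1, neg_sub]

/-- The integrals over unit pieces telescope, and monotone convergence passes to the half-line.
Half-open pieces partition it, so the functions `ψ n` may disagree at common end points. -/
lemma lintegral_Ioi_of_unit_intervals {u : ℝ} {Ψ : ℝ → ℝ} {g : ℝ → ℝ≥0∞} {ψ : ℕ → ℝ → ℝ}
    (hcont : ∀ n : ℕ, ContinuousOn (ψ n) (Icc (u + n) (u + (n + 1))))
    (hder : ∀ n : ℕ, ∀ t ∈ Icc (u + (n : ℝ)) (u + (n + 1)),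
      HasDerivWithinAt Ψ (ψ n t) (Icc (u + n) (u + (n + 1))) t)
    (hneg : ∀ n : ℕ, ∀ t ∈ Ioc (u + (n : ℝ)) (u + (n + 1)), ψ n t ≤ 0)
    (hg : ∀ n : ℕ, ∀ t ∈ Ioc (u + (n : ℝ)) (u + (n + 1)), g t = ENNReal.ofReal (-ψ n t))
    (hlim : Tendsto (fun n : ℕ => Ψ (u + n)) atTop (𝓝 0)) :
    ∫⁻ t in Ioi u, g t = ENNReal.ofReal (Ψ u) := by
  have hstep : ∀ n : ℕ, ∫⁻ t in Ioc (u + (n : ℝ)) (u + (n + 1)), g t =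
      ENNReal.ofReal (Ψ (u + n) - Ψ (u + (n + 1))) := fun n => by
    rw [← lintegral_Ioc_of_hasDerivWithinAt (by linarith) (hcont n) (hder n) (hneg n)]
    exact setLIntegral_congr_fun measurableSet_Ioc (hg n)
  have hanti : ∀ n : ℕ, Ψ (u + (n + 1)) ≤ Ψ (u + n) := fun n => by
    have hle : u + (n : ℝ) ≤ u + (n + 1) := by linarith
    refine antitoneOn_of_deriv_nonpos (convex_Icc (u + (n : ℝ)) (u + (n + 1)))
      (fun t ht => (hder n t ht).continuousWithinAt) (fun t ht => ?_) (fun t ht => ?_)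
      (left_mem_Icc.2 hle) (right_mem_Icc.2 hle) hle
    · rw [interior_Icc] at ht
      exact ((hder n t (Ioo_subset_Icc_self ht)).hasDerivAt
        (Icc_mem_nhds ht.1 ht.2)).differentiableAt.differentiableWithinAt
    · rw [interior_Icc] at ht
      rw [((hder n t (Ioo_subset_Icc_self ht)).hasDerivAt (Icc_mem_nhds ht.1 ht.2)).deriv]
      exact hneg n t (Ioo_subset_Ioc_self ht)
  have hanti' : ∀ n : ℕ, Ψ (u + n) ≤ Ψ u := fun n => by
    induction n with
    | zero => simp
    | succ n ih => exact (by simpa using hanti n : Ψ (u + ((n + 1 : ℕ) : ℝ)) ≤ _).trans ih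
  have hsum : ∀ n : ℕ, ∫⁻ t in Ioc u (u + n), g t = ENNReal.ofReal (Ψ u - Ψ (u + n)) := fun n => by
    induction n with
    | zero => simp
    | succ n ih =>
      have hle : u ≤ u + n := by simp
      push_cast
      rw [← Ioc_union_Ioc_eq_Ioc hle (by linarith : u + (n : ℝ) ≤ u + (n + 1)),
        lintegral_union measurableSet_Ioc (Ioc_disjoint_Ioc_of_le le_rfl), ih, hstep,
        ← ENNReal.ofReal_add (by linarith [hanti' n]) (by linarith [hanti n])]
      congr 1
      ring
  have hU : Ioi u = ⋃ n : ℕ, Ioc u (u + n) := by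
    ext x
    simp only [mem_Ioi, mem_iUnion, mem_Ioc]
    constructor
    · intro hx
      obtain ⟨n, hn⟩ := exists_nat_ge (x - u)
      exact ⟨n, hx, by linarith⟩
    · rintro ⟨n, hx, _⟩
      exact hx
  have hmono : Monotone fun n : ℕ => Ioc u (u + (n : ℝ)) := fun m n hmn =>
    Ioc_subset_Ioc_right (by simpa using hmn)
  have h1 : Tendsto (fun n : ℕ => ∫⁻ t in Ioc u (u + (n : ℝ)), g t) atTop
      (𝓝 (∫⁻ t in Ioi u, g t)) := by
    rw [hU, setLIntegral_iUnion_of_directed _ (hmono.directed_le)]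
    exact tendsto_atTop_iSup fun m n hmn => lintegral_mono_set (hmono hmn)
  have h2 : Tendsto (fun n : ℕ => ENNReal.ofReal (Ψ u - Ψ (u + n))) atTop
      (𝓝 (ENNReal.ofReal (Ψ u - 0))) := ENNReal.tendsto_ofReal (hlim.const_sub _)
  simp only [hsum] at h1
  rw [sub_zero] at h2
  exact tendsto_nhds_unique h1 h2

lemma polyInt_eq_sum (p : Polynomial ℝ) :
    polyInt p = ∑ j ∈ p.support, p.coeff j / (j + 1) := by
  unfold polyInt
  simp only [Polynomial.eval_eq_sum, Polynomial.sum]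
  rw [intervalIntegral.integral_finsetSum fun j _ => by
    exact (continuous_const.mul (continuous_pow j)).intervalIntegrable _ _]
  refine Finset.sum_congr rfl fun j _ => ?_
  rw [intervalIntegral.integral_const_mul, integral_pow]
  simp [div_eq_mul_inv]

/-! ### The potentials whose derivatives are the GEXIT integrands -/

namespace PolyRep

variable {μ ν : ℝ → Measure EReal} {u v : ℝ}

/-- Rewriting of the endpoints. -/
def cast (R : PolyRep μ u v) {u' v' : ℝ} (hu : u' = u) (hv : v' = v) : PolyRep μ u' v' where
  ι := R.ι
  p := R.p
  m := R.m
  ld := R.ld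
  nonneg i t ht := R.nonneg i t (by rwa [hu, hv] at ht)
  sum_eq := R.sum_eq
  eq t ht := R.eq t (by rwa [hu, hv] at ht)

/-- Linearity in the first argument: mixing the derivatives over the components of `μ t` is the same
as differentiating with `μ t` frozen. It supplies the second half of the product rule. -/
lemma d_swap (R : PolyRep μ u v) (S : PolyRep ν u v)
    {F : Measure EReal → Measure EReal → ℝ} (hF : ∀ b, IsLDensity b → IsLinear fun a => F a b)
    {t : ℝ} (ht : t ∈ Icc u v) :
    ∑ i, (R.p i).eval t * S.d (F (R.m i)) t = S.d (F (μ t)) t := by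
  simp only [d, Finset.mul_sum]
  rw [Finset.sum_comm]
  refine Finset.sum_congr rfl fun j _ => ?_
  rw [R.apply_eq (hF _ (S.ld j)) ht, Finset.mul_sum]
  exact Finset.sum_congr rfl fun i _ => by ring

/-- The product rule for the entropy of the check-node convolution of two families. -/
lemma hasDerivWithinAt_entropy_checkConv (R : PolyRep μ u v) (S : PolyRep ν u v) {t : ℝ}
    (ht : t ∈ Icc u v) :
    HasDerivWithinAt (fun t => entropy (LDPC.checkConv (μ t) (ν t)))
      (R.d (fun a => entropy (LDPC.checkConv a (ν t))) t +
        S.d (fun b => entropy (LDPC.checkConv (μ t) b)) t) (Icc u v) t := by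
  have hlin : ∀ b, IsLDensity b → IsLinear fun a => entropy (LDPC.checkConv a b) := fun b hb =>
    (isLinear_entropy_checkConv hb).congr fun a ha => by
      have := ha.prob
      have := hb.prob
      rw [checkConv_comm]
  have h : HasDerivWithinAt
      (fun t => ∑ i, (R.p i).eval t * entropy (LDPC.checkConv (R.m i) (ν t)))
      (∑ i, ((R.p i).derivative.eval t * entropy (LDPC.checkConv (R.m i) (ν t)) +
        (R.p i).eval t * S.d (fun b => entropy (LDPC.checkConv (R.m i) b)) t)) (Icc u v) t :=
    HasDerivWithinAt.fun_sum fun i _ => ((R.p i).hasDerivAt t).hasDerivWithinAt.mul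
      (S.hasDerivWithinAt (isLinear_entropy_checkConv (R.ld i)) ht)
  rw [Finset.sum_add_distrib, R.d_swap S (F := fun a b => entropy (LDPC.checkConv a b)) hlin ht]
    at h
  exact h.congr_of_mem (fun s hs => R.apply_eq (hlin _ (S.isLDensity hs)) hs) ht

end PolyRep

/-- By duality this is `H(a) ≤ H(a ⊠ b)`, which holds since check convolution multiplies the moments
of `a` by numbers at most one. -/
lemma IsLDensity.entropy_starConv_le {a b : Measure EReal} (ha : IsLDensity a)
    (hb : IsLDensity b) : entropy (LDPC.starConv a b) ≤ entropy b := by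
  have := ha.prob
  have := hb.prob
  have h1 := ha.entropy_starConv_add_entropy_checkConv hb
  have h2 := (ha.checkConv hb).entropy_le_entropy ha fun k => by
    rw [moment_checkConv]
    exact mul_le_of_le_one_right (moment_mem k a).1 (moment_mem k b).2
  linarith

lemma IsLDensity.entropy_checkConv_le {a b : Measure EReal} (ha : IsLDensity a)
    (hb : IsLDensity b) : entropy (LDPC.checkConv a b) ≤ entropy a + entropy b := by
  linarith [ha.entropy_starConv_add_entropy_checkConv hb, (ha.starConv hb).entropy_nonneg]

/-- The potential of the check-node curve. -/
noncomputable def checkPotential (r : Polynomial ℝ) (a : Measure EReal) : ℝ :=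
  entropy a - ∑ j ∈ r.support, r.coeff j / (j + 1) * entropy (checkPow a (j + 1))

/-- The potential of the variable-node curve. -/
noncomputable def varPotential (l : Polynomial ℝ) (c a b : Measure EReal) : ℝ :=
  entropy (checkConv a b) - entropy b +
    ∑ j ∈ l.support, l.coeff j / (j + 1) * entropy (starConv c (starPow b (j + 1)))

lemma checkPotential_deltaZero (r : Polynomial ℝ) :
    checkPotential r deltaZero = 1 - polyInt r := by
  rw [checkPotential, polyInt_eq_sum, entropy_deltaZero]
  congr 1
  refine Finset.sum_congr rfl fun j _ => ?_
  have := (isLDensity_deltaZero.checkPow j).prob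
  rw [checkPow, checkConv_deltaZero, entropy_deltaZero, mul_one]

lemma varPotential_deltaZero (l : Polynomial ℝ) (c : Measure EReal) [IsProbabilityMeasure c] :
    varPotential l c c deltaZero = entropy c * polyInt l := by
  rw [varPotential, checkConv_deltaZero, sub_self, zero_add, polyInt_eq_sum, Finset.mul_sum]
  refine Finset.sum_congr rfl fun j _ => ?_
  rw [starPow_deltaZero, starConv_deltaZero, mul_comm]

namespace Decodable

variable {l r : Polynomial ℝ} {c : Measure EReal}

/-- By the power rule `H(a^{⊠(j+1)}) / (j + 1)` has the derivative of `H(a ⊠ a^{⊠ j})` with the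
second factor frozen. Averaging over `ρ` freezes `b_{α+1}`, and duality turns the difference from
`dH(a)` into the GEXIT numerator. -/
lemma hasDerivWithinAt_checkPotential (h : Decodable l r c) (k : ℕ) {α : ℝ}
    (hα : α ∈ Icc ((k : ℝ) - 1) k) :
    HasDerivWithinAt (fun t => checkPotential r (aFam l r c t))
      (h.gexitNum k (bFam l r c (α + 1)) α) (Icc ((k : ℝ) - 1) k) α := by
  have ha := (h.aRep k).isLDensity hα
  have h1 := ((h.aRep k).hasDerivWithinAt isLinear_entropy hα).sub
    (HasDerivWithinAt.fun_sum (u := r.support) fun j _ =>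
      ((h.aRep k).hasDerivWithinAt_entropy_checkPow (j + 1) hα).const_mul
        (r.coeff j / ((j : ℝ) + 1)))
  refine h1.congr_deriv ?_
  rw [gexitNum, (h.aRep k).d_starConv (by rw [bFam_add_one]; exact ha.checkOut h.right)]
  congr 1
  rw [(h.aRep k).d_congr (Ψ := fun a => ∑ j ∈ r.support, r.coeff j *
      entropy (LDPC.checkConv a (LDPC.checkPow (aFam l r c α) j))) fun a ha' => by
    rw [bFam_add_one]
    exact (isLinear_entropy_checkConv ha').apply_checkOut h.right ha, PolyRep.d_finset_sum]
  refine Finset.sum_congr rfl fun j _ => ?_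
  rw [PolyRep.d_const_mul]
  have : (j : ℝ) + 1 ≠ 0 := by positivity
  simp only [add_tsub_cancel_right]
  push_cast
  field_simp

/-- The product rule splits the change of `H(a ⊠ b)`. In the part where `b` moves, duality gives
`dH(b) - dH(a ⋆ b)` with `a` frozen; inserting `a = ∑ λ_j c ⋆ b^{⋆ j}` turns the last term into the
derivatives of the powers. The other two terms of the potential cancel all of this, and only the
change of `a` remains. -/
lemma hasDerivWithinAt_varPotential (h : Decodable l r c) (k : ℕ) {α : ℝ}
    (hα : α ∈ Icc (k : ℝ) (k + 1)) :
    HasDerivWithinAt (fun t => varPotential l c (aFam l r c t) (bFam l r c t))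
      ((h.aRep (k + 1)).d (fun a => entropy (LDPC.checkConv a (bFam l r c α))) α)
      (Icc (k : ℝ) (k + 1)) α := by
  set R := (h.aRep (k + 1)).cast (u' := (k : ℝ)) (v' := (k : ℝ) + 1) (by push_cast; ring)
    (by push_cast; ring) with hR
  set S := h.bRep k
  have ha := R.isLDensity hα
  have hb := S.isLDensity hα
  have := hb.prob
  have h1 := ((R.hasDerivWithinAt_entropy_checkConv S hα).sub
    (S.hasDerivWithinAt isLinear_entropy hα)).add
    (HasDerivWithinAt.fun_sum (u := l.support) fun j _ =>
      (S.hasDerivWithinAt_entropy_starPow h.channel (j + 1) hα).const_mul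
        (l.coeff j / ((j : ℝ) + 1)))
  refine h1.congr_deriv ?_
  have e1 : S.d (fun b => entropy (LDPC.checkConv (aFam l r c α) b)) α =
      S.d entropy α - ∑ j ∈ l.support, l.coeff j * S.d (fun b => entropy (LDPC.starConv b
        (LDPC.starConv c (LDPC.starPow (bFam l r c α) j)))) α := by
    suffices e2 : S.d (fun b => entropy (LDPC.checkConv (aFam l r c α) b)) α =
        S.d (fun b => entropy (aFam l r c α) + (entropy b - ∑ j ∈ l.support, l.coeff j *
          entropy (LDPC.starConv b (LDPC.starConv c (LDPC.starPow (bFam l r c α) j))))) α by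
      rw [e2, S.d_add, S.d_const, zero_add, S.d_sub, S.d_finset_sum]
      simp only [PolyRep.d_const_mul]
    refine S.d_congr (fun b hb' => ?_) α
    have h2 := ha.entropy_starConv_add_entropy_checkConv hb'
    have h3 : entropy (LDPC.starConv (aFam l r c α) b) = ∑ j ∈ l.support, l.coeff j *
        entropy (LDPC.starConv b (LDPC.starConv c (LDPC.starPow (bFam l r c α) j))) := by
      have := ha.prob
      have := hb'.prob
      rw [starConv_comm, h.aFam_eq_varOut (k.cast_nonneg.trans hα.1)]
      exact (isLinear_entropy_starConv hb').apply_varOut h.left h.channel hb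
    linarith
  rw [e1]
  have e3 : ∑ j ∈ l.support, l.coeff j / ((j : ℝ) + 1) * (((j + 1 : ℕ) : ℝ) *
      S.d (fun a => entropy (LDPC.starConv a (LDPC.starConv c
        (LDPC.starPow (bFam l r c α) (j + 1 - 1))))) α) =
      ∑ j ∈ l.support, l.coeff j * S.d (fun b => entropy (LDPC.starConv b
        (LDPC.starConv c (LDPC.starPow (bFam l r c α) j)))) α := by
    refine Finset.sum_congr rfl fun j _ => ?_
    have : (j : ℝ) + 1 ≠ 0 := by positivity
    simp only [add_tsub_cancel_right]
    push_cast
    field_simp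
  rw [e3]
  have e4 : R.d (fun a => entropy (LDPC.checkConv a (bFam l r c α))) α =
    (h.aRep (k + 1)).d (fun a => entropy (LDPC.checkConv a (bFam l r c α))) α := rfl
  rw [e4]
  ring

lemma tendsto_checkPotential (h : Decodable l r c) :
    Tendsto (fun n : ℕ => checkPotential r (aFam l r c n)) atTop (𝓝 0) := by
  have h0 := h.tendsto_entropy_aFam
  have h1 : ∀ j, Tendsto (fun n : ℕ => entropy (checkPow (aFam l r c n) j)) atTop (𝓝 0) :=
    fun j => by
      have h2 := h0.const_mul (j : ℝ)
      rw [mul_zero] at h2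
      have ha := fun n : ℕ => h.isLDensity_aFam (α := n) (by linarith [n.cast_nonneg (α := ℝ)])
      exact squeeze_zero (fun n => ((ha n).checkPow j).entropy_nonneg)
        (fun n => (ha n).entropy_checkPow_le j) h2
  have h2 := h0.sub (tendsto_finsetSum r.support fun j _ =>
    (h1 (j + 1)).const_mul (r.coeff j / ((j : ℝ) + 1)))
  simpa [checkPotential] using h2

lemma tendsto_varPotential (h : Decodable l r c) :
    Tendsto (fun n : ℕ => varPotential l c (aFam l r c n) (bFam l r c n)) atTop (𝓝 0) := by
  have ha := fun n : ℕ => h.isLDensity_aFam (α := n) (by linarith [n.cast_nonneg (α := ℝ)])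
  have hb := fun n : ℕ => h.isLDensity_bFam (α := n) n.cast_nonneg
  have h0 := h.tendsto_entropy_aFam
  have h1 := h.tendsto_entropy_bFam
  have h2 : Tendsto (fun n : ℕ => entropy (checkConv (aFam l r c n) (bFam l r c n))) atTop
      (𝓝 0) := by
    have := h0.add h1
    rw [add_zero] at this
    exact squeeze_zero (fun n => ((ha n).checkConv (hb n)).entropy_nonneg)
      (fun n => (ha n).entropy_checkConv_le (hb n)) this
  have h3 : ∀ j, Tendsto (fun n : ℕ => entropy (starConv c (starPow (bFam l r c n) (j + 1)))) atTop
      (𝓝 0) := fun j => by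
    refine squeeze_zero (fun n => (h.channel.starConv ((hb n).starPow _)).entropy_nonneg)
      (fun n => ?_) h1
    exact (h.channel.entropy_starConv_le ((hb n).starPow _)).trans
      (((hb n).starPow j).entropy_starConv_le (hb n))
  have h4 := (h2.sub h1).add (tendsto_finsetSum l.support fun j _ =>
    (h3 j).const_mul (l.coeff j / ((j : ℝ) + 1)))
  simpa [varPotential] using h4

/-! ### The areas -/

lemma isAbscissa (h : Decodable l r c) {u : ℝ} (hu : -1 ≤ u) :
    IsAbscissa (fun α => entropy (aFam l r c α))
      (fun α => derivWithin (fun t => entropy (aFam l r c t)) (Iic α) α) u where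
  continuousOn := (h.continuousOn_aFam isLinear_entropy).mono (Ici_subset_Ici.2 hu)
  antitoneOn := h.antitoneOn_entropy_aFam.mono (Ici_subset_Ici.2 hu)
  nonneg α hα := (h.isLDensity_aFam (hu.trans hα)).entropy_nonneg
  inj α β hα hβ := h.eq_of_entropy_aFam_eq (hu.trans hα) (hu.trans hβ)
  tendsto := h.tendsto_entropy_aFam
  hasDerivAt := by
    refine ⟨range fun k : ℕ => (k : ℝ), countable_range _, fun α hα hne => ?_⟩
    obtain ⟨k, hk⟩ := exists_mem_Ioc (hu.trans_lt hα)
    have hk' := mem_Ioo_of_ne hk fun k hk => hne ⟨k, hk.symm⟩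
    rw [h.derivWithin_entropy hk]
    exact ((h.aRep k).hasDerivWithinAt isLinear_entropy
      (Ioo_subset_Icc_self hk')).hasDerivAt (Icc_mem_nhds hk'.1 hk'.2)

lemma Ioc_unit_eq (n : ℕ) : Ioc (-1 + (n : ℝ)) (-1 + (n + 1)) = Ioc ((n : ℝ) - 1) n := by
  congr 1 <;> ring

lemma measurable_gCheck (h : Decodable l r c) : Measurable ((Ioi (-1)).indicator (gCheck l r c)) :=
  measurable_indicator_of_unit_intervals fun n => by
    rw [Ioc_unit_eq]
    exact h.continuousOn_gCheck n

lemma measurable_gVar (h : Decodable l r c) : Measurable ((Ioi 0).indicator (gVar l r c)) :=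
  measurable_indicator_of_unit_intervals fun n => by
    rw [zero_add, zero_add]
    exact h.continuousOn_gVar n

lemma ofReal_abs_mul {x y z : ℝ} (hx : x ≤ 0) (h : x * y = z) :
    ENNReal.ofReal |x| * ENNReal.ofReal y = ENNReal.ofReal (-z) := by
  rw [← ENNReal.ofReal_mul (abs_nonneg x), abs_of_nonpos hx, ← h, neg_mul]

lemma regionUnder_checkCurve_eq (l r : Polynomial ℝ) (c : Measure EReal) :
    regionUnder (checkCurve l r c) =
      paramRegion (fun α => entropy (aFam l r c α)) (fun _ => 0) (gCheck l r c) (-1) := by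
  ext ⟨x, y⟩
  constructor
  · rintro ⟨g, ⟨α, hα, he⟩, h1, h2⟩
    obtain ⟨rfl, rfl⟩ := Prod.mk.inj he
    exact ⟨α, hα, rfl, h1, h2⟩
  · rintro ⟨α, hα, he, h1, h2⟩
    exact ⟨gCheck l r c α, ⟨α, hα, Prod.ext he.symm rfl⟩, h1, h2⟩

lemma volume_regionUnder (h : Decodable l r c) :
    NullMeasurableSet (regionUnder (checkCurve l r c)) ∧
      volume (regionUnder (checkCurve l r c)) = ENNReal.ofReal (1 - polyInt r) := by
  rw [regionUnder_checkCurve_eq]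
  obtain ⟨h1, h2⟩ := (h.isAbscissa le_rfl).volume_paramRegion (lo := fun _ => 0)
    (measurable_const.indicator measurableSet_Ioi) h.measurable_gCheck
  refine ⟨h1, h2.trans ?_⟩
  rw [← checkPotential_deltaZero, ← aFam_neg_one l r c]
  refine lintegral_Ioi_of_unit_intervals (Ψ := fun t => checkPotential r (aFam l r c t))
    (ψ := fun k α => h.gexitNum k (bFam l r c (α + 1)) α) (fun k => ?_) (fun k α hα => ?_)
    (fun k α hα => ?_) (fun k α hα => ?_) ?_
  · rw [unit_interval_eq]
    exact (h.continuousOn_gexitNum k (b := fun α => bFam l r c (α + 1)) (s := Ici (-1))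
      fun Φ hΦ => h.continuousOn_bFam_add_one hΦ).mono
      fun α hα => (neg_one_le_cast_sub_one k).trans hα.1
  · rw [unit_interval_eq] at hα ⊢
    exact h.hasDerivWithinAt_checkPotential k hα
  · rw [Ioc_unit_eq] at hα
    exact h.gexitNum_nonpos k
      (h.isLDensity_bFam (by linarith [hα.1, k.cast_nonneg (α := ℝ)])) (Ioc_subset_Icc_self hα)
  · rw [Ioc_unit_eq] at hα
    rw [h.derivWithin_entropy hα, sub_zero]
    exact ofReal_abs_mul (h.d_entropy_nonpos k (Ioc_subset_Icc_self hα)) (h.d_entropy_mul_gCheck hα)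
  -- The parameters start at `-1`, so the limit along `-1 + n` is the limit along the integers
  -- shifted by one.
  · rw [← tendsto_add_atTop_iff_nat 1]
    refine h.tendsto_checkPotential.congr fun n => ?_
    push_cast
    rw [neg_add_cancel_comm_assoc]

lemma regionLeft_varCurve_subset (l r : Polynomial ℝ) (c : Measure EReal) :
    paramRegion (fun α => entropy (aFam l r c α)) (gVar l r c) (fun _ => 1) 0 ⊆
        regionLeft (varCurve l r c) ∧
      regionLeft (varCurve l r c) ⊆
        paramRegion (fun α => entropy (aFam l r c α)) (gVar l r c) (fun _ => 1) 0 ∪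
          {p | p.1 = entropy c} := by
  constructor
  · rintro ⟨x, y⟩ ⟨α, hα, he, h1, h2⟩
    exact ⟨gVar l r c α, ⟨α, hα.le, Prod.ext he.symm rfl⟩, h1, h2⟩
  · rintro ⟨x, y⟩ ⟨g, ⟨α, hα, he⟩, h1, h2⟩
    obtain ⟨rfl, rfl⟩ := Prod.mk.inj he
    rcases (mem_Ici.1 hα).eq_or_lt with rfl | hα
    · exact Or.inr (by simp only [mem_ofPred_eq, aFam_zero])
    · exact Or.inl ⟨α, hα, rfl, h1, h2⟩

/-- Opening the parameter range at `0` loses at most a vertical segment over `H(c)`. The integrand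
`|H'| (1 - G)` is minus the derivative of `H(a ⊠ b)` in its first argument, hence minus that of the
variable-node potential. -/
lemma volume_regionLeft (h : Decodable l r c) :
    NullMeasurableSet (regionLeft (varCurve l r c)) ∧
      volume (regionLeft (varCurve l r c)) = ENNReal.ofReal (entropy c * polyInt l) := by
  have hprob := h.channel.prob
  obtain ⟨hsub, hsub'⟩ := regionLeft_varCurve_subset l r c
  obtain ⟨h1, h2⟩ := (h.isAbscissa (by norm_num : (-1 : ℝ) ≤ 0)).volume_paramRegion
    (up := fun _ => 1) h.measurable_gVar (measurable_const.indicator measurableSet_Ioi)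
  have hae : paramRegion (fun α => entropy (aFam l r c α)) (gVar l r c) (fun _ => 1) 0 =ᵐ[volume]
      regionLeft (varCurve l r c) := by
    refine (ae_le_set.2 ?_ : _ ≤ᵐ[volume] _).antisymm (ae_le_set.2 ?_)
    · rw [sdiff_eq_empty.2 hsub, measure_empty]
    · exact measure_mono_null (fun p hp => (hsub' hp.1).resolve_left hp.2)
        (volume_vertical_line (entropy c))
  refine ⟨h1.congr hae, ?_⟩
  rw [← measure_congr hae, h2, ← varPotential_deltaZero, ← h.bFam_zero]
  have hΨ0 : varPotential l c c (bFam l r c 0) =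
      (fun t => varPotential l c (aFam l r c t) (bFam l r c t)) 0 := by
    simp only [aFam_zero]
  rw [hΨ0]
  refine lintegral_Ioi_of_unit_intervals (u := 0)
    (Ψ := fun t => varPotential l c (aFam l r c t) (bFam l r c t))
    (ψ := fun k α => (h.aRep (k + 1)).d (fun a => entropy (LDPC.checkConv a (bFam l r c α))) α)
    (fun k => ?_) (fun k α hα => ?_) (fun k α hα => ?_) (fun k α hα => ?_) ?_
  · rw [zero_add, zero_add]
    exact continuousOn_finsetSum _ fun i _ =>
      (((h.aRep (k + 1)).p i).derivative.continuous.continuousOn).mul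
        ((h.continuousOn_bFam (isLinear_entropy_checkConv ((h.aRep (k + 1)).ld i))).mono
          fun α hα => k.cast_nonneg.trans hα.1)
  · rw [zero_add, zero_add] at hα ⊢
    exact h.hasDerivWithinAt_varPotential k hα
  all_goals try
    have hα' : α ∈ Ioc (((k + 1 : ℕ) : ℝ) - 1) ((k + 1 : ℕ) : ℝ) := by
      push_cast
      constructor <;> linarith [hα.1, hα.2]
    have hα0 : 0 ≤ α := by linarith [hα.1, k.cast_nonneg (α := ℝ)]
    have hb := h.isLDensity_bFam hα0
    have hd := (h.aRep (k + 1)).d_starConv hb α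
  · have h3 := h.d_entropy_le_gexitNum (k + 1) hb (Ioc_subset_Icc_self hα')
    unfold gexitNum at h3
    linarith
  · rw [h.derivWithin_entropy hα']
    refine ofReal_abs_mul (h.d_entropy_nonpos (k + 1) (Ioc_subset_Icc_self hα')) ?_
    have h3 := h.d_entropy_mul_gVar hα' hα0
    unfold gexitNum at h3
    rw [mul_sub, h3, hd]
    ring
  · simpa only [zero_add] using h.tendsto_varPotential

/-- At a positive common abscissa both regions use the same parameter by injectivity, so a common
point lies between `gVar` below and `gCheck` above, where there is no room up to a null set. What
remains is contained in the vertical lines over `0` and `H(c)`. -/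
lemma volume_inter (h : Decodable l r c) :
    volume (regionUnder (checkCurve l r c) ∩ regionLeft (varCurve l r c)) = 0 := by
  have hmeas : Measurable ((Ioi 0).indicator (gCheck l r c)) := by
    have : (Ioi (0 : ℝ)).indicator (gCheck l r c) =
        (Ioi 0).indicator ((Ioi (-1)).indicator (gCheck l r c)) := by
      rw [indicator_indicator, inter_eq_left.2 (Ioi_subset_Ioi (by norm_num))]
    rw [this]
    exact h.measurable_gCheck.indicator measurableSet_Ioi
  have h1 := ((h.isAbscissa (by norm_num : (-1 : ℝ) ≤ 0)).volume_paramRegion h.measurable_gVar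
    hmeas).2
  have h2 : volume (paramRegion (fun α => entropy (aFam l r c α)) (gVar l r c) (gCheck l r c) 0) =
      0 := by
    rw [h1]
    refine (setLIntegral_congr_fun measurableSet_Ioi fun α hα => ?_).trans lintegral_zero
    rw [ENNReal.ofReal_of_nonpos (p := gCheck l r c α - gVar l r c α)
      (by linarith [h.gCheck_le_gVar (mem_Ioi.1 hα).le]), mul_zero]
  refine measure_mono_null (fun p hp => ?_) (measure_union_null (measure_union_null h2
    (volume_vertical_line 0)) (volume_vertical_line (entropy c)))
  rw [regionUnder_checkCurve_eq] at hp
  obtain ⟨⟨α, hα, he, _, h3⟩, hleft⟩ := hp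
  rcases (regionLeft_varCurve_subset l r c).2 hleft with ⟨β, hβ, he', h4, _⟩ | h5
  · left
    rcases eq_or_ne p.1 0 with h0 | h0
    · exact Or.inr h0
    · left
      have he : p.1 = entropy (aFam l r c α) := he
      have hβ1 : -1 ≤ β := by linarith
      have hpos : 0 < entropy (aFam l r c α) :=
        lt_of_le_of_ne (h.isLDensity_aFam hα.le).entropy_nonneg fun h' => h0 (he.trans h'.symm)
      have := h.eq_of_entropy_aFam_eq hα.le hβ1 (he.symm.trans he') hpos
      subst this
      exact ⟨α, hβ, he, h4, h3⟩
  · exact Or.inr h5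

end Decodable

/-! ### The rate bound and the area of the gap -/

lemma IsDegreeDistribution.polyInt_pos {p : Polynomial ℝ} (hp : IsDegreeDistribution p) :
    0 < polyInt p := by
  rw [polyInt_eq_sum]
  refine Finset.sum_pos (fun j hj => ?_) ?_
  · have : 0 < p.coeff j := lt_of_le_of_ne (hp.1 j) (Polynomial.mem_support_iff.1 hj).symm
    positivity
  · by_contra hne
    have := hp.sum_coeff
    simp [Finset.not_nonempty_iff_eq_empty.1 hne] at this

lemma IsDegreeDistribution.polyInt_le_one {p : Polynomial ℝ} (hp : IsDegreeDistribution p) :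
    polyInt p ≤ 1 := by
  rw [polyInt_eq_sum]
  exact (Finset.sum_le_sum fun j _ => div_le_self (hp.1 j)
    (by linarith [j.cast_nonneg (α := ℝ)])).trans_eq hp.sum_coeff

namespace Decodable

variable {l r : Polynomial ℝ} {c : Measure EReal}

lemma entropy_aFam_mem (h : Decodable l r c) {α : ℝ} (hα : -1 ≤ α) :
    entropy (aFam l r c α) ∈ Icc (0 : ℝ) 1 := by
  refine ⟨(h.isLDensity_aFam hα).entropy_nonneg, ?_⟩
  have := h.antitoneOn_entropy_aFam self_mem_Ici hα hα
  simpa only [aFam_neg_one, entropy_deltaZero] using this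

lemma regionUnder_subset (h : Decodable l r c) :
    regionUnder (checkCurve l r c) ⊆ Icc 0 1 ×ˢ Icc 0 1 := by
  rw [regionUnder_checkCurve_eq]
  rintro ⟨x, y⟩ ⟨α, hα, he, h1, h2⟩
  simp only at he h1 h2
  exact ⟨he ▸ h.entropy_aFam_mem hα.le, h1, h2.trans (h.gCheck_mem hα).2⟩

lemma regionLeft_subset (h : Decodable l r c) :
    regionLeft (varCurve l r c) ⊆ Icc 0 1 ×ˢ Icc 0 1 := by
  rintro ⟨x, y⟩ ⟨g, ⟨α, hα, he⟩, h1, h2⟩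
  obtain ⟨rfl, rfl⟩ := Prod.mk.inj he
  have hα : 0 ≤ α := hα
  exact ⟨h.entropy_aFam_mem (by linarith), (h.gVar_mem hα).1.trans h1, h2⟩

/-- The two regions are almost disjoint inside a box of area one, so their areas add; comparison
with the box gives the inequality and the complement gives the gap. -/
lemma volume_gapRegion (h : Decodable l r c) :
    1 - polyInt r + entropy c * polyInt l ≤ 1 ∧ volume (gapRegion l r c) =
      ENNReal.ofReal (1 - (1 - polyInt r + entropy c * polyInt l)) := by
  obtain ⟨h1, h2⟩ := h.volume_regionUnder
  obtain ⟨h3, h4⟩ := h.volume_regionLeft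
  have hr := h.right.polyInt_le_one
  have hl := mul_nonneg h.channel.entropy_nonneg h.left.polyInt_pos.le
  have hU : volume (regionUnder (checkCurve l r c) ∪ regionLeft (varCurve l r c)) =
      ENNReal.ofReal (1 - polyInt r + entropy c * polyInt l) := by
    rw [measure_union₀ h3 h.volume_inter, h2, h4, ENNReal.ofReal_add (by linarith) hl]
  have hbox : volume (Icc (0 : ℝ) 1 ×ˢ Icc (0 : ℝ) 1) = 1 := by
    rw [Measure.volume_eq_prod, Measure.prod_prod, Real.volume_Icc]
    simp
  have hsub := union_subset h.regionUnder_subset h.regionLeft_subset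
  refine ⟨?_, ?_⟩
  · have := measure_mono (μ := volume) hsub
    rwa [hU, hbox, ENNReal.ofReal_le_one] at this
  · rw [gapRegion, measure_sdiff hsub (h1.union h3) (by rw [hU]; exact ENNReal.ofReal_ne_top), hU,
      hbox, ENNReal.ofReal_sub _ (by linarith), ENNReal.ofReal_one]

lemma gap_eq (h : Decodable l r c) :
    polyInt l * ((1 - entropy c) - designRate l r) =
      1 - (1 - polyInt r + entropy c * polyInt l) := by
  have := h.left.polyInt_pos.ne'
  rw [designRate]
  field_simp
  ring

lemma designRate_le (h : Decodable l r c) : designRate l r ≤ 1 - entropy c := by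
  have h1 := h.volume_gapRegion.1
  have h2 := h.gap_eq
  have h3 := h.left.polyInt_pos
  by_contra! hlt
  nlinarith

lemma volume_gapRegion_eq (h : Decodable l r c) : volume (gapRegion l r c) =
    ENNReal.ofReal (polyInt l * ((1 - entropy c) - designRate l r)) := by
  rw [h.gap_eq]
  exact h.volume_gapRegion.2

end Decodable

end LDPC

theorem mainTheorem1 :
    (∀ (l r : Polynomial ℝ) (c : Measure EReal), Decodable l r c →
      -- the families interpolate density evolution and satisfy its recursions
      (∀ n : ℕ, aFam l r c n = densityEvolution l r c n) ∧
      (∀ α : ℝ, -1 ≤ α → bFam l r c (α + 1) = checkOut r (aFam l r c α)) ∧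
      (∀ α : ℝ, 0 ≤ α → aFam l r c α = varOut l c (bFam l r c α)) ∧
      -- all their members are L-densities
      (∀ α : ℝ, -1 ≤ α → IsLDensity (aFam l r c α)) ∧
      (∀ α : ℝ, 0 ≤ α → IsLDensity (bFam l r c α)) ∧
      -- the families are complete, and every positive entropy value is attained by one parameter
      ContinuousOn (fun α => entropy (aFam l r c α)) (Ici (-1)) ∧
      AntitoneOn (fun α => entropy (aFam l r c α)) (Ici (-1)) ∧
      (∀ h ∈ Ioc (0 : ℝ) 1, ∃! α : ℝ, -1 ≤ α ∧ entropy (aFam l r c α) = h) ∧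
      ContinuousOn (fun α => entropy (bFam l r c α)) (Ici 0) ∧
      AntitoneOn (fun α => entropy (bFam l r c α)) (Ici 0) ∧
      (∀ h ∈ Ioc (0 : ℝ) 1, ∃! α : ℝ, 0 ≤ α ∧ entropy (bFam l r c α) = h) ∧
      -- the GEXIT kernels and functionals are well defined along the families
      (∀ (α : ℝ) (z : ℝ), -1 < α →
        DifferentiableWithinAt ℝ (gexitPotential (aFam l r c) z) (Iic α) α) ∧
      (∀ (α : ℝ) (z : ℝ), -1 < α → (∀ k : ℕ, α ≠ k) →
        DifferentiableAt ℝ (gexitPotential (aFam l r c) z) α) ∧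
      (∀ α : ℝ, -1 < α → 0 < entropy (aFam l r c α) →
        derivWithin (fun t => entropy (aFam l r c t)) (Iic α) α < 0) ∧
      (∀ α : ℝ, -1 < α →
        Integrable (gexitKernel (aFam l r c) α) (bFam l r c (α + 1))) ∧
      (∀ α : ℝ, 0 ≤ α → Integrable (gexitKernel (aFam l r c) α) (bFam l r c α)) ∧
      -- the two curves are piecewise continuous and lie in the unit box
      (∀ k : ℕ, ContinuousOn (gCheck l r c) (Ioc ((k : ℝ) - 1) k)) ∧
      (∀ k : ℕ, ContinuousOn (gVar l r c) (Ioc (k : ℝ) (k + 1))) ∧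
      (∀ α : ℝ, -1 < α → gCheck l r c α ∈ Icc (0 : ℝ) 1) ∧
      (∀ α : ℝ, 0 ≤ α → gVar l r c α ∈ Icc (0 : ℝ) 1) ∧
      -- the two curves do not overlap
      (∀ α : ℝ, 0 ≤ α → gCheck l r c α ≤ gVar l r c α) ∧
      volume (regionUnder (checkCurve l r c) ∩ regionLeft (varCurve l r c)) = 0 ∧
      -- the areas
      0 ≤ 1 - polyInt r ∧
      volume (regionUnder (checkCurve l r c)) = ENNReal.ofReal (1 - polyInt r) ∧
      0 ≤ entropy c * polyInt l ∧
      volume (regionLeft (varCurve l r c)) = ENNReal.ofReal (entropy c * polyInt l) ∧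
      -- the bound on the rate
      0 < polyInt l ∧
      designRate l r ≤ 1 - entropy c ∧
      -- the area between the curves is proportional to the gap to capacity
      volume (gapRegion l r c) =
        ENNReal.ofReal (polyInt l * ((1 - entropy c) - designRate l r))) ∧
    -- approaching capacity forces the two curves to match perfectly
    (∀ (l r : ℕ → Polynomial ℝ) (c : ℕ → Measure EReal),
      (∀ n, Decodable (l n) (r n) (c n)) →
      Tendsto (fun n => (1 - entropy (c n)) - designRate (l n) (r n)) atTop (𝓝 0) →
      Tendsto (fun n => volume (gapRegion (l n) (r n) (c n))) atTop (𝓝 0)) := by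
  refine ⟨fun l r c h => ⟨fun n => aFam_natCast l r c n, fun α _ => bFam_add_one l r c α,
    fun α hα => h.aFam_eq_varOut hα, fun α hα => h.isLDensity_aFam hα,
    fun α hα => h.isLDensity_bFam hα, h.continuousOn_aFam isLinear_entropy,
    h.antitoneOn_entropy_aFam, fun y hy => ?_, h.continuousOn_bFam isLinear_entropy,
    h.antitoneOn_entropy_bFam, fun y hy => ?_,
    fun α z hα => h.differentiableWithinAt_gexitPotential z hα,
    fun α z hα hne => h.differentiableAt_gexitPotential z hα hne,
    fun α hα hpos => h.derivWithin_entropy_neg hα hpos, fun α hα => ?_, fun α hα => ?_,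
    h.continuousOn_gCheck, h.continuousOn_gVar, fun α hα => h.gCheck_mem hα,
    fun α hα => h.gVar_mem hα, fun α hα => h.gCheck_le_gVar hα, h.volume_inter,
    sub_nonneg.2 h.right.polyInt_le_one, h.volume_regionUnder.2,
    mul_nonneg h.channel.entropy_nonneg h.left.polyInt_pos.le, h.volume_regionLeft.2,
    h.left.polyInt_pos, h.designRate_le, h.volume_gapRegion_eq⟩, fun l r c h hlim => ?_⟩
  · exact existsUnique_of_antitoneOn (h.continuousOn_aFam isLinear_entropy)
      (by simp only [aFam_neg_one, entropy_deltaZero]) h.tendsto_entropy_aFam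
      (fun x y hx hx' he hpos => h.eq_of_entropy_aFam_eq hx hx' he hpos) hy
  · exact existsUnique_of_antitoneOn (h.continuousOn_bFam isLinear_entropy)
      (by simp only [h.bFam_zero, entropy_deltaZero]) h.tendsto_entropy_bFam
      (fun x y hx hx' he hpos => h.eq_of_entropy_bFam_eq hx hx' he hpos) hy
  · obtain ⟨k, hk⟩ := exists_mem_Ioc hα
    exact (h.aRep k).integrable_gexitKernel hk (h.isLDensity_bFam (by linarith))
  · obtain ⟨k, hk⟩ := exists_mem_Ioc (by linarith : -1 < α)
    exact (h.aRep k).integrable_gexitKernel hk (h.isLDensity_bFam hα)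
  -- The area of the gap is `∫λ` times the distance to capacity; `∫λ ≤ 1` uniformly in `n` and the
  -- rate bound makes the distance nonnegative, so the squeeze applies.
  · have h1 := ENNReal.tendsto_ofReal hlim
    rw [ENNReal.ofReal_zero] at h1
    refine tendsto_of_tendsto_of_tendsto_of_le_of_le tendsto_const_nhds h1
      (fun _ => zero_le) fun n => ?_
    rw [(h n).volume_gapRegion_eq]
    exact ENNReal.ofReal_le_ofReal (mul_le_of_le_one_left
      (by linarith [(h n).designRate_le]) (h n).left.polyInt_le_one)
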